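/- **Conventions.** A mould $Z$ with values in a commutative $\mathbb Q$-algebra $\mathcal A$ is a family $Z(X_1,\dots,X_r)\in\mathcal A[[X_1,\dots,X_r]]$, $r\ge 0$, with coefficients $z$ given by $Z(X_1,\dots,X_r)=\sum_{k_1,\dots,k_r\ge1} z(k_1,\dots,k_r)X_1^{k_1-1}\cdots X_r^{k_r-1}$. A bimould is a family $B\binom{X_1,\dots,X_r}{Y_1,\dots,Y_r}\in\mathcal A[[X_1,\dots,X_r,Y_1,\dots,Y_r]]$, $r\ge0$. Products are $(B\times C)\binom{X_1,\dots,X_r}{Y_1,\dots,Y_r}=\sum_{j=0}^r B\binom{X_1,\dots,X_j}{Y_1,\dots,Y_j}C\binom{X_{j+1},\dots,X_r}{Y_{j+1},\dots,Y_r}$, and similarly for moulds. A power series $\sum a_rT^r$ is also regarded as the constant (bi)mould equal to $a_r$ in depth $r$. Let $\mathfrak H^1=\mathbb Q\langle z_k\mid k\ge1\rangle$. For a bilinear commutative associative product $\diamond$ on $\bigoplus_k\mathbb Q z_k$ the quasi-shuffle product $*_\diamond$ on $\mathfrak H^1$ is given by $\mathbf 1*_\diamond w=w*_\diamond\mathbf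 1=w$ and $aw*_\diamond bv=a(w*_\diamond bv)+b(aw*_\diamond v)+(a\diamond b)(w*_\diamond v)$. The stuffle product $*$ is the case $z_i\diamond z_j=z_{i+j}$. A mould $Z$ is symmetril (resp. symmetral) if the linear map with $\mathbf 1\mapsto 1$, $z_{k_1}\cdots z_{k_r}\mapsto z(k_1,\dots,k_r)$ is an algebra homomorphism for $*_\diamond$ with $z_i\diamond z_j=z_{i+j}$ (resp. $z_i\diamond z_j=0$), and the depth $0$ part of $Z$ is $1$. Put $Z^\sharp(X_1,\dots,X_r)=Z(X_1+\dots+X_r,\dots,X_1+X_2,X_1)$ and $Z_\gamma=Z^\sharp\times\exp\big(\sum_{n\ge2}\frac{(-1)^n}{n}z(n)T^n\big)$. The mould $Z$ satisfies the extended double shuffle equations if $Z$ is symmetril and $Z_\gamma$ is symmetral. **The series $G$.** Fix a $\mathbb Q$-valued mould $\mathfrak b$ with coefficients $\beta(k_1,\dots,k_r)$ which satisfies the extended double shuffle equations and has $\beta(1)=0$ and $\beta(k)=-\frac{B_k}{2\,k!}$ for $k\ge2$. For a mould $Z$ let $X^Z\binom{X_1,\dots,X_r}{Y_1,\dots,Y_r}=Z(X_1,\dots,X_r)$,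 $Y^Z\binom{X_1,\dots,X_r}{Y_1,\dots,Y_r}=Z(Y_1,\dots,Y_r)$ and $Z^-(X_1,\dots,X_r)=Z(-X_1,\dots,-X_r)$. Define the bimoulds $\mathfrak b=Y^{\mathfrak b_\gamma}\times X^{\mathfrak b}$ (also denoted $\mathfrak b$), $\tilde{\mathfrak b}=Y^{\mathfrak b_\gamma^-}\times\exp(-\tfrac T2)\times X^{\mathfrak b}$ and, for $m\ge1$, with $L_m\binom XY=\frac{e^{X+mY}q^m}{1-e^Xq^m}$, the $\mathbb Q[[q]]$-valued bimould $\mathfrak L_m$ which is $1$ in depth $0$ and, in depth $r\ge1$, $$\mathfrak L_m\binom{X_1,\dots,X_r}{Y_1,\dots,Y_r}=\sum_{j=1}^r\mathfrak b\binom{X_1-X_j,\dots,X_{j-1}-X_j}{Y_1,\dots,Y_{j-1}}\,L_m\binom{X_j}{Y_1+\dots+Y_r}\,\tilde{\mathfrak b}\binom{X_r-X_j,\dots,X_{j+1}-X_j}{Y_r,\dots,Y_{j+1}}.$$ Let $\mathfrak g^*$ be the bimould which is $1$ in depth $0$ and, in depth $r\ge1$, $$\mathfrak g^*\binom{X_1,\dots,X_r}{Y_1,\dots,Y_r}=\sum_{\substack{1\le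 j\le r,\ 0=r_0<r_1<\dots<r_j=r\\ m_1>\dots>m_j>0}}\ \prod_{i=1}^j\mathfrak L_{m_i}\binom{X_{r_{i-1}+1},\dots,X_{r_i}}{Y_{r_{i-1}+1},\dots,Y_{r_i}},$$ and let $\mathfrak G=\mathfrak g^*\times\mathfrak b$. The combinatorial multiple Eisenstein series $G(k_1,\dots,k_r)\in\mathbb Q[[q]]$ is the coefficient of $X_1^{k_1-1}\cdots X_r^{k_r-1}Y_1^0\cdots Y_r^0$ in $\mathfrak G$. Extend $G$ linearly to $\mathfrak H^1$ by $G(z_{k_1}\cdots z_{k_r})=G(k_1,\dots,k_r)$. **Regularization.** Let $\mathfrak H^0\subset\mathfrak H^1$ be the span of the words (including $\mathbf 1$) which do not start with $z_1$. Every $w=z_{k_1}\cdots z_{k_r}$ can be written uniquely as a finite sum $w=\sum_{j\ge0}w_j*z_1^{*j}$ with $w_j\in\mathfrak H^0$; define $${\lim_{q\to1}}^{*}(1-q)^{k_1+\dots+k_r}G(k_1,\dots,k_r):=\lim_{q\to1^-}(1-q)^{k_1+\dots+k_r}G(w_0),\qquad q\in(0,1).$$ There is a unique $\mathbb Q$-linear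 map $\zeta^*:\mathfrak H^1\to\mathbb R$ which is an algebra homomorphism for the stuffle product, satisfies $\zeta^*(z_1)=0$, and maps each word $z_{k_1}\cdots z_{k_r}$ not starting with $z_1$ to the convergent series $\sum_{m_1>\dots>m_r>0}m_1^{-k_1}\cdots m_r^{-k_r}$; write $\zeta^*(k_1,\dots,k_r)=\zeta^*(z_{k_1}\cdots z_{k_r})$. **Proposition 5.12.** For all $k_1,\dots,k_r\ge1$, the constant term of $G(k_1,\dots,k_r)$ is $\beta(k_1,\dots,k_r)$; the $q$-series $G(k_1,\dots,k_r)$ converges for all real $|q|<1$, and $\lim_{q\to0}G(k_1,\dots,k_r)=\beta(k_1,\dots,k_r)$. Moreover the regularized limit below exists and $${\lim_{q\to1}}^{*}(1-q)^{k_1+\dots+k_r}G(k_1,\dots,k_r)=\zeta^*(k_1,\dots,k_r).$$ (The existence and uniqueness claims under Regularization are part of the assertion.) -/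

import Mathlib

open Filter
open scoped Topology

namespace CombMES

noncomputable section

/-! ### Quasi-shuffle algebras -/

/-- The underlying vector space of `ℚ⟨L⟩`: formal linear combinations of words in the letters `L`.
The empty word is the list `[]`. -/
abbrev Words (L : Type) : Type := List L →₀ ℚ

/-- A word, as an element of `ℚ⟨L⟩`. -/
def word {L : Type} (w : List L) : Words L := Finsupp.single w 1

/-- Left concatenation with the letter `a`. -/
def prepend {L : Type} (a : L) (x : Words L) : Words L := Finsupp.mapDomain (List.cons a) x

/-- The quasi-shuffle product of two words, for a product `d` on the space `ℚL` spanned by the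
letters (given by its values on letters):
`aw * bv = a (w * bv) + b (aw * v) + (a ⋄ b) (w * v)`. -/
def qsh {L : Type} (d : L → L → (L →₀ ℚ)) : List L → List L → Words L
  | [], v => word v
  | a :: w, [] => word (a :: w)
  | a :: w, b :: v =>
      prepend a (qsh d w (b :: v)) + prepend b (qsh d (a :: w) v)
        + (d a b).sum (fun c t => t • prepend c (qsh d w v))
termination_by w v => w.length + v.length

/-- The quasi-shuffle product, extended bilinearly to `ℚ⟨L⟩`. -/
def qmul {L : Type} (d : L → L → (L →₀ ℚ)) (x y : Words L) : Words L :=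
  x.sum fun w s => y.sum fun v t => (s * t) • qsh d w v

/-- A linear map `φ` is a (unital) algebra homomorphism for the quasi-shuffle product of `d`. -/
def IsQuasiShuffleHom {L A : Type} [CommRing A] [Algebra ℚ A] (d : L → L → (L →₀ ℚ))
    (φ : Words L →ₗ[ℚ] A) : Prop :=
  φ (word []) = 1 ∧ ∀ x y : Words L, φ (qmul d x y) = φ x * φ y

/-- `z_i ⋄ z_j = z_{i+j}`: the letter `z_k` is `k : ℕ+`, and `Words ℕ+` is `𝔥¹`. -/
def stuffleLetters (i j : ℕ+) : ℕ+ →₀ ℚ := Finsupp.single (i + j) 1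

/-- `z_i ⋄ z_j = 0`. -/
def shuffleLetters (_ _ : ℕ+) : ℕ+ →₀ ℚ := 0

/-- The stuffle product on `𝔥¹`. -/
def stuffle (x y : Words ℕ+) : Words ℕ+ := qmul stuffleLetters x y

/-- The stuffle power `z_1 * ⋯ * z_1` (`j` factors). -/
def stufflePow : ℕ → Words ℕ+
  | 0 => word []
  | j + 1 => stuffle (word [1]) (stufflePow j)

/-- A word that does not start with `z_1` (the empty word is admissible). -/
def Admissible (ks : List ℕ+) : Prop := ks.head? ≠ some 1

/-- `𝔥⁰`, spanned by the words that do not start with `z_1`. -/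
def H0 : Submodule ℚ (Words ℕ+) := Submodule.span ℚ (word '' {ks | Admissible ks})

/-! ### Moulds and bimoulds -/

/-- A mould with values in `A`: a power series in `X_1, …, X_r` for each depth `r`. -/
def Mould (A : Type) : Type := (r : ℕ) → MvPowerSeries (Fin r) A

/-- A bimould with values in `A`: a power series in `X_1, …, X_r` (the variables `Sum.inl i`) and
`Y_1, …, Y_r` (the variables `Sum.inr i`) for each depth `r`. -/
def Bimould (A : Type) : Type := (r : ℕ) → MvPowerSeries (Fin r ⊕ Fin r) A

section General

variable {A : Type} [CommRing A]

/-- `Z.ev n x` is `Z(x 0, …, x (n-1))`, by substitution into the depth `n` part. It is only used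
for finitely many series `x i` without constant term. -/
def Mould.ev {σ : Type} (Z : Mould A) (n : ℕ) (x : ℕ → MvPowerSeries σ A) : MvPowerSeries σ A :=
  MvPowerSeries.subst (fun i : Fin n => x i) (Z n)

/-- `B.ev n x y` is the bimould `B` at `x 0, …, x (n-1)` (upper row) and `y 0, …, y (n-1)`
(lower row). -/
def Bimould.ev {σ : Type} (B : Bimould A) (n : ℕ) (x y : ℕ → MvPowerSeries σ A) :
    MvPowerSeries σ A :=
  MvPowerSeries.subst (Sum.elim (fun i : Fin n => x i) (fun i : Fin n => y i)) (B n)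

/-- The variables of a mould in depth `r`, counted from `0` (and `0` beyond the depth). -/
def X1 (A : Type) [CommRing A] (r : ℕ) (i : ℕ) : MvPowerSeries (Fin r) A :=
  if h : i < r then MvPowerSeries.X ⟨i, h⟩ else 0

/-- The upper variables of a bimould in depth `r`, counted from `0`. -/
def XX (A : Type) [CommRing A] (r : ℕ) (i : ℕ) : MvPowerSeries (Fin r ⊕ Fin r) A :=
  if h : i < r then MvPowerSeries.X (Sum.inl ⟨i, h⟩) else 0

/-- The lower variables of a bimould in depth `r`, counted from `0`. -/
def YY (A : Type) [CommRing A] (r : ℕ) (i : ℕ) : MvPowerSeries (Fin r ⊕ Fin r) A :=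
  if h : i < r then MvPowerSeries.X (Sum.inr ⟨i, h⟩) else 0

/-- The coefficient `z(k_1, …, k_r)` of a mould, i.e. that of `X_1^{k_1-1} ⋯ X_r^{k_r-1}`. -/
def Mould.coeff (Z : Mould A) (ks : List ℕ+) : A :=
  MvPowerSeries.coeff
    (Finsupp.equivFunOnFinite.symm fun i : Fin ks.length => ((ks.get i : ℕ) - 1)) (Z ks.length)

/-- The coefficient of a bimould with upper indices `k_i ≥ 1` and lower indices `d_i ≥ 0`, i.e. that
of `X_1^{k_1-1} ⋯ X_r^{k_r-1} (Y_1^{d_1} / d_1!) ⋯ (Y_r^{d_r} / d_r!)`. -/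
def Bimould.coeff (B : Bimould A) (w : List (ℕ+ × ℕ)) : A :=
  ((w.map fun p => (p.2.factorial : A)).prod) *
    MvPowerSeries.coeff
      (Finsupp.equivFunOnFinite.symm
        (Sum.elim (fun i : Fin w.length => (((w.get i).1 : ℕ) - 1))
          (fun i : Fin w.length => (w.get i).2))) (B w.length)

/-- The product of moulds. -/
def Mould.mul (Z W : Mould A) : Mould A := fun r =>
  ∑ j ∈ Finset.range (r + 1), Z.ev j (X1 A r) * W.ev (r - j) (fun i => X1 A r (j + i))

/-- The product of bimoulds. -/
def Bimould.mul (B C : Bimould A) : Bimould A := fun r =>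
  ∑ j ∈ Finset.range (r + 1),
    B.ev j (XX A r) (YY A r) * C.ev (r - j) (fun i => XX A r (j + i)) (fun i => YY A r (j + i))

/-- A power series `∑ a_r T^r` as a constant mould. -/
def constMould (F : PowerSeries A) : Mould A := fun r => MvPowerSeries.C (PowerSeries.coeff r F)

/-- A power series `∑ a_r T^r` as a constant bimould. -/
def constBimould (F : PowerSeries A) : Bimould A :=
  fun r => MvPowerSeries.C (PowerSeries.coeff r F)

/-- `Z^♯(X_1, …, X_r) = Z(X_1 + ⋯ + X_r, …, X_1 + X_2, X_1)`. -/
def Mould.sharp (Z : Mould A) : Mould A := fun r =>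
  Z.ev r (fun i => ∑ t ∈ Finset.range (r - i), X1 A r t)

/-- `Z^-(X_1, …, X_r) = Z(-X_1, …, -X_r)`. -/
def Mould.minus (Z : Mould A) : Mould A := fun r => Z.ev r (fun i => -X1 A r i)

/-- The bimould `X^Z`, which is `Z` in the upper variables. -/
def Mould.upper (Z : Mould A) : Bimould A := fun r =>
  MvPowerSeries.subst (fun i : Fin r => XX A r i) (Z r)

/-- The bimould `Y^Z`, which is `Z` in the lower variables. -/
def Mould.lower (Z : Mould A) : Bimould A := fun r =>
  MvPowerSeries.subst (fun i : Fin r => YY A r i) (Z r)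

variable [Algebra ℚ A]

/-- The coefficient map `𝔥¹ → A`, `z_{k_1} ⋯ z_{k_r} ↦ z(k_1, …, k_r)`. -/
def Mould.coeffMap (Z : Mould A) : Words ℕ+ →ₗ[ℚ] A := Finsupp.linearCombination ℚ Z.coeff

/-- A mould is symmetril if its coefficient map is a homomorphism for the stuffle product. The
condition on the unit says that its depth `0` part is `1`. -/
def Mould.IsSymmetril (Z : Mould A) : Prop := IsQuasiShuffleHom stuffleLetters Z.coeffMap

/-- A mould is symmetral if its coefficient map is a homomorphism for the shuffle product of the
alphabet `{z_k}`. -/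
def Mould.IsSymmetral (Z : Mould A) : Prop := IsQuasiShuffleHom shuffleLetters Z.coeffMap

/-- The power series `exp (∑_{n ≥ 2} (-1)^n / n * z(n) T^n)`. -/
def Mould.Gam (Z : Mould A) : PowerSeries A :=
  PowerSeries.subst
    (PowerSeries.mk fun n : ℕ =>
      if h : 2 ≤ n then ((-1 : ℚ) ^ n / n) • Z.coeff [⟨n, by omega⟩] else 0 : PowerSeries A)
    (PowerSeries.exp A)

/-- `Z_γ = Z^♯ × Γ^Z`. -/
def Mould.gam (Z : Mould A) : Mould A := Z.sharp.mul (constMould Z.Gam)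

/-- `Z` satisfies the extended double shuffle equations. -/
def Mould.IsEDS (Z : Mould A) : Prop := Z.IsSymmetril ∧ Z.gam.IsSymmetral

/-- The bimould `B^Z = Y^{Z_γ} × X^Z`. -/
def Mould.toBimould (Z : Mould A) : Bimould A := Z.gam.lower.mul Z.upper

/-- The bimould `Y^{Z_γ^-} × exp(-T/2) × X^Z`. -/
def Mould.tildeBimould (Z : Mould A) : Bimould A :=
  (Z.gam.minus.lower.mul
    (constBimould (PowerSeries.mk fun i : ℕ => algebraMap ℚ A ((-1) ^ i / (2 ^ i * i.factorial))))).mul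
      Z.upper

end General

/-- A `ℚ`-valued bimould, seen as a bimould with values in `ℚ⟦q⟧`. -/
def Bimould.toQ (B : Bimould ℚ) : Bimould (PowerSeries ℚ) :=
  fun r => MvPowerSeries.map (PowerSeries.C : ℚ →+* PowerSeries ℚ) (B r)

/-- The depth one part of the mould is `∑_{k ≥ 2} -B_k / (2 k!) X^{k-1}`. -/
def Mould.HasBernoulliDepthOne (b : Mould ℚ) : Prop :=
  ∀ k : ℕ+, b.coeff [k] =
    if k = 1 then 0 else -bernoulli (k : ℕ) / (2 * ((k : ℕ).factorial : ℚ))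

/-! ### Combinatorial multiple Eisenstein series -/

/-- `L_m(x; y) = e^{x + m y} q^m / (1 - e^x q^m)`. The denominator is invertible for `m ≥ 1`: its
constant term is the unit `1 - q^m` of `ℚ⟦q⟧`. -/
def Lm {σ : Type} (m : ℕ) (x y : MvPowerSeries σ (PowerSeries ℚ)) :
    MvPowerSeries σ (PowerSeries ℚ) :=
  PowerSeries.subst (x + m • y) (PowerSeries.exp ℚ) * MvPowerSeries.C (PowerSeries.X ^ m) *
    Ring.inverse (1 - PowerSeries.subst x (PowerSeries.exp ℚ) * MvPowerSeries.C (PowerSeries.X ^ m))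

/-- The bimould `𝔏_m` attached to `b`; with `j` counted from `0`, the `j`-th summand in depth `r` is
`b(X_1 - X_j, …, X_{j-1} - X_j; Y_1, …, Y_{j-1}) L_m(X_j; Y_1 + ⋯ + Y_r)
 b~(X_r - X_j, …, X_{j+1} - X_j; Y_r, …, Y_{j+1})`. -/
def LL (b : Mould ℚ) (m : ℕ) : Bimould (PowerSeries ℚ) := fun r =>
  let x := XX (PowerSeries ℚ) r
  let y := YY (PowerSeries ℚ) r
  if r = 0 then 1 else
    ∑ j ∈ Finset.range r,
      b.toBimould.toQ.ev j (fun i => x i - x j) y *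
        Lm m (x j) (∑ i ∈ Finset.range r, y i) *
          b.tildeBimould.toQ.ev (r - 1 - j) (fun i => x (r - 1 - i) - x j) (fun i => y (r - 1 - i))

open Classical in
/-- The bimould `𝔤*`, the sum over all decompositions of `(1, …, r)` into `j` consecutive nonempty
blocks and all `m_1 > ⋯ > m_j > 0` of the product of the `𝔏_{m_i}` at the `i`-th block. As `𝔏_m` is
divisible by `q^m`, only the finitely many terms with `m_1 ≤ n` contribute to the coefficient of
`q^n`, by which the infinite sum is defined. -/
def gStar (b : Mould ℚ) : Bimould (PowerSeries ℚ) := fun r e =>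
  PowerSeries.mk fun n : ℕ =>
    ∑ c : Composition r,
      ∑ m ∈ (Fintype.piFinset fun _ : Fin c.length => Finset.Icc 1 n).filter StrictAnti,
        PowerSeries.coeff n (MvPowerSeries.coeff e (∏ i : Fin c.length,
          (LL b (m i)).ev (c.blocksFun i)
            (fun t => XX (PowerSeries ℚ) r (c.sizeUpTo i + t))
            (fun t => YY (PowerSeries ℚ) r (c.sizeUpTo i + t))))

/-- The bimould `𝔊 = 𝔤* × b`. -/
def GG (b : Mould ℚ) : Bimould (PowerSeries ℚ) := (gStar b).mul b.toBimould.toQ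

/-- The combinatorial bi-multiple Eisenstein series. -/
def biG (b : Mould ℚ) (w : List (ℕ+ × ℕ)) : PowerSeries ℚ := (GG b).coeff w

/-- The combinatorial multiple Eisenstein series `G(k_1, …, k_r)`. -/
def G (b : Mould ℚ) (ks : List ℕ+) : PowerSeries ℚ := biG b (ks.map fun k => (k, 0))

/-- `G` as a linear map on `𝔥¹`. -/
def GMap (b : Mould ℚ) : Words ℕ+ →ₗ[ℚ] PowerSeries ℚ := Finsupp.linearCombination ℚ (G b)

/-! ### Limits -/

/-- The terms of a formal `q`-series at a real number `q`. -/
def qTerm (f : PowerSeries ℚ) (q : ℝ) (n : ℕ) : ℝ := ((PowerSeries.coeff n f : ℚ) : ℝ) * q ^ n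

/-- The value of a formal `q`-series at a real number `q` at which it converges. -/
def qValue (f : PowerSeries ℚ) (q : ℝ) : ℝ := ∑' n : ℕ, qTerm f q n

/-- The weight `k_1 + ⋯ + k_r`. -/
def weight (ks : List ℕ+) : ℕ := (ks.map fun k => (k : ℕ)).sum

/-- `w = ∑_j c_j * z_1^{*j}` with all `c_j` in `𝔥⁰`. -/
def IsH0Expansion (w : Words ℕ+) (c : ℕ →₀ Words ℕ+) : Prop :=
  (∀ j, c j ∈ H0) ∧ w = c.sum fun j u => stuffle u (stufflePow j)

/-- The stuffle regularized limit of `(1 - q)^{k_1 + ⋯ + k_r} G(k_1, …, k_r)` as `q → 1` exists and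
is `l`: the word `w = z_{k_1} ⋯ z_{k_r}` has a unique expansion `w = ∑_j w_j * z_1^{*j}` over `𝔥⁰`, and
`(1 - q)^{k_1 + ⋯ + k_r} G(w_0)` tends to `l`. -/
def HasStuffleRegLimit (b : Mould ℚ) (ks : List ℕ+) (l : ℝ) : Prop :=
  ∃ c : ℕ →₀ Words ℕ+, IsH0Expansion (word ks) c ∧ (∀ c', IsH0Expansion (word ks) c' → c' = c) ∧
    Tendsto (fun q : ℝ => (1 - q) ^ weight ks * qValue (GMap b (c 0)) q) (𝓝[<] 1) (𝓝 l)

/-! ### Multiple zeta values -/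

/-- The sequences `m_1 > ⋯ > m_r > 0`. -/
abbrev DecSeq (r : ℕ) : Type := {m : Fin r → ℕ // StrictAnti m ∧ ∀ i, 0 < m i}

/-- The terms `1 / (m_1^{k_1} ⋯ m_r^{k_r})` of the multiple zeta value `ζ(k_1, …, k_r)`. -/
def mzvTerm (ks : List ℕ+) (m : DecSeq ks.length) : ℝ :=
  ∏ i, 1 / ((m.1 i : ℝ) ^ ((ks.get i : ℕ)))

/-- `φ` is the map of stuffle regularized multiple zeta values `ζ* : 𝔥¹ → ℝ`: a homomorphism for the
stuffle product with `ζ*(1) = 0` that sends each word not starting with `z_1` to the (convergent)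
multiple zeta value. -/
def IsStuffleRegZeta (φ : Words ℕ+ →ₗ[ℚ] ℝ) : Prop :=
  IsQuasiShuffleHom stuffleLetters φ ∧ φ (word [1]) = 0 ∧
    ∀ ks : List ℕ+, Admissible ks → HasSum (mzvTerm ks) (φ (word ks))

end

end CombMES

/-! Regularization is pure algebra. The map `del`, which deletes a leading `z_1` and kills all other
words, is a derivation of the stuffle algebra with `del z_1 = 1` and kernel `𝔥⁰`. Hence `𝔥¹ =
𝔥⁰[z_1]`: integration in `z_1` gives existence of the expansion (`exists_eval_eq_sword`),
differentiation gives uniqueness (`eq_zero_of_eval_eq_zero`). Truncated multiple zeta values are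
stuffle homomorphisms (`truncZeta_mul`), so their limit is multiplicative on `𝔥⁰`; `ζ*` is this
limit applied to the constant coefficient in `z_1`.

For `G` only `Y = 0` matters. A symmetral mould whose depth one constant term vanishes has no
constant term in any positive depth, because `z_1` shuffled with `z_1^n` is `(n+1) z_1^(n+1)`; thus
the bimould `b` restricts to the mould `b` (`cf_atZero_toBimould`). On a block of `s` variables with
exponents of sum `d`, the coefficient of `𝔏_m` is a Lambert series `∑ p(n) q^(mn)` with `p(n) =
O(n^d)`, and `p(n) = n^d/d!` exactly when the block is a single variable. So `G` is a finite sum of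
nested Lambert series times numbers `β` (`G_eq_sum`). Their coefficients grow polynomially, whence
convergence for `|q| < 1`; the constant term comes from the empty nest alone.

As `q → 1`, such a Lambert series is `O(q^m/(1-q^m)^(d+1))`, so `(1-q)^(d+1)` already bounds it,
whereas the weight provides `(1-q)^(d+s)`. Every block with `s ≥ 2` and every `β` of positive depth
therefore disappears, and the one remaining nested sum tends termwise to the multiple zeta value.
Dominated convergence (`tendsto_nestedTsum`) applies because each scaled factor is `O(1/m)` and, for
an admissible word, the outermost one is `O(1/m²)` (`scaled_le`, `scaled_le_sq`); the inner sums
cost only powers of harmonic numbers. -/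

namespace CombMES

noncomputable section

/-! ### The stuffle algebra -/

/-- `𝔥¹`, as a commutative ring with the stuffle product. -/
def StuffleAlg : Type := Words ℕ+

instance instAddCommGroupStuffleAlg : AddCommGroup StuffleAlg := inferInstanceAs (AddCommGroup (Words ℕ+))

instance : Module ℚ StuffleAlg := inferInstanceAs (Module ℚ (Words ℕ+))

/-- The stuffle product as a bilinear map. -/
def stuffleBilin : Words ℕ+ →ₗ[ℚ] Words ℕ+ →ₗ[ℚ] Words ℕ+ :=
  Finsupp.linearCombination ℚ fun w => Finsupp.linearCombination ℚ (qsh stuffleLetters w)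

theorem stuffleBilin_apply (x y : Words ℕ+) : stuffleBilin x y = qmul stuffleLetters x y := by
  simp only [stuffleBilin, qmul, Finsupp.linearCombination_apply, Finsupp.sum,
    LinearMap.sum_apply, LinearMap.smul_apply, Finset.smul_sum, smul_smul]

/-- An element of `𝔥¹`, seen in the stuffle algebra. -/
def ofWords : Words ℕ+ ≃ₗ[ℚ] StuffleAlg := LinearEquiv.refl ℚ (Words ℕ+)

instance instMulStuffleAlg : Mul StuffleAlg := ⟨qmul stuffleLetters⟩

/-- The basis element of the stuffle algebra given by a word. -/
def sword (w : List ℕ+) : StuffleAlg := ofWords (word w)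

instance instOneStuffleAlg : One StuffleAlg := ⟨sword []⟩

theorem mul_eq_stuffleBilin (x y : StuffleAlg) : x * y = stuffleBilin x y :=
  (stuffleBilin_apply x y).symm

theorem sword_mul_sword (u v : List ℕ+) : sword u * sword v = qsh stuffleLetters u v := by
  rw [mul_eq_stuffleBilin]
  change stuffleBilin (word u) (word v) = _
  simp [stuffleBilin, word]

theorem sword_nil : sword [] = 1 := rfl

theorem qsh_nil_right {L : Type} (d : L → L → (L →₀ ℚ)) (w : List L) :
    qsh d w [] = word w := by
  cases w <;> simp [qsh]

theorem stuffleAlg_induction {p : StuffleAlg → Prop} (x : StuffleAlg) (h0 : p 0)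
    (hadd : ∀ x y, p x → p y → p (x + y)) (hsmul : ∀ (r : ℚ) x, p x → p (r • x))
    (hw : ∀ w, p (sword w)) : p x := by
  refine Finsupp.induction_linear (motive := p) x h0 hadd fun w r => ?_
  have : (Finsupp.single w r : Words ℕ+) = r • word w := by simp [word]
  rw [this]
  exact hsmul r _ (hw w)

theorem smul_mul_stuffle (r : ℚ) (x y : StuffleAlg) : r • x * y = r • (x * y) := by
  simp only [mul_eq_stuffleBilin]; exact LinearMap.map_smul₂ stuffleBilin r x y

theorem mul_smul_stuffle (r : ℚ) (x y : StuffleAlg) : x * r • y = r • (x * y) := by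
  simp only [mul_eq_stuffleBilin]; exact (stuffleBilin x).map_smul r y

theorem add_mul_stuffle (x y z : StuffleAlg) : (x + y) * z = x * z + y * z := by
  simp only [mul_eq_stuffleBilin]; exact LinearMap.map_add₂ stuffleBilin x y z

theorem mul_add_stuffle (x y z : StuffleAlg) : x * (y + z) = x * y + x * z := by
  simp only [mul_eq_stuffleBilin]; exact (stuffleBilin x).map_add y z

theorem zero_mul_stuffle (x : StuffleAlg) : 0 * x = 0 := by
  simp only [mul_eq_stuffleBilin]; exact LinearMap.map_zero₂ stuffleBilin x

theorem mul_zero_stuffle (x : StuffleAlg) : x * 0 = 0 := by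
  simp only [mul_eq_stuffleBilin]; exact (stuffleBilin x).map_zero

theorem one_mul_stuffle (x : StuffleAlg) : 1 * x = x := by
  induction x using stuffleAlg_induction with
  | h0 => exact mul_zero_stuffle 1
  | hadd x y hx hy => rw [mul_add_stuffle, hx, hy]
  | hsmul r x hx => rw [mul_smul_stuffle, hx]
  | hw w => rw [← sword_nil, sword_mul_sword]; simp [qsh, sword]; rfl

theorem mul_one_stuffle (x : StuffleAlg) : x * 1 = x := by
  induction x using stuffleAlg_induction with
  | h0 => exact zero_mul_stuffle 1
  | hadd x y hx hy => rw [add_mul_stuffle, hx, hy]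
  | hsmul r x hx => rw [smul_mul_stuffle, hx]
  | hw w => rw [← sword_nil, sword_mul_sword, qsh_nil_right]; rfl

/-- Left concatenation with a letter, as a linear map. -/
def cat (a : ℕ+) : StuffleAlg →ₗ[ℚ] StuffleAlg := Finsupp.lmapDomain ℚ ℚ (List.cons a)

theorem cat_sword (a : ℕ+) (w : List ℕ+) : cat a (sword w) = sword (a :: w) :=
  Finsupp.mapDomain_single

/-- The defining recursion is bilinear in the two tails, so it passes from words to all elements. In
this form iterated products can be unfolded by rewriting. -/
theorem cat_mul_cat (a b : ℕ+) (x y : StuffleAlg) :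
    cat a x * cat b y = cat a (x * cat b y) + cat b (cat a x * y) + cat (a + b) (x * y) := by
  induction x using stuffleAlg_induction with
  | h0 => simp [zero_mul_stuffle]
  | hadd x x' hx hx' => simp only [map_add, add_mul_stuffle, hx, hx']; abel
  | hsmul r x hx => simp only [map_smul, smul_mul_stuffle, hx, smul_add]
  | hw u =>
    induction y using stuffleAlg_induction with
    | h0 => simp [mul_zero_stuffle]
    | hadd y y' hy hy' => simp only [map_add, mul_add_stuffle, hy, hy']; abel
    | hsmul r y hy => simp only [map_smul, mul_smul_stuffle, hy, smul_add]
    | hw v =>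
      simp only [cat_sword, sword_mul_sword]
      rw [qsh, stuffleLetters, Finsupp.sum_single_index (by simp), one_smul]
      rfl

theorem mul_comm_stuffle (x y : StuffleAlg) : x * y = y * x := by
  induction x using stuffleAlg_induction with
  | h0 => rw [zero_mul_stuffle, mul_zero_stuffle]
  | hadd x x' hx hx' => rw [add_mul_stuffle, mul_add_stuffle, hx, hx']
  | hsmul r x hx => rw [smul_mul_stuffle, mul_smul_stuffle, hx]
  | hw u =>
  induction y using stuffleAlg_induction with
  | h0 => rw [zero_mul_stuffle, mul_zero_stuffle]
  | hadd x x' hx hx' => rw [add_mul_stuffle, mul_add_stuffle, hx, hx']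
  | hsmul r x hx => rw [smul_mul_stuffle, mul_smul_stuffle, hx]
  | hw v =>
  induction h : u.length + v.length using Nat.strong_induction_on generalizing u v with
  | _ n ih =>
  cases u with
  | nil => rw [sword_nil, one_mul_stuffle, mul_one_stuffle]
  | cons a u =>
  cases v with
  | nil => rw [sword_nil, one_mul_stuffle, mul_one_stuffle]
  | cons b v =>
    simp only [List.length_cons] at h
    have h1 := ih _ (by simp; omega) u (b :: v) rfl
    have h2 := ih _ (by simp; omega) (a :: u) v rfl
    have h3 := ih _ (by omega) u v rfl
    simp only [← cat_sword] at h1 h2 ⊢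
    rw [cat_mul_cat, cat_mul_cat, h1, h2, h3, add_comm b a]
    abel

theorem mul_assoc_stuffle (x y z : StuffleAlg) : x * y * z = x * (y * z) := by
  induction x using stuffleAlg_induction with
  | h0 => simp only [zero_mul_stuffle]
  | hadd x x' hx hx' => simp only [add_mul_stuffle, hx, hx']
  | hsmul r x hx => simp only [smul_mul_stuffle, hx]
  | hw u =>
  induction y using stuffleAlg_induction with
  | h0 => simp only [zero_mul_stuffle, mul_zero_stuffle]
  | hadd x x' hx hx' => simp only [add_mul_stuffle, mul_add_stuffle, hx, hx']
  | hsmul r x hx => simp only [smul_mul_stuffle, mul_smul_stuffle, hx]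
  | hw v =>
  induction z using stuffleAlg_induction with
  | h0 => simp only [mul_zero_stuffle]
  | hadd x x' hx hx' => simp only [mul_add_stuffle, hx, hx']
  | hsmul r x hx => simp only [mul_smul_stuffle, hx]
  | hw w =>
  induction h : u.length + v.length + w.length using Nat.strong_induction_on
    generalizing u v w with
  | _ n ih =>
  cases u with
  | nil => simp only [sword_nil, one_mul_stuffle]
  | cons a u =>
  cases v with
  | nil => simp only [sword_nil, one_mul_stuffle, mul_one_stuffle]
  | cons b v =>
  cases w with
  | nil => simp only [sword_nil, mul_one_stuffle]
  | cons c w =>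
    simp only [List.length_cons] at h
    have h1 := ih _ (by simp; omega) u (b :: v) (c :: w) rfl
    have h2 := ih _ (by simp; omega) (a :: u) v (c :: w) rfl
    have h3 := ih _ (by simp; omega) (a :: u) (b :: v) w rfl
    have h4 := ih _ (by simp; omega) u v (c :: w) rfl
    have h5 := ih _ (by simp; omega) u (b :: v) w rfl
    have h6 := ih _ (by simp; omega) (a :: u) v w rfl
    have h7 := ih _ (by omega) u v w rfl
    simp only [← cat_sword] at h1 h2 h3 h4 h5 h6 ⊢
    generalize sword u = x at *
    generalize sword v = y at *
    generalize sword w = z at *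
    -- There is one summand for each nonempty subset of `{a, b, c}`, namely the letters merged into
    -- the first letter of the result; both bracketings give the same seven summands up to
    -- associativity in smaller total length.
    calc cat a x * cat b y * cat c z
      _ = cat a (x * cat b y * cat c z) + cat b (cat a x * y * cat c z)
          + cat (a + b) (x * y * cat c z) + cat c (cat a x * cat b y * z)
          + cat (a + c) (x * cat b y * z) + cat (b + c) (cat a x * y * z)
          + cat (a + b + c) (x * y * z) := by
        simp only [add_mul_stuffle, cat_mul_cat, map_add]
        abel
      _ = cat a (x * (cat b y * cat c z)) + cat b (cat a x * (y * cat c z))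
          + cat (a + b) (x * (y * cat c z)) + cat c (cat a x * (cat b y * z))
          + cat (a + c) (x * (cat b y * z)) + cat (b + c) (cat a x * (y * z))
          + cat (a + b + c) (x * (y * z)) := by rw [h1, h2, h3, h4, h5, h6, h7]
      _ = cat a x * (cat b y * cat c z) := by
        simp only [mul_add_stuffle, cat_mul_cat, map_add, add_assoc a b c]
        abel

instance : CommRing StuffleAlg :=
  { instAddCommGroupStuffleAlg, instMulStuffleAlg, instOneStuffleAlg with
    left_distrib := mul_add_stuffle
    right_distrib := add_mul_stuffle
    zero_mul := zero_mul_stuffle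
    mul_zero := mul_zero_stuffle
    mul_assoc := mul_assoc_stuffle
    one_mul := one_mul_stuffle
    mul_one := mul_one_stuffle
    mul_comm := mul_comm_stuffle }

instance : Algebra ℚ StuffleAlg := Algebra.ofModule smul_mul_stuffle mul_smul_stuffle

/-- Without torsion, a polynomial over this ring with zero derivative is constant. -/
instance : IsAddTorsionFree StuffleAlg := inferInstanceAs (IsAddTorsionFree (Words ℕ+))

theorem ofWords_stuffle (x y : Words ℕ+) : ofWords (stuffle x y) = ofWords x * ofWords y := rfl

theorem ofWords_word (w : List ℕ+) : ofWords (word w) = sword w := rfl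

theorem ofWords_stufflePow (j : ℕ) : ofWords (stufflePow j) = sword [1] ^ j := by
  induction j with
  | zero => rfl
  | succ j ih => rw [stufflePow, ofWords_stuffle, ih, pow_succ']; rfl

/-! ### Deleting a leading `z_1` -/

/-- The derivation of `𝔥¹` with `z_1 w ↦ w` and `w ↦ 0` if `w` does not start with `z_1`. -/
def del : StuffleAlg →ₗ[ℚ] StuffleAlg :=
  Finsupp.linearCombination ℚ fun w : List ℕ+ =>
    if w.head? = some 1 then sword w.tail else (0 : StuffleAlg)

theorem del_sword (w : List ℕ+) :
    del (sword w) = if w.head? = some 1 then sword w.tail else 0 := by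
  rw [del, sword, word]
  exact (Finsupp.linearCombination_single ℚ 1 w).trans (one_smul _ _)

theorem del_one : del 1 = 0 := by
  rw [← sword_nil, del_sword]; simp

theorem del_cat (a : ℕ+) (x : StuffleAlg) : del (cat a x) = if a = 1 then x else 0 := by
  induction x using stuffleAlg_induction with
  | h0 => simp
  | hadd x y hx hy => rw [map_add, map_add, hx, hy]; split_ifs <;> simp
  | hsmul r x hx => rw [map_smul, map_smul, hx]; split_ifs <;> simp
  | hw w => rw [cat_sword, del_sword]; simp

/-- In the product of `a u` and `b v` the summands start with `a`, `b` or `a + b`. As `a + b` is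
never `1`, the merged summand is killed and the other two form the Leibniz rule. -/
theorem del_mul (x y : StuffleAlg) : del (x * y) = del x * y + x * del y := by
  induction x using stuffleAlg_induction with
  | h0 => simp
  | hadd x x' hx hx' => rw [add_mul, map_add, map_add, hx, hx']; ring
  | hsmul r x hx => simp only [map_smul, smul_mul_assoc, hx, smul_add]
  | hw u =>
  induction y using stuffleAlg_induction with
  | h0 => simp
  | hadd x x' hx hx' => rw [mul_add, map_add, map_add, hx, hx']; ring
  | hsmul r x hx => simp only [map_smul, mul_smul_comm, hx, smul_add]
  | hw v =>
  cases u with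
  | nil => simp [sword_nil, del_one]
  | cons a u =>
  cases v with
  | nil => simp [sword_nil, del_one]
  | cons b v =>
    have hab : a + b ≠ 1 := fun h => by
      have := congrArg PNat.val h
      have ha := a.pos
      have hb := b.pos
      simp at this
      omega
    simp only [← cat_sword, cat_mul_cat, map_add, del_cat, hab, if_false, add_zero]
    split_ifs <;> simp [add_comm]

theorem del_pow_succ (j : ℕ) : del (sword [1] ^ (j + 1)) = (j + 1 : ℚ) • sword [1] ^ j := by
  induction j with
  | zero => simp [del_sword, sword_nil]
  | succ j ih =>
    rw [pow_succ', del_mul, ih, del_sword]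
    simp only [List.head?_cons, if_true, List.tail_cons, sword_nil, mul_smul_comm, ← pow_succ',
      one_mul]
    simp only [Nat.cast_add_one, add_smul, one_smul]
    abel

/-- Combinations of the words of weight `n`. -/
def weightSpace (n : ℕ) : Submodule ℚ StuffleAlg :=
  Submodule.span ℚ (sword '' {ks | weight ks = n})

/-- Combinations of the words of weight `n` that do not start with `z_1`. -/
def admSpace (n : ℕ) : Submodule ℚ StuffleAlg :=
  Submodule.span ℚ (sword '' {ks | Admissible ks ∧ weight ks = n})

theorem sword_mem_weightSpace (w : List ℕ+) : sword w ∈ weightSpace (weight w) :=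
  Submodule.subset_span ⟨w, rfl, rfl⟩

theorem weight_cons (a : ℕ+) (w : List ℕ+) : weight (a :: w) = a + weight w := by
  simp [weight]

theorem cat_mem_weightSpace (a : ℕ+) {n : ℕ} {x : StuffleAlg} (hx : x ∈ weightSpace n) :
    cat a x ∈ weightSpace (a + n) := by
  induction hx using Submodule.span_induction with
  | mem x h =>
    obtain ⟨w, rfl, rfl⟩ := h
    rw [cat_sword, ← weight_cons]
    exact sword_mem_weightSpace _
  | zero => simp
  | add x y _ _ hx hy => rw [map_add]; exact add_mem hx hy
  | smul r x _ hx => rw [map_smul]; exact Submodule.smul_mem _ _ hx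

/-- Homogeneity matters because a single power of `1 - q` has to scale all words of `w_0` at once.
-/
theorem sword_mul_mem_weightSpace (u v : List ℕ+) :
    sword u * sword v ∈ weightSpace (weight u + weight v) := by
  induction h : u.length + v.length using Nat.strong_induction_on generalizing u v with
  | _ n ih =>
  cases u with
  | nil => simpa [sword_nil, weight] using sword_mem_weightSpace v
  | cons a u =>
  cases v with
  | nil => simpa [sword_nil, weight] using sword_mem_weightSpace (a :: u)
  | cons b v =>
    simp only [List.length_cons] at h
    have h1 := cat_mem_weightSpace a (ih _ (by simp; omega) u (b :: v) rfl)
    have h2 := cat_mem_weightSpace b (ih _ (by simp; omega) (a :: u) v rfl)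
    have h3 := cat_mem_weightSpace (a + b) (ih _ (by omega) u v rfl)
    rw [← cat_sword, ← cat_sword, cat_mul_cat, cat_sword, cat_sword]
    simp only [weight_cons, PNat.add_coe] at h1 h2 h3 ⊢
    refine add_mem (add_mem ?_ ?_) ?_
    · convert h1 using 2; ring
    · convert h2 using 2; ring
    · convert h3 using 2; ring

theorem mul_mem_weightSpace {m n : ℕ} {x y : StuffleAlg} (hx : x ∈ weightSpace m)
    (hy : y ∈ weightSpace n) : x * y ∈ weightSpace (m + n) := by
  induction hx, hy using Submodule.span_induction₂ with
  | mem_mem x y hx hy =>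
    obtain ⟨u, rfl, rfl⟩ := hx
    obtain ⟨v, rfl, rfl⟩ := hy
    exact sword_mul_mem_weightSpace u v
  | zero_left y hy => simp
  | zero_right x hx => simp
  | add_left x y z _ _ _ h1 h2 => rw [add_mul]; exact add_mem h1 h2
  | add_right x y z _ _ _ h1 h2 => rw [mul_add]; exact add_mem h1 h2
  | smul_left r x y _ _ h => rw [smul_mul_assoc]; exact Submodule.smul_mem _ _ h
  | smul_right r x y _ _ h => rw [mul_smul_comm]; exact Submodule.smul_mem _ _ h

/-- Subtracting `z_1 · del x` removes exactly the words that start with `z_1`. In particular a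
homogeneous element of the kernel of `del` is a combination of admissible words of its weight. -/
theorem sub_cat_del_mem_admSpace {n : ℕ} {x : StuffleAlg} (hx : x ∈ weightSpace n) :
    x - cat 1 (del x) ∈ admSpace n := by
  induction hx using Submodule.span_induction with
  | mem x h =>
    obtain ⟨w, hw, rfl⟩ := h
    rw [del_sword]
    split_ifs with h1
    · obtain ⟨v, rfl⟩ : ∃ v, w = 1 :: v := by
        cases w with
        | nil => simp at h1
        | cons a v => simp at h1; exact ⟨v, by rw [h1]⟩
      simp [cat_sword]
    · rw [map_zero, sub_zero]
      exact Submodule.subset_span ⟨w, ⟨h1, hw⟩, rfl⟩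
  | zero => simp
  | add x y _ _ hx hy =>
    simp only [map_add]
    convert add_mem hx hy using 1
    abel
  | smul r x _ hx =>
    simp only [map_smul, ← smul_sub]
    exact Submodule.smul_mem _ _ hx

theorem sub_cat_del_mem_map_H0 (x : StuffleAlg) :
    x - cat 1 (del x) ∈ H0.map ofWords.toLinearMap := by
  induction x using stuffleAlg_induction with
  | h0 => simp
  | hadd x y hx hy =>
    simp only [map_add]
    convert add_mem hx hy using 1
    abel
  | hsmul r x hx =>
    simp only [map_smul, ← smul_sub]
    exact Submodule.smul_mem _ r hx
  | hw w =>
    rw [del_sword]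
    split_ifs with h1
    · obtain ⟨v, rfl⟩ : ∃ v, w = 1 :: v := by
        cases w with
        | nil => simp at h1
        | cons a v => simp at h1; exact ⟨v, by rw [h1]⟩
      simp [cat_sword]
    · rw [map_zero, sub_zero]
      exact ⟨word w, Submodule.subset_span ⟨w, h1, rfl⟩, rfl⟩

/-- As the constants of a derivation, `𝔥⁰` is a subalgebra. -/
theorem mem_H0_iff_del_eq_zero (x : Words ℕ+) : x ∈ H0 ↔ del (ofWords x) = 0 := by
  constructor
  · intro hx
    induction hx using Submodule.span_induction with
    | mem x h =>
      obtain ⟨w, hw, rfl⟩ := h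
      exact (del_sword w).trans (if_neg hw)
    | zero => simp
    | add x y _ _ hx hy => rw [map_add, map_add, hx, hy, add_zero]
    | smul r x _ hx => rw [map_smul, map_smul, hx, smul_zero]
  · intro hx
    obtain ⟨y, hy, h⟩ := sub_cat_del_mem_map_H0 (ofWords x)
    rw [hx, map_zero, sub_zero] at h
    rwa [← ofWords.injective h]

/-! ### Polynomials in `z_1` -/

open Polynomial in
-- Chain rule: the coefficients are constants of `del`, and `del z_1 = 1`.
theorem del_eval {p : Polynomial StuffleAlg} (hp : ∀ j, del (p.coeff j) = 0) :
    del (p.eval (sword [1])) = (derivative p).eval (sword [1]) := by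
  rw [eval_eq_sum, derivative_eval, sum_def, sum_def, map_sum]
  refine Finset.sum_congr rfl fun j _ => ?_
  rw [del_mul, hp, zero_mul, zero_add]
  cases j with
  | zero => simp [del_one]
  | succ j =>
    rw [del_pow_succ, mul_smul_comm, mul_assoc, Nat.add_sub_cancel, ← smul_mul_assoc]
    rw [← Nat.cast_add_one, Nat.cast_smul_eq_nsmul, nsmul_eq_mul]
    ring

open Polynomial in
-- `z_1` is transcendental over `𝔥⁰`: applying `del` to a relation gives the relation of the
-- derivative, of smaller degree, so a minimal one would be constant.
theorem eq_zero_of_eval_eq_zero {p : Polynomial StuffleAlg} (hp : ∀ j, del (p.coeff j) = 0)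
    (h : p.eval (sword [1]) = 0) : p = 0 := by
  induction hn : p.natDegree using Nat.strong_induction_on generalizing p with
  | _ n ih =>
  have hdeg : p.natDegree = 0 := by
    by_contra hne
    have hd : derivative p = 0 := by
      refine ih _ (hn ▸ natDegree_derivative_lt hne) (fun j => ?_) ?_ rfl
      · rw [coeff_derivative, ← Nat.cast_add_one, mul_comm, ← nsmul_eq_mul, map_nsmul, hp,
          smul_zero]
      · rw [← del_eval hp, h, map_zero]
    exact hne (derivative_eq_zero.1 hd)
  rw [natDegree_eq_zero] at hdeg
  obtain ⟨x, rfl⟩ := hdeg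
  rw [eval_C] at h
  rw [h, C_0]

open Polynomial in
-- Induction on the word. For a word `z_1 w`, the polynomial of `w` is integrated in `z_1`; the
-- integration constant lies in `𝔥⁰`. The weights are carried along so that the constant coefficient
-- is seen to be homogeneous.
theorem exists_eval_eq_sword (w : List ℕ+) : ∃ p : Polynomial StuffleAlg,
    (∀ j, del (p.coeff j) = 0) ∧ p.eval (sword [1]) = sword w ∧
      (∀ j, p.coeff j * sword [1] ^ j ∈ weightSpace (weight w)) ∧
        p.coeff 0 ∈ admSpace (weight w) := by
  induction w with
  | nil =>
    refine ⟨1, fun j => ?_, by simp [sword_nil], fun j => ?_, ?_⟩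
    · rw [coeff_one]; split_ifs <;> simp [del_one]
    · rw [coeff_one]
      split_ifs with h
      · simpa [h, sword_nil] using sword_mem_weightSpace []
      · simp
    · rw [coeff_one_zero]
      exact Submodule.subset_span ⟨[], ⟨by simp [Admissible], rfl⟩, rfl⟩
  | cons a w ih =>
    by_cases ha : a = 1
    swap
    · have hdel : del (sword (a :: w)) = 0 := by rw [del_sword]; simp [ha]
      refine ⟨C (sword (a :: w)), fun j => ?_, by simp, fun j => ?_, ?_⟩
      · rw [coeff_C]; split_ifs <;> simp [hdel]
      · rw [coeff_C]
        split_ifs with h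
        · simpa [h] using sword_mem_weightSpace (a :: w)
        · simp
      · rw [coeff_C_zero]
        exact Submodule.subset_span ⟨a :: w, ⟨by simpa [Admissible] using ha, rfl⟩, rfl⟩
    subst ha
    obtain ⟨p, h0, hev, hwt, -⟩ := ih
    have hz : (sword [1] : StuffleAlg) ∈ weightSpace 1 := sword_mem_weightSpace [1]
    -- The formal antiderivative of `p` with zero constant term.
    set q : Polynomial StuffleAlg :=
      ∑ j ∈ p.support, monomial (j + 1) (((j : ℚ) + 1)⁻¹ • p.coeff j) with hq
    have hqc : ∀ j, q.coeff (j + 1) = ((j : ℚ) + 1)⁻¹ • p.coeff j := fun j => by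
      rw [hq, finsetSum_coeff]
      simp only [coeff_monomial, add_left_inj, Finset.sum_ite_eq']
      split_ifs with h
      · rfl
      · rw [notMem_support_iff.1 h, smul_zero]
    have hq0 : q.coeff 0 = 0 := by
      rw [hq, finsetSum_coeff]
      exact Finset.sum_eq_zero fun j _ => by rw [coeff_monomial, if_neg (by omega)]
    have hqdel : ∀ j, del (q.coeff j) = 0
      | 0 => by rw [hq0, map_zero]
      | j + 1 => by rw [hqc, map_smul, h0, smul_zero]
    have hder : derivative q = p := by
      ext j
      rw [coeff_derivative, hqc, smul_mul_assoc, ← Nat.cast_add_one, ← Nat.cast_add_one, mul_comm,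
        ← nsmul_eq_mul, ← Nat.cast_smul_eq_nsmul ℚ, smul_smul, inv_mul_cancel₀ (by positivity),
        one_smul]
    have hqwt : ∀ j, q.coeff j * sword [1] ^ j ∈ weightSpace (weight (1 :: w))
      | 0 => by simp [hq0]
      | j + 1 => by
        rw [hqc, smul_mul_assoc, pow_succ, ← mul_assoc, weight_cons, add_comm]
        exact Submodule.smul_mem _ _ (mul_mem_weightSpace (hwt j) hz)
    have hqev : q.eval (sword [1]) ∈ weightSpace (weight (1 :: w)) := by
      rw [eval_eq_sum, sum_def]
      exact sum_mem fun j _ => hqwt j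
    -- Both `z_1 w` and `q(z_1)` are mapped to `w` by `del`, so their difference is the missing
    -- integration constant.
    set h : StuffleAlg := sword (1 :: w) - q.eval (sword [1]) with hh
    have hhdel : del h = 0 := by
      rw [hh, map_sub, del_eval hqdel, hder, hev, del_sword]
      simp
    have hhwt : h ∈ weightSpace (weight (1 :: w)) := sub_mem (sword_mem_weightSpace _) hqev
    have hhadm : h ∈ admSpace (weight (1 :: w)) := by
      have := sub_cat_del_mem_admSpace hhwt
      rwa [hhdel, map_zero, sub_zero] at this
    refine ⟨C h + q, fun j => ?_, ?_, fun j => ?_, ?_⟩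
    · rw [coeff_add, map_add, hqdel, coeff_C]; split_ifs <;> simp [hhdel]
    · rw [eval_add, eval_C, hh]; abel
    · rw [coeff_add, add_mul]
      refine add_mem ?_ (hqwt j)
      rw [coeff_C]
      split_ifs with hj
      · simpa [hj] using hhwt
      · simp
    · rw [coeff_add, coeff_C_zero, hq0, add_zero]
      exact hhadm

/-- The polynomial in `z_1` with coefficients in `𝔥⁰` that represents an element of `𝔥¹`. -/
def toPoly : StuffleAlg →ₗ[ℚ] Polynomial StuffleAlg :=
  (Finsupp.linearCombination ℚ fun w => (exists_eval_eq_sword w).choose) ∘ₗ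
    ofWords.symm.toLinearMap

theorem toPoly_sword (w : List ℕ+) : toPoly (sword w) = (exists_eval_eq_sword w).choose := by
  simp [toPoly, sword, word]

theorem del_coeff_toPoly (x : StuffleAlg) (j : ℕ) : del ((toPoly x).coeff j) = 0 := by
  induction x using stuffleAlg_induction with
  | h0 => simp
  | hadd x y hx hy => rw [map_add, Polynomial.coeff_add, map_add, hx, hy, add_zero]
  | hsmul r x hx => rw [map_smul, Polynomial.coeff_smul, map_smul, hx, smul_zero]
  | hw w => rw [toPoly_sword]; exact (exists_eval_eq_sword w).choose_spec.1 j

theorem eval_toPoly (x : StuffleAlg) : (toPoly x).eval (sword [1]) = x := by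
  induction x using stuffleAlg_induction with
  | h0 => simp
  | hadd x y hx hy => rw [map_add, Polynomial.eval_add, hx, hy]
  | hsmul r x hx => rw [map_smul, Polynomial.eval_smul, hx]
  | hw w => rw [toPoly_sword]; exact (exists_eval_eq_sword w).choose_spec.2.1

theorem coeff_zero_toPoly_mem (w : List ℕ+) : (toPoly (sword w)).coeff 0 ∈ admSpace (weight w) := by
  rw [toPoly_sword]; exact (exists_eval_eq_sword w).choose_spec.2.2.2

theorem eq_toPoly {p : Polynomial StuffleAlg} (hp : ∀ j, del (p.coeff j) = 0) :
    p = toPoly (p.eval (sword [1])) := by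
  rw [← sub_eq_zero]
  refine eq_zero_of_eval_eq_zero (fun j => ?_) ?_
  · rw [Polynomial.coeff_sub, map_sub, hp, del_coeff_toPoly, sub_zero]
  · rw [Polynomial.eval_sub, eval_toPoly, sub_self]

/-- The product polynomial again has coefficients in `𝔥⁰` and evaluates to `x * y`, so uniqueness
identifies it. -/
theorem toPoly_mul (x y : StuffleAlg) : toPoly (x * y) = toPoly x * toPoly y := by
  symm
  conv_rhs => rw [← eval_toPoly x, ← eval_toPoly y, ← Polynomial.eval_mul]
  refine eq_toPoly fun j => ?_
  rw [Polynomial.coeff_mul, map_sum]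
  refine Finset.sum_eq_zero fun i _ => ?_
  rw [del_mul, del_coeff_toPoly, del_coeff_toPoly, zero_mul, mul_zero, add_zero]

theorem toPoly_of_del_eq_zero {x : StuffleAlg} (hx : del x = 0) : toPoly x = Polynomial.C x := by
  have h := eq_toPoly (p := Polynomial.C x) fun j => by
    rw [Polynomial.coeff_C]; split_ifs <;> simp [hx]
  rwa [Polynomial.eval_C, eq_comm] at h

theorem toPoly_z1 : toPoly (sword [1]) = Polynomial.X := by
  have h := eq_toPoly (p := (Polynomial.X : Polynomial StuffleAlg)) fun j => by
    rw [Polynomial.coeff_X]; split_ifs <;> simp [del_one]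
  rwa [Polynomial.eval_X, eq_comm] at h

theorem isH0Expansion_toPoly (x : Words ℕ+) : ∃ c : ℕ →₀ Words ℕ+,
    (∀ j, ofWords (c j) = (toPoly (ofWords x)).coeff j) ∧ IsH0Expansion x c := by
  set p := toPoly (ofWords x) with hp
  have hc : ∀ j, ofWords (ofWords.symm (p.coeff j)) = p.coeff j :=
    fun j => ofWords.apply_symm_apply _
  refine ⟨Finsupp.onFinset p.support (fun j => ofWords.symm (p.coeff j)) fun j hj => ?_,
    fun j => hc j, fun j => ?_, ?_⟩
  · rw [Polynomial.mem_support_iff]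
    exact fun h => hj (by rw [h, map_zero])
  · rw [mem_H0_iff_del_eq_zero, Finsupp.onFinset_apply, hc, hp]
    exact del_coeff_toPoly _ j
  · apply ofWords.injective
    rw [Finsupp.onFinset_sum, map_sum]
    · conv_lhs => rw [← eval_toPoly (ofWords x), Polynomial.eval_eq_sum, Polynomial.sum_def]
      refine Finset.sum_congr rfl fun j _ => ?_
      rw [ofWords_stuffle, ofWords_stufflePow, hc]
    · intro j
      apply ofWords.injective
      rw [ofWords_stuffle, map_zero, zero_mul]

theorem IsH0Expansion.apply_eq {x : Words ℕ+} {c : ℕ →₀ Words ℕ+} (h : IsH0Expansion x c)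
    (j : ℕ) : ofWords (c j) = (toPoly (ofWords x)).coeff j := by
  set p : Polynomial StuffleAlg := ∑ i ∈ c.support, Polynomial.monomial i (ofWords (c i)) with hp
  have hpc : ∀ j, p.coeff j = ofWords (c j) := fun j => by
    rw [hp, Polynomial.finsetSum_coeff]
    simp only [Polynomial.coeff_monomial, Finset.sum_ite_eq']
    split_ifs with hj
    · rfl
    · rw [Finsupp.notMem_support_iff.1 hj, map_zero]
  have hev : p.eval (sword [1]) = ofWords x := by
    rw [hp, Polynomial.eval_finsetSum, h.2, Finsupp.sum, map_sum]
    refine Finset.sum_congr rfl fun i _ => ?_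
    rw [Polynomial.eval_monomial, ofWords_stuffle, ofWords_stufflePow]
  rw [← hpc, ← hev]
  congr 1
  refine eq_toPoly fun i => ?_
  rw [hpc]
  exact (mem_H0_iff_del_eq_zero _).1 (h.1 i)

/-! ### Nested sums -/

/-- The nested sum `∑_{N ≥ m_1 > ⋯ > m_r > 0} f_1(m_1) ⋯ f_r(m_r)`. -/
def nestedSum {R : Type*} [CommSemiring R] : ℕ → List (ℕ → R) → R
  | _, [] => 1
  | N, f :: fs => ∑ a ∈ Finset.range N, f (a + 1) * nestedSum a fs

section Semiring

variable {R : Type*} [CommSemiring R]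

@[simp]
theorem nestedSum_nil (N : ℕ) : nestedSum N ([] : List (ℕ → R)) = 1 := by
  rw [nestedSum]

theorem nestedSum_cons (N : ℕ) (f : ℕ → R) (fs : List (ℕ → R)) :
    nestedSum N (f :: fs) = ∑ a ∈ Finset.range N, f (a + 1) * nestedSum a fs := by
  rw [nestedSum]

theorem nestedSum_succ (N : ℕ) (f : ℕ → R) (fs : List (ℕ → R)) :
    nestedSum (N + 1) (f :: fs) = nestedSum N (f :: fs) + f (N + 1) * nestedSum N fs := by
  rw [nestedSum_cons, Finset.sum_range_succ, ← nestedSum_cons]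

open Classical in
theorem sum_strictAnti_eq_nestedSum {l : ℕ} (N : ℕ) (f : Fin l → ℕ → R) :
    ∑ m ∈ (Fintype.piFinset fun _ : Fin l => Finset.Icc 1 N).filter StrictAnti,
      ∏ i, f i (m i) = nestedSum N (List.ofFn f) := by
  induction l generalizing N with
  | zero =>
    rw [List.ofFn_zero, nestedSum_nil]
    have : (Fintype.piFinset fun _ : Fin 0 => Finset.Icc 1 N).filter StrictAnti =
        {(fun i => i.elim0 : Fin 0 → ℕ)} := by
      ext m
      simp only [Finset.mem_filter, Fintype.mem_piFinset, Finset.mem_singleton]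
      exact ⟨fun _ => Subsingleton.elim _ _, fun _ => ⟨fun i => i.elim0, fun i => i.elim0⟩⟩
    rw [this]
    simp
  | succ l ih =>
    rw [List.ofFn_succ, nestedSum_cons]
    simp_rw [← ih, Finset.mul_sum]
    rw [Finset.sum_sigma']
    -- The outer index is `a = m_1 - 1`, so that the remaining entries, being smaller than `m_1`,
    -- range over `1, …, a`.
    refine Finset.sum_bij' (fun m _ => ⟨m 0 - 1, Fin.tail m⟩)
      (fun p _ => Fin.cons (p.1 + 1) p.2) ?_ ?_ ?_ ?_ ?_
    · intro m hm
      simp only [Finset.mem_filter, Fintype.mem_piFinset, Finset.mem_sigma, Finset.mem_range,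
        Finset.mem_Icc] at hm ⊢
      have h0 := hm.1 0
      refine ⟨by omega, fun i => ?_, fun i j hij => hm.2 (Fin.succ_lt_succ_iff.2 hij)⟩
      have h1 := hm.1 i.succ
      have h2 := hm.2 (Fin.succ_pos i)
      simp only [Fin.tail]
      omega
    · rintro ⟨a, m⟩ hm
      simp only [Finset.mem_filter, Fintype.mem_piFinset, Finset.mem_sigma, Finset.mem_range,
        Finset.mem_Icc] at hm ⊢
      obtain ⟨ha, hm, hanti⟩ := hm
      refine ⟨fun i => ?_, fun i j hij => ?_⟩
      · cases i using Fin.cases with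
        | zero => simp only [Fin.cons_zero]; omega
        | succ i => simp only [Fin.cons_succ]; have := hm i; omega
      · cases j using Fin.cases with
        | zero => simp at hij
        | succ j =>
          cases i using Fin.cases with
          | zero => simp only [Fin.cons_zero, Fin.cons_succ]; have := hm j; omega
          | succ i => simp only [Fin.cons_succ]; exact hanti (Fin.succ_lt_succ_iff.1 hij)
    · intro m hm
      simp only [Finset.mem_filter, Fintype.mem_piFinset, Finset.mem_Icc] at hm
      have h0 := hm.1 0
      have h1 : m 0 - 1 + 1 = m 0 := by omega
      simp only [h1]
      exact Fin.cons_self_tail m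
    · rintro ⟨a, m⟩ hm
      simp
    · intro m hm
      simp only [Finset.mem_filter, Fintype.mem_piFinset, Finset.mem_Icc] at hm
      have h0 := hm.1 0
      have h1 : m 0 - 1 + 1 = m 0 := by omega
      rw [Fin.prod_univ_succ, h1]
      rfl

end Semiring

/-! ### Convergence of nested sums -/

/-- Harmonic numbers as real numbers. -/
def harm (N : ℕ) : ℝ := ∑ a ∈ Finset.range N, 1 / ((a : ℝ) + 1)

theorem harm_nonneg (N : ℕ) : 0 ≤ harm N := Finset.sum_nonneg fun _ _ => by positivity

theorem harm_mono : Monotone harm := fun _ _ h =>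
  Finset.sum_le_sum_of_subset_of_nonneg (Finset.range_subset_range.2 h) fun _ _ _ => by positivity

theorem harm_le (N : ℕ) : harm N ≤ 1 + Real.log ((N : ℝ) + 1) := by
  have h : harm N = ((harmonic N : ℚ) : ℝ) := by
    simp [harm, harmonic]
  rw [h]
  refine (harmonic_le_one_add_log N).trans ?_
  rcases Nat.eq_zero_or_pos N with rfl | hN
  · simp
  · gcongr
    linarith

/-- Harmonic numbers grow slower than any power `m^ε`. -/
theorem summable_harm_pow_div (r : ℕ) :
    Summable fun m : ℕ => harm m ^ r * (1 / ((m : ℝ) + 1) ^ 2) := by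
  -- Chosen so that `ε r ≤ 1/2`, which leaves the summable exponent `-3/2`.
  set ε : ℝ := 1 / (2 * (r + 1)) with hε
  have hε0 : 0 < ε := by positivity
  have hεr : ε * r ≤ 1 / 2 := by
    rw [hε, div_mul_eq_mul_div, one_mul, div_le_div_iff₀ (by positivity) (by norm_num)]
    linarith
  have hs : Summable fun m : ℕ => (1 + 1 / ε) ^ r * (((m + 1 : ℕ) : ℝ) ^ (-(3 / 2) : ℝ)) := by
    refine Summable.mul_left _ ?_
    exact (summable_nat_add_iff 1).2 (Real.summable_nat_rpow.2 (by norm_num))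
  refine Summable.of_nonneg_of_le (fun m => mul_nonneg (pow_nonneg (harm_nonneg m) r)
    (by positivity)) (fun m => ?_) hs
  have hx : (1 : ℝ) ≤ (m : ℝ) + 1 := by linarith [Nat.cast_nonneg (α := ℝ) m]
  have hx0 : (0 : ℝ) < (m : ℝ) + 1 := by linarith
  have h1 : harm m ≤ (1 + 1 / ε) * ((m : ℝ) + 1) ^ ε := by
    refine (harm_le m).trans ?_
    have h2 := Real.log_le_rpow_div hx0.le hε0
    have h3 := Real.one_le_rpow hx hε0.le
    rw [add_mul, one_div_mul_eq_div]
    linarith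
  have h4 : harm m ^ r ≤ (1 + 1 / ε) ^ r * ((m : ℝ) + 1) ^ (1 / 2 : ℝ) := by
    refine (pow_le_pow_left₀ (harm_nonneg m) h1 r).trans ?_
    rw [mul_pow, ← Real.rpow_natCast ((_ : ℝ) ^ ε), ← Real.rpow_mul hx0.le]
    gcongr
  calc harm m ^ r * (1 / ((m : ℝ) + 1) ^ 2)
      ≤ (1 + 1 / ε) ^ r * ((m : ℝ) + 1) ^ (1 / 2 : ℝ) * (1 / ((m : ℝ) + 1) ^ 2) := by gcongr
    _ = _ := by
      have h5 : 1 / ((m : ℝ) + 1) ^ 2 = ((m : ℝ) + 1) ^ (-2 : ℝ) := by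
        rw [Real.rpow_neg hx0.le, one_div]
        norm_num
      rw [h5, mul_assoc, ← Real.rpow_add hx0]
      push_cast
      norm_num

/-- Forgetting the order of the indices bounds the nested sum by a product of independent harmonic
sums. -/
theorem abs_nestedSum_le {C : ℝ} {fs : List (ℕ → ℝ)}
    (h : ∀ f ∈ fs, ∀ a : ℕ, |f (a + 1)| ≤ C * (1 / ((a : ℝ) + 1))) (N : ℕ) :
    |nestedSum N fs| ≤ C ^ fs.length * harm N ^ fs.length := by
  induction fs generalizing N with
  | nil => simp
  | cons f fs ih =>
    have hC : 0 ≤ C := by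
      have := (abs_nonneg _).trans (h f (by simp) 0)
      simpa using this
    rw [nestedSum_cons, List.length_cons]
    refine (Finset.abs_sum_le_sum_abs _ _).trans ?_
    calc ∑ a ∈ Finset.range N, |f (a + 1) * nestedSum a fs|
        ≤ ∑ a ∈ Finset.range N, C ^ (fs.length + 1) * harm N ^ fs.length * (1 / ((a : ℝ) + 1)) := by
          refine Finset.sum_le_sum fun a ha => ?_
          rw [abs_mul]
          have h1 := h f (by simp) a
          have h2 := ih (fun g hg => h g (by simp [hg])) a
          have h3 : harm a ^ fs.length ≤ harm N ^ fs.length :=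
            pow_le_pow_left₀ (harm_nonneg a) (harm_mono (Finset.mem_range.1 ha).le) _
          calc |f (a + 1)| * |nestedSum a fs|
              ≤ C * (1 / ((a : ℝ) + 1)) * (C ^ fs.length * harm N ^ fs.length) := by
                gcongr
                exact h2.trans (by gcongr)
            _ = _ := by ring
      _ = _ := by
        rw [← Finset.mul_sum, pow_succ (harm N), mul_assoc]
        rfl

/-- The limit of the nested sums. -/
def nestedTsum : List (ℕ → ℝ) → ℝ
  | [] => 1
  | f :: fs => ∑' a : ℕ, f (a + 1) * nestedSum a fs

theorem abs_nestedTerm_le {C : ℝ} {f : ℕ → ℝ} {fs : List (ℕ → ℝ)}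
    (hf : ∀ a : ℕ, |f (a + 1)| ≤ C * (1 / ((a : ℝ) + 1) ^ 2))
    (h : ∀ f ∈ fs, ∀ a : ℕ, |f (a + 1)| ≤ C * (1 / ((a : ℝ) + 1))) (a : ℕ) :
    |f (a + 1) * nestedSum a fs| ≤
      C ^ (fs.length + 1) * (harm a ^ fs.length * (1 / ((a : ℝ) + 1) ^ 2)) := by
  rw [abs_mul]
  have h1 := hf a
  calc |f (a + 1)| * |nestedSum a fs|
      ≤ C * (1 / ((a : ℝ) + 1) ^ 2) * (C ^ fs.length * harm a ^ fs.length) :=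
        mul_le_mul h1 (abs_nestedSum_le h a) (abs_nonneg _) ((abs_nonneg _).trans h1)
    _ = _ := by ring

theorem summable_nestedTerm {C : ℝ} {f : ℕ → ℝ} {fs : List (ℕ → ℝ)}
    (hf : ∀ a : ℕ, |f (a + 1)| ≤ C * (1 / ((a : ℝ) + 1) ^ 2))
    (h : ∀ f ∈ fs, ∀ a : ℕ, |f (a + 1)| ≤ C * (1 / ((a : ℝ) + 1))) :
    Summable fun a : ℕ => f (a + 1) * nestedSum a fs :=
  Summable.of_norm_bounded ((summable_harm_pow_div fs.length).mul_left (C ^ (fs.length + 1)))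
    (abs_nestedTerm_le hf h)

theorem tendsto_nestedSum_nestedTsum {C : ℝ} {f : ℕ → ℝ} {fs : List (ℕ → ℝ)}
    (hf : ∀ a : ℕ, |f (a + 1)| ≤ C * (1 / ((a : ℝ) + 1) ^ 2))
    (h : ∀ f ∈ fs, ∀ a : ℕ, |f (a + 1)| ≤ C * (1 / ((a : ℝ) + 1))) :
    Tendsto (fun N => nestedSum N (f :: fs)) atTop (𝓝 (nestedTsum (f :: fs))) := by
  simp_rw [nestedSum_cons]
  exact (summable_nestedTerm hf h).hasSum.tendsto_sum_nat

theorem tendsto_nestedSum {α ι : Type*} {l : Filter α} {L : List ι} {F : α → ι → ℕ → ℝ}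
    {g : ι → ℕ → ℝ} (h : ∀ i ∈ L, ∀ a : ℕ, Tendsto (fun q => F q i (a + 1)) l (𝓝 (g i (a + 1))))
    (N : ℕ) : Tendsto (fun q => nestedSum N (L.map (F q))) l (𝓝 (nestedSum N (L.map g))) := by
  induction L generalizing N with
  | nil => simpa using tendsto_const_nhds
  | cons i L ih =>
    simp only [List.map_cons, nestedSum_cons]
    exact tendsto_finsetSum _ fun a _ =>
      (h i (by simp) a).mul (ih (fun j hj => h j (by simp [hj])) a)

/-- Dominated convergence for nested sums. -/
theorem tendsto_nestedTsum {α ι : Type*} {l : Filter α} {i : ι} {L : List ι}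
    {F : α → ι → ℕ → ℝ} {g : ι → ℕ → ℝ} {C : ℝ}
    (h : ∀ j ∈ i :: L, ∀ a : ℕ, Tendsto (fun q => F q j (a + 1)) l (𝓝 (g j (a + 1))))
    (hi : ∀ᶠ q in l, ∀ a : ℕ, |F q i (a + 1)| ≤ C * (1 / ((a : ℝ) + 1) ^ 2))
    (hL : ∀ᶠ q in l, ∀ j ∈ L, ∀ a : ℕ, |F q j (a + 1)| ≤ C * (1 / ((a : ℝ) + 1))) :
    Tendsto (fun q => nestedTsum ((i :: L).map (F q))) l (𝓝 (nestedTsum ((i :: L).map g))) := by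
  simp only [List.map_cons, nestedTsum]
  refine tendsto_tsum_of_dominated_convergence
    (bound := fun a => C ^ (L.length + 1) * (harm a ^ L.length * (1 / ((a : ℝ) + 1) ^ 2)))
    ((summable_harm_pow_div L.length).mul_left _) (fun a => ?_) ?_
  · exact (h i (by simp) a).mul (tendsto_nestedSum (fun j hj => h j (by simp [hj])) a)
  · filter_upwards [hi, hL] with q h1 h2 a
    have := abs_nestedTerm_le (fs := L.map (F q)) h1 (by simpa using h2) a
    simpa using this

theorem nestedSum_nonneg {fs : List (ℕ → ℝ)} (h : ∀ f ∈ fs, ∀ a, 0 ≤ f a) (N : ℕ) :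
    0 ≤ nestedSum N fs := by
  induction fs generalizing N with
  | nil => simp
  | cons f fs ih =>
    rw [nestedSum_cons]
    exact Finset.sum_nonneg fun a _ =>
      mul_nonneg (h f (by simp) _) (ih (fun g hg => h g (by simp [hg])) a)

theorem monotone_nestedSum {fs : List (ℕ → ℝ)} (h : ∀ f ∈ fs, ∀ a, 0 ≤ f a) :
    Monotone fun N => nestedSum N fs := by
  refine monotone_nat_of_le_succ fun N => ?_
  cases fs with
  | nil => simp
  | cons f fs =>
    rw [nestedSum_succ]
    have := mul_nonneg (h f (by simp) (N + 1))
      (nestedSum_nonneg (fs := fs) (fun g hg => h g (by simp [hg])) N)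
    linarith

/-- The terms are nonnegative, so the unconditional sum is the limit along the exhausting finite
sets of sequences with entries at most `N`, and over these the sum is the nested sum. -/
theorem hasSum_decSeq {r : ℕ} {f : Fin r → ℕ → ℝ} (hf : ∀ i a, 0 ≤ f i a) {S : ℝ}
    (h : Tendsto (fun N => nestedSum N (List.ofFn f)) atTop (𝓝 S)) :
    HasSum (fun m : DecSeq r => ∏ i, f i (m.1 i)) S := by
  classical
  have hnn : ∀ g ∈ List.ofFn f, ∀ a, 0 ≤ g a := by
    intro g hg a
    obtain ⟨i, rfl⟩ := (List.mem_ofFn' f g).1 hg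
    exact hf i a
  set T : ℕ → Finset (DecSeq r) := fun N =>
    (Fintype.piFinset fun _ : Fin r => Finset.Icc 1 N).subtype _ with hT
  have hsum : ∀ N, ∑ m ∈ T N, ∏ i, f i (m.1 i) = nestedSum N (List.ofFn f) := fun N => by
    rw [← sum_strictAnti_eq_nestedSum, hT]
    refine (Finset.sum_subtype_eq_sum_filter (fun m : Fin r → ℕ => ∏ i, f i (m i))).trans ?_
    refine Finset.sum_congr (Finset.ext fun m => ?_) fun _ _ => rfl
    simp only [Finset.mem_filter, Fintype.mem_piFinset, Finset.mem_Icc]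
    exact ⟨fun h => ⟨h.1, h.2.1⟩, fun h => ⟨h.1, h.2, fun i => (h.1 i).1⟩⟩
  have hmono : Monotone T := fun M N hMN m hm => by
    simp only [hT, Finset.mem_subtype, Fintype.mem_piFinset, Finset.mem_Icc] at hm ⊢
    exact fun i => ⟨(hm i).1, (hm i).2.trans hMN⟩
  have hcover : ∀ m : DecSeq r, ∃ N, m ∈ T N := fun m => by
    refine ⟨∑ i, m.1 i, ?_⟩
    simp only [hT, Finset.mem_subtype, Fintype.mem_piFinset, Finset.mem_Icc]
    exact fun i => ⟨m.2.2 i, Finset.single_le_sum (f := m.1) (fun _ _ => Nat.zero_le _)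
      (Finset.mem_univ i)⟩
  have hTt : Tendsto T atTop atTop := tendsto_atTop_finset_of_monotone hmono hcover
  have hle : ∀ N, nestedSum N (List.ofFn f) ≤ S := (monotone_nestedSum hnn).ge_of_tendsto h
  have hsm : Summable fun m : DecSeq r => ∏ i, f i (m.1 i) := by
    refine summable_of_sum_le (c := S) (fun m => Finset.prod_nonneg fun i _ => hf i _) fun u => ?_
    obtain ⟨N, hN⟩ := (hTt.eventually_ge_atTop u).exists
    refine le_trans ?_ (hle N)
    rw [← hsum]
    exact Finset.sum_le_sum_of_subset_of_nonneg hN fun m _ _ =>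
      Finset.prod_nonneg fun i _ => hf i _
  have hlim := hsm.hasSum.comp hTt
  simp only [Function.comp_def, hsum] at hlim
  rw [← tendsto_nhds_unique hlim h]
  exact hsm.hasSum

/-! ### Multiple zeta values -/

/-- The function `m ↦ m ^ (-k)`. -/
def zetaTerm (k : ℕ+) (m : ℕ) : ℝ := 1 / (m : ℝ) ^ (k : ℕ)

theorem zetaTerm_nonneg (k : ℕ+) (m : ℕ) : 0 ≤ zetaTerm k m := by
  unfold zetaTerm; positivity

theorem abs_zetaTerm_le (k : ℕ+) (a : ℕ) : |zetaTerm k (a + 1)| ≤ 1 * (1 / ((a : ℝ) + 1)) := by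
  rw [abs_of_nonneg (zetaTerm_nonneg _ _), zetaTerm, one_mul]
  push_cast
  gcongr
  exact le_self_pow₀ (by linarith [Nat.cast_nonneg (α := ℝ) a]) k.ne_zero

theorem abs_zetaTerm_le_of_ne_one {k : ℕ+} (hk : k ≠ 1) (a : ℕ) :
    |zetaTerm k (a + 1)| ≤ 1 * (1 / ((a : ℝ) + 1) ^ 2) := by
  rw [abs_of_nonneg (zetaTerm_nonneg _ _), zetaTerm, one_mul]
  push_cast
  have h2 : 2 ≤ (k : ℕ) := by
    have h1 : (k : ℕ) ≠ 1 := fun h => hk (PNat.eq h)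
    have := k.pos
    omega
  gcongr
  linarith [Nat.cast_nonneg (α := ℝ) a]

/-- The multiple zeta value (for words not starting with `z_1`). -/
def mzv (ks : List ℕ+) : ℝ := nestedTsum (ks.map zetaTerm)

theorem tendsto_mzv {ks : List ℕ+} (h : Admissible ks) :
    Tendsto (fun N => nestedSum N (ks.map zetaTerm)) atTop (𝓝 (mzv ks)) := by
  cases ks with
  | nil => simp [mzv, nestedTsum]
  | cons k ks =>
    refine tendsto_nestedSum_nestedTsum (C := 1)
      (abs_zetaTerm_le_of_ne_one (by simpa [Admissible] using h)) fun f hf => ?_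
    obtain ⟨k, -, rfl⟩ := List.mem_map.1 hf
    exact abs_zetaTerm_le k

theorem hasSum_mzvTerm {ks : List ℕ+} (h : Admissible ks) : HasSum (mzvTerm ks) (mzv ks) := by
  have h1 : ks.map zetaTerm = List.ofFn fun i => zetaTerm (ks.get i) := by
    conv_lhs => rw [← List.ofFn_get ks, List.map_ofFn]
    rfl
  have h2 := tendsto_mzv h
  simp only [h1] at h2
  exact hasSum_decSeq (fun i a => zetaTerm_nonneg _ a) h2

/-- Truncated multiple zeta values, as a linear map. -/
def truncZeta (N : ℕ) : StuffleAlg →ₗ[ℚ] ℝ :=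
  (Finsupp.linearCombination ℚ fun ks : List ℕ+ => nestedSum N (ks.map zetaTerm)) ∘ₗ
    ofWords.symm.toLinearMap

theorem truncZeta_sword (N : ℕ) (w : List ℕ+) :
    truncZeta N (sword w) = nestedSum N (w.map zetaTerm) := by
  simp [truncZeta, sword, word]

theorem truncZeta_zero_cat (a : ℕ+) (x : StuffleAlg) : truncZeta 0 (cat a x) = 0 := by
  induction x using stuffleAlg_induction with
  | h0 => simp
  | hadd x y hx hy => rw [map_add, map_add, hx, hy, add_zero]
  | hsmul r x hx => rw [map_smul, map_smul, hx, smul_zero]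
  | hw w => rw [cat_sword, truncZeta_sword]; simp [nestedSum_cons]

theorem truncZeta_succ_cat (N : ℕ) (a : ℕ+) (x : StuffleAlg) :
    truncZeta (N + 1) (cat a x) = truncZeta N (cat a x) + zetaTerm a (N + 1) * truncZeta N x := by
  induction x using stuffleAlg_induction with
  | h0 => simp
  | hadd x y hx hy => simp only [map_add, hx, hy]; ring
  | hsmul r x hx => simp only [map_smul, hx, smul_add, mul_smul_comm]
  | hw w => simp only [cat_sword, truncZeta_sword, List.map_cons, nestedSum_succ]

/-- Induction on the truncation. Passing from `N` to `N + 1` adds to each factor the terms with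
largest index `N + 1`; the product of these two increments is the one of the merged letter, as
`m^(-a) m^(-b) = m^(-(a+b))`. -/
theorem truncZeta_mul (N : ℕ) (x y : StuffleAlg) :
    truncZeta N (x * y) = truncZeta N x * truncZeta N y := by
  have h1 : ∀ N, truncZeta N 1 = 1 := fun N => by rw [← sword_nil, truncZeta_sword]; simp
  induction N generalizing x y with
  | zero =>
    induction x using stuffleAlg_induction with
    | h0 => simp
    | hadd x x' hx hx' => rw [add_mul, map_add, map_add, hx, hx', add_mul]
    | hsmul r x hx => rw [smul_mul_assoc, map_smul, map_smul, hx, smul_mul_assoc]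
    | hw u =>
    induction y using stuffleAlg_induction with
    | h0 => simp
    | hadd x x' hx hx' => rw [mul_add, map_add, map_add, hx, hx', mul_add]
    | hsmul r x hx => rw [mul_smul_comm, map_smul, map_smul, hx, mul_smul_comm]
    | hw v =>
    cases u with
    | nil => simp [sword_nil, h1]
    | cons a u =>
    cases v with
    | nil => simp [sword_nil, h1]
    | cons b v =>
      rw [← cat_sword, ← cat_sword, cat_mul_cat]
      simp only [map_add, truncZeta_zero_cat]
      ring
  | succ N ih =>
    induction x using stuffleAlg_induction with
    | h0 => simp
    | hadd x x' hx hx' => rw [add_mul, map_add, map_add, hx, hx', add_mul]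
    | hsmul r x hx => rw [smul_mul_assoc, map_smul, map_smul, hx, smul_mul_assoc]
    | hw u =>
    induction y using stuffleAlg_induction with
    | h0 => simp
    | hadd x x' hx hx' => rw [mul_add, map_add, map_add, hx, hx', mul_add]
    | hsmul r x hx => rw [mul_smul_comm, map_smul, map_smul, hx, mul_smul_comm]
    | hw v =>
    cases u with
    | nil => simp [sword_nil, h1]
    | cons a u =>
    cases v with
    | nil => simp [sword_nil, h1]
    | cons b v =>
      have hab : zetaTerm (a + b) (N + 1) = zetaTerm a (N + 1) * zetaTerm b (N + 1) := by
        simp [zetaTerm, pow_add, mul_comm]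
      have h2 := ih (cat a (sword u)) (cat b (sword v))
      rw [cat_mul_cat, map_add, map_add] at h2
      rw [← cat_sword, ← cat_sword, cat_mul_cat]
      simp only [map_add, truncZeta_succ_cat, ih, hab]
      linear_combination h2

/-- The linear extension of `mzv` to all words. -/
def mzvMap : StuffleAlg →ₗ[ℚ] ℝ :=
  (Finsupp.linearCombination ℚ mzv) ∘ₗ ofWords.symm.toLinearMap

theorem mzvMap_sword (w : List ℕ+) : mzvMap (sword w) = mzv w := by
  simp [mzvMap, sword, word]

theorem H0_induction {p : StuffleAlg → Prop} {x : StuffleAlg} (hx : del x = 0) (h0 : p 0)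
    (hadd : ∀ x y, p x → p y → p (x + y)) (hsmul : ∀ (r : ℚ) x, p x → p (r • x))
    (hw : ∀ w, Admissible w → p (sword w)) : p x := by
  have hx' : ofWords.symm x ∈ H0 := (mem_H0_iff_del_eq_zero _).2 hx
  suffices ∀ y ∈ H0, p (ofWords y) by simpa using this _ hx'
  intro y hy
  induction hy using Submodule.span_induction with
  | mem y h => obtain ⟨w, hw', rfl⟩ := h; exact hw w hw'
  | zero => simpa using h0
  | add y z _ _ hy hz => rw [map_add]; exact hadd _ _ hy hz
  | smul r y _ hy => rw [map_smul]; exact hsmul r _ hy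

theorem tendsto_truncZeta {x : StuffleAlg} (hx : del x = 0) :
    Tendsto (fun N => truncZeta N x) atTop (𝓝 (mzvMap x)) := by
  refine H0_induction (p := fun x => Tendsto (fun N => truncZeta N x) atTop (𝓝 (mzvMap x)))
    hx ?_ ?_ ?_ ?_
  · simp
  · intro x y hx hy
    simp only [map_add]
    exact hx.add hy
  · intro r x hx
    simp only [map_smul]
    exact hx.const_smul r
  · intro w hw
    simp only [truncZeta_sword, mzvMap_sword]
    exact tendsto_mzv hw

/-- The product also lies in `𝔥⁰`, so the truncated identity passes to the limit on both sides. -/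
theorem mzvMap_mul {x y : StuffleAlg} (hx : del x = 0) (hy : del y = 0) :
    mzvMap (x * y) = mzvMap x * mzvMap y := by
  have hxy : del (x * y) = 0 := by rw [del_mul, hx, hy, zero_mul, mul_zero, add_zero]
  refine tendsto_nhds_unique (tendsto_truncZeta hxy) ?_
  simp only [truncZeta_mul]
  exact (tendsto_truncZeta hx).mul (tendsto_truncZeta hy)

/-- The stuffle regularized multiple zeta values. -/
def zetaStar : Words ℕ+ →ₗ[ℚ] ℝ :=
  mzvMap ∘ₗ ((Polynomial.lcoeff StuffleAlg 0).restrictScalars ℚ) ∘ₗ toPoly ∘ₗ ofWords.toLinearMap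

theorem zetaStar_apply (x : Words ℕ+) :
    zetaStar x = mzvMap ((toPoly (ofWords x)).coeff 0) := rfl

theorem zetaStar_word {w : List ℕ+} (hw : Admissible w) : zetaStar (word w) = mzv w := by
  rw [zetaStar_apply, ofWords_word, toPoly_of_del_eq_zero, Polynomial.coeff_C_zero, mzvMap_sword]
  rw [del_sword]
  exact if_neg hw

theorem isStuffleRegZeta_zetaStar : IsStuffleRegZeta zetaStar := by
  refine ⟨⟨?_, fun x y => ?_⟩, ?_, fun ks hks => ?_⟩
  · rw [zetaStar_word (by simp [Admissible])]
    rfl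
  · change zetaStar (stuffle x y) = _
    rw [zetaStar_apply, ofWords_stuffle, toPoly_mul, Polynomial.mul_coeff_zero,
      mzvMap_mul (del_coeff_toPoly _ _) (del_coeff_toPoly _ _)]
    rfl
  · rw [zetaStar_apply, ofWords_word, toPoly_z1, Polynomial.coeff_X_zero, map_zero]
  · rw [zetaStar_word hks]
    exact hasSum_mzvTerm hks

/-- On `𝔥⁰[z_1]` a homomorphism that kills `z_1` sees only the constant coefficient, and on `𝔥⁰` its
values are prescribed. -/
theorem IsStuffleRegZeta.eq_zetaStar {φ : Words ℕ+ →ₗ[ℚ] ℝ} (h : IsStuffleRegZeta φ) :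
    φ = zetaStar := by
  obtain ⟨⟨hone, hmul⟩, h1, hadm⟩ := h
  set ψ : StuffleAlg →ₗ[ℚ] ℝ := φ ∘ₗ ofWords.symm.toLinearMap with hψ
  have hψmul : ∀ x y, ψ (x * y) = ψ x * ψ y := fun x y => hmul _ _
  have hψone : ψ 1 = 1 := hone
  have hψz : ψ (sword [1]) = 0 := h1
  have hψH0 : ∀ x, del x = 0 → ψ x = mzvMap x := fun x hx => by
    refine H0_induction (p := fun x => ψ x = mzvMap x) hx ?_ ?_ ?_ ?_
    · simp
    · intro x y hx hy; rw [map_add, map_add, hx, hy]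
    · intro r x hx; rw [map_smul, map_smul, hx]
    · intro w hw
      rw [mzvMap_sword]
      exact (hadm w hw).unique (hasSum_mzvTerm hw)
  have hpow : ∀ j, ψ (sword [1] ^ j) = if j = 0 then 1 else 0 := fun j => by
    cases j with
    | zero => simpa using hψone
    | succ j => rw [pow_succ, hψmul, hψz, mul_zero]; simp
  ext w
  change φ (word w) = zetaStar (word w)
  rw [zetaStar_apply, ← hψH0 _ (del_coeff_toPoly _ _)]
  change ψ (sword w) = _
  conv_lhs => rw [← eval_toPoly (sword w), Polynomial.eval_eq_sum, Polynomial.sum_def, map_sum]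
  simp only [hψmul, hpow, mul_ite, mul_one, mul_zero, Finset.sum_ite_eq', ofWords_word]
  split_ifs with h
  · rfl
  · rw [Polynomial.notMem_support_iff.1 h, map_zero]

/-! ### Coefficients of substituted power series -/

section Formal

variable {A : Type} [CommRing A]

/-- The coefficient of `X_1^{k_0} ⋯ X_n^{k_{n-1}}` in the depth `n` part of a mould. -/
def Mould.cf (Z : Mould A) (n : ℕ) (k : ℕ → ℕ) : A :=
  MvPowerSeries.coeff (Finsupp.equivFunOnFinite.symm fun i : Fin n => k i) (Z n)

/-- By `he` the images of the `e i` partition the variables. For series in disjoint variables a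
monomial of the product splits in only one way, so its coefficient is a product of coefficients. -/
theorem coeff_prod_rename {ι τ : Type} [Fintype ι] [Finite τ] {σ : ι → Type}
    (e : ∀ i, σ i ↪ τ) (he : Function.Bijective fun p : Σ i, σ i => e p.1 p.2)
    (F : ∀ i, MvPowerSeries (σ i) A) (d : τ →₀ ℕ) :
    MvPowerSeries.coeff d (∏ i, MvPowerSeries.rename (e i) (F i)) =
      ∏ i, MvPowerSeries.coeff (d.comapDomain (e i) (e i).injective.injOn) (F i) := by
  classical
  have hne : ∀ {i j : ι} (s : σ i), i ≠ j → e i s ∉ Set.range (e j) := by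
    rintro i j s hij ⟨s', hs'⟩
    have := @he.1 ⟨j, s'⟩ ⟨i, s⟩ hs'
    exact hij (congrArg Sigma.fst this).symm
  have hsum : ∀ (y : ∀ i, σ i →₀ ℕ) (i : ι) (s : σ i),
      (∑ j, Finsupp.embDomain (e j) (y j)) (e i s) = y i s := by
    intro y i s
    rw [Finsupp.finsetSum_apply, Finset.sum_eq_single i]
    · exact Finsupp.embDomain_apply_self _ _ _
    · exact fun j _ hj => Finsupp.embDomain_of_notMem_range _ _ _ (hne s (Ne.symm hj))
    · simp
  set y₀ : ∀ i, σ i →₀ ℕ := fun i => d.comapDomain (e i) (e i).injective.injOn with hy₀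
  rw [MvPowerSeries.coeff_prod, Finset.sum_eq_single
    (Finsupp.equivFunOnFinite.symm fun i => Finsupp.embDomain (e i) (y₀ i))]
  · exact Finset.prod_congr rfl fun i _ => by
      simp only [Finsupp.equivFunOnFinite_symm_apply_apply]
      rw [MvPowerSeries.coeff_embDomain_rename]
  · intro l hl hne'
    by_contra hprod
    apply hne'
    have h1 : ∀ i, ∃ y : σ i →₀ ℕ, l i = Finsupp.embDomain (e i) y := by
      intro i
      by_contra hi
      refine hprod (Finset.prod_eq_zero (Finset.mem_univ i) ?_)
      refine MvPowerSeries.coeff_rename_eq_zero _ _ ?_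
      rintro ⟨y, hy⟩
      exact hi ⟨y, by rw [← hy, Finsupp.embDomain_eq_mapDomain]⟩
    choose y hy using h1
    have hl' := (Finset.mem_finsuppAntidiag.1 hl).1
    ext1 i
    rw [hy, Finsupp.equivFunOnFinite_symm_apply_apply]
    congr 1
    ext s
    have h2 := hsum y i s
    simp_rw [← hy, hl'] at h2
    rw [← h2, hy₀, Finsupp.comapDomain_apply]
  · intro h
    exfalso
    apply h
    rw [Finset.mem_finsuppAntidiag]
    refine ⟨?_, by simp⟩
    ext t
    obtain ⟨⟨i, s⟩, rfl⟩ := he.2 t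
    simp only [Finsupp.equivFunOnFinite_symm_apply_apply]
    exact hsum y₀ i s

theorem constantCoeff_X1 (r i : ℕ) : MvPowerSeries.constantCoeff (X1 A r i) = 0 := by
  unfold X1; split_ifs <;> simp

theorem constantCoeff_XX (r i : ℕ) : MvPowerSeries.constantCoeff (XX A r i) = 0 := by
  unfold XX; split_ifs <;> simp

theorem constantCoeff_YY (r i : ℕ) : MvPowerSeries.constantCoeff (YY A r i) = 0 := by
  unfold YY; split_ifs <;> simp

theorem ev_eq_rename (Z : Mould A) {n r : ℕ} (e : Fin n ↪ Fin r) (x : ℕ → MvPowerSeries (Fin r) A)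
    (hx : ∀ i : Fin n, x i = MvPowerSeries.X (e i)) :
    Z.ev n x = MvPowerSeries.rename e (Z n) := by
  rw [Mould.ev, MvPowerSeries.rename_eq_subst]
  congr 1
  funext i
  exact hx i

/-- The embedding of `n` consecutive indices, starting with `s`. -/
def shiftEmb (s n r : ℕ) (h : s + n ≤ r) : Fin n ↪ Fin r where
  toFun i := ⟨s + i, by omega⟩
  inj' i j hij := by
    simp only [Fin.mk.injEq] at hij
    exact Fin.ext (by omega)

theorem cf_mul (Z W : Mould A) (r : ℕ) (k : ℕ → ℕ) :
    (Z.mul W).cf r k = ∑ j ∈ Finset.range (r + 1), Z.cf j k * W.cf (r - j) fun i => k (j + i) := by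
  unfold Mould.cf Mould.mul
  rw [map_sum]
  refine Finset.sum_congr rfl fun j hj => ?_
  have hj' : j ≤ r := Nat.lt_succ_iff.1 (Finset.mem_range.1 hj)
  rw [ev_eq_rename Z (shiftEmb 0 j r (by omega)), ev_eq_rename W (shiftEmb j (r - j) r (by omega))]
  -- The two factors are arranged as a family over `Bool` with disjoint blocks of variables, so that
  -- `coeff_prod_rename` applies.
  · let σ : Bool → Type := fun b => Fin (bif b then j else r - j)
    let e : ∀ b, σ b ↪ Fin r := fun b =>
      match b with
      | true => shiftEmb 0 j r (by omega)
      | false => shiftEmb j (r - j) r (by omega)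
    let F : ∀ b, MvPowerSeries (σ b) A := fun b =>
      match b with
      | true => Z j
      | false => W (r - j)
    have he : Function.Bijective fun p : Σ b, σ b => e p.1 p.2 := by
      constructor
      · rintro ⟨b, s⟩ ⟨b', s'⟩ h
        have h' := congrArg Fin.val h
        match b, b', s, s', h' with
        | true, true, s, s', h' =>
          have h' : 0 + Fin.val (n := j) s = 0 + Fin.val (n := j) s' := h'
          have : s = s' := Fin.ext (n := j) (by omega)
          rw [this]
        | true, false, s, s', h' =>
          have h' : 0 + Fin.val (n := j) s = j + Fin.val (n := r - j) s' := h'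
          have := Fin.is_lt (n := j) s
          omega
        | false, true, s, s', h' =>
          have h' : j + Fin.val (n := r - j) s = 0 + Fin.val (n := j) s' := h'
          have := Fin.is_lt (n := j) s'
          omega
        | false, false, s, s', h' =>
          have h' : j + Fin.val (n := r - j) s = j + Fin.val (n := r - j) s' := h'
          have : s = s' := Fin.ext (n := r - j) (by omega)
          rw [this]
      · intro t
        by_cases ht : (t : ℕ) < j
        · exact ⟨⟨true, (⟨t, ht⟩ : Fin j)⟩, Fin.ext (Nat.zero_add _)⟩
        · refine ⟨⟨false, (⟨t - j, by omega⟩ : Fin (r - j))⟩, Fin.ext ?_⟩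
          change j + ((t : ℕ) - j) = t
          omega
    have := coeff_prod_rename e he F (Finsupp.equivFunOnFinite.symm fun i : Fin r => k i)
    rw [Fintype.prod_bool, Fintype.prod_bool] at this
    refine this.trans ?_
    have h1 : Finsupp.comapDomain (e true) (Finsupp.equivFunOnFinite.symm fun i : Fin r => k i)
        (e true).injective.injOn = Finsupp.equivFunOnFinite.symm fun i : Fin j => k i := by
      ext i
      change k (0 + Fin.val (n := j) i) = k (Fin.val (n := j) i)
      rw [zero_add]
    have h2 : Finsupp.comapDomain (e false) (Finsupp.equivFunOnFinite.symm fun i : Fin r => k i)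
        (e false).injective.injOn =
          Finsupp.equivFunOnFinite.symm fun i : Fin (r - j) => k (j + i) := by
      ext i
      rfl
    rw [h1, h2]
  · intro i
    have := i.2
    rw [X1, dif_pos (by omega)]
    rfl
  · intro i
    have := i.2
    rw [X1, dif_pos (by omega)]
    simp [shiftEmb]

/-! ### Setting the lower variables to zero -/

theorem killCompl_subst {σ τ υ : Type} {e : υ ↪ τ} {a : σ → MvPowerSeries τ A}
    (ha : MvPowerSeries.HasSubst a)
    (ha' : MvPowerSeries.HasSubst fun s => MvPowerSeries.killCompl e (a s))
    (F : MvPowerSeries σ A) :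
    MvPowerSeries.killCompl e (MvPowerSeries.subst a F) =
      MvPowerSeries.subst (fun s => MvPowerSeries.killCompl e (a s)) F := by
  ext d
  rw [MvPowerSeries.coeff_killCompl, MvPowerSeries.coeff_subst ha, MvPowerSeries.coeff_subst ha']
  refine finsum_congr fun u => ?_
  rw [← MvPowerSeries.coeff_killCompl, map_finsuppProd]
  simp only [map_pow]

theorem constantCoeff_killCompl {τ υ : Type} {e : υ ↪ τ} (F : MvPowerSeries τ A) :
    MvPowerSeries.constantCoeff (MvPowerSeries.killCompl e F) = MvPowerSeries.constantCoeff F := by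
  rw [← MvPowerSeries.coeff_zero_eq_constantCoeff_apply, MvPowerSeries.coeff_killCompl,
    Finsupp.embDomain_zero, MvPowerSeries.coeff_zero_eq_constantCoeff_apply]

/-- Set the lower variables to zero. -/
def killLower (A : Type) [CommRing A] (r : ℕ) :
    MvPowerSeries (Fin r ⊕ Fin r) A →ₐ[A] MvPowerSeries (Fin r) A :=
  MvPowerSeries.killCompl (Function.Embedding.inl : Fin r ↪ Fin r ⊕ Fin r)

theorem constantCoeff_killLower {r : ℕ} (F : MvPowerSeries (Fin r ⊕ Fin r) A) :
    MvPowerSeries.constantCoeff (killLower A r F) = MvPowerSeries.constantCoeff F :=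
  constantCoeff_killCompl F

theorem killLower_XX (r i : ℕ) : killLower A r (XX A r i) = X1 A r i := by
  unfold XX X1
  split_ifs with h
  · exact MvPowerSeries.killCompl_X (e := Function.Embedding.inl) (⟨i, h⟩ : Fin r)
  · exact map_zero _

theorem killLower_YY (r i : ℕ) : killLower A r (YY A r i) = 0 := by
  unfold YY
  split_ifs with h
  · exact MvPowerSeries.killCompl_X_eq_zero (by simp)
  · exact map_zero _

theorem killLower_subst {σ : Type} [Finite σ] {r : ℕ} {a : σ → MvPowerSeries (Fin r ⊕ Fin r) A}
    (ha : ∀ s, MvPowerSeries.constantCoeff (a s) = 0) (F : MvPowerSeries σ A) :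
    killLower A r (MvPowerSeries.subst a F) =
      MvPowerSeries.subst (fun s => killLower A r (a s)) F :=
  killCompl_subst (MvPowerSeries.hasSubst_of_constantCoeff_zero ha)
    (MvPowerSeries.hasSubst_of_constantCoeff_zero fun s => by
      rw [constantCoeff_killCompl, ha]) F

theorem killLower_eq_subst {r : ℕ} (F : MvPowerSeries (Fin r ⊕ Fin r) A) :
    killLower A r F =
      MvPowerSeries.subst (Sum.elim MvPowerSeries.X fun _ => (0 : MvPowerSeries (Fin r) A)) F := by
  conv_lhs => rw [← id_eq F, ← MvPowerSeries.subst_self]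
  rw [killLower_subst (fun s => MvPowerSeries.constantCoeff_X s)]
  congr 1
  funext s
  rcases s with s | s
  · exact MvPowerSeries.killCompl_X (e := Function.Embedding.inl) s
  · exact MvPowerSeries.killCompl_X_eq_zero (by simp)

/-- The mould obtained from a bimould by setting the lower variables to zero. -/
def Bimould.atZero (B : Bimould A) : Mould A := fun r => killLower A r (B r)

theorem killLower_ev (B : Bimould A) {r : ℕ} (n : ℕ) {x y : ℕ → MvPowerSeries (Fin r ⊕ Fin r) A}
    (hx : ∀ i, MvPowerSeries.constantCoeff (x i) = 0)
    (hy : ∀ i, MvPowerSeries.constantCoeff (y i) = 0) (hy' : ∀ i, killLower A r (y i) = 0) :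
    killLower A r (B.ev n x y) = B.atZero.ev n fun i => killLower A r (x i) := by
  unfold Bimould.ev Mould.ev Bimould.atZero
  rw [killLower_subst, killLower_eq_subst, MvPowerSeries.subst_comp_subst_apply]
  · congr 1
    funext s
    rcases s with s | s
    · simp only [Sum.elim_inl]
      rw [MvPowerSeries.subst_X]
      exact MvPowerSeries.hasSubst_of_constantCoeff_zero fun i => by
        rw [constantCoeff_killLower, hx]
    · simp only [Sum.elim_inr, hy']
      symm
      rw [← MvPowerSeries.coe_substAlgHom, map_zero]
      exact MvPowerSeries.hasSubst_of_constantCoeff_zero fun i => by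
        rw [constantCoeff_killLower, hx]
  · exact MvPowerSeries.hasSubst_of_constantCoeff_zero fun s => by rcases s with s | s <;> simp
  · exact MvPowerSeries.hasSubst_of_constantCoeff_zero fun i => by
      rw [constantCoeff_killLower, hx]
  · intro s
    rcases s with s | s
    · exact hx _
    · exact hy _

/-- Setting the lower variables to zero is a ring homomorphism that respects the blocks of
variables. As `G` uses only the coefficients of `Y^0`, the problem reduces from bimoulds to moulds.
-/
theorem atZero_mul (B C : Bimould A) : (B.mul C).atZero = B.atZero.mul C.atZero := by
  funext r
  unfold Bimould.atZero Bimould.mul Mould.mul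
  rw [map_sum]
  refine Finset.sum_congr rfl fun j _ => ?_
  rw [map_mul, killLower_ev B j (constantCoeff_XX r) (constantCoeff_YY r) (killLower_YY r),
    killLower_ev C (r - j) (fun i => constantCoeff_XX r _) (fun i => constantCoeff_YY r _)
      (fun i => killLower_YY r _)]
  simp only [killLower_XX]
  rfl

theorem atZero_upper (Z : Mould A) : Z.upper.atZero = Z := by
  funext r
  unfold Bimould.atZero Mould.upper
  rw [killLower_subst fun i : Fin r => constantCoeff_XX r i]
  have : (fun i : Fin r => killLower A r (XX A r i)) = MvPowerSeries.X := by
    funext i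
    rw [killLower_XX, X1, dif_pos i.2]
  rw [this, MvPowerSeries.subst_self]
  rfl

theorem atZero_lower (Z : Mould A) (r : ℕ) :
    Z.lower.atZero r = MvPowerSeries.C (MvPowerSeries.constantCoeff (Z r)) := by
  unfold Bimould.atZero Mould.lower
  rw [killLower_subst fun i : Fin r => constantCoeff_YY r i]
  have : (fun i : Fin r => killLower A r (YY A r i)) = 0 := by
    funext i
    rw [killLower_YY]
    rfl
  rw [this, MvPowerSeries.subst_zero_eq_C_constantCoeff]
  simp

theorem atZero_constBimould (F : PowerSeries A) :
    (constBimould F).atZero = constMould F := by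
  funext r
  exact MvPowerSeries.killCompl_C _

theorem cf_of_const {Z : Mould A} {r : ℕ} {c : A} (h : Z r = MvPowerSeries.C c) (k : ℕ → ℕ) :
    Z.cf r k = if ∀ i < r, k i = 0 then c else 0 := by
  classical
  rw [Mould.cf, h, MvPowerSeries.coeff_C]
  refine if_congr ?_ rfl rfl
  rw [DFunLike.ext_iff, Fin.forall_iff]
  simp

theorem constantCoeff_eq_cf (Z : Mould A) (r : ℕ) :
    MvPowerSeries.constantCoeff (Z r) = Z.cf r fun _ => 0 := by
  rw [Mould.cf, ← MvPowerSeries.coeff_zero_eq_constantCoeff_apply]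
  congr 2
  ext i
  rfl

theorem eq_one_of_cf_zero {Z : Mould A} (h : Z.cf 0 (fun _ => 0) = 1) : Z 0 = 1 := by
  ext d
  have hd : d = 0 := Subsingleton.elim _ _
  rw [hd, MvPowerSeries.coeff_zero_eq_constantCoeff_apply, constantCoeff_eq_cf, h]
  simp

/-- The function `i ↦ k_{i+1} - 1`, extended by zero. -/
def expFun (ks : List ℕ+) (i : ℕ) : ℕ := (ks[i]?.getD 1 : ℕ+) - 1

theorem Mould.coeff_eq_cf (Z : Mould A) (ks : List ℕ+) :
    Z.coeff ks = Z.cf ks.length (expFun ks) := by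
  unfold Mould.coeff Mould.cf
  congr 3
  funext i
  simp [expFun]

theorem Mould.coeff_eq_cf_of_length (Z : Mould A) {ks : List ℕ+} {n : ℕ} (h : ks.length = n) :
    Z.coeff ks = Z.cf n (expFun ks) := by
  rw [Z.coeff_eq_cf, h]

theorem Bimould.coeff_map_zero (B : Bimould A) (ks : List ℕ+) :
    B.coeff (ks.map fun k => (k, 0)) = B.atZero.cf ks.length (expFun ks) := by
  have h1 : ((ks.map fun k => (k, 0)).map fun p : ℕ+ × ℕ => (p.2.factorial : A)).prod = 1 := by
    rw [List.map_map]
    exact List.prod_eq_one fun x hx => by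
      obtain ⟨k, -, rfl⟩ := List.mem_map.1 hx
      simp
  rw [Bimould.coeff, h1, one_mul]
  have h2 : ∀ n (hn : n = ks.length) (w : List (ℕ+ × ℕ)) (hw : w.length = n)
      (hw' : ∀ i (h : i < w.length), w[i].2 = 0 ∧ (w[i].1 : ℕ) - 1 = expFun ks i),
      MvPowerSeries.coeff (Finsupp.equivFunOnFinite.symm
        (Sum.elim (fun i : Fin w.length => (((w.get i).1 : ℕ) - 1))
          (fun i : Fin w.length => (w.get i).2))) (B w.length) = B.atZero.cf n (expFun ks) := by
    rintro n - w rfl hw'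
    unfold Mould.cf Bimould.atZero killLower
    rw [MvPowerSeries.coeff_killCompl]
    congr 2
    ext s
    rcases s with s | s
    · have := Finsupp.embDomain_apply_self (Function.Embedding.inl : Fin w.length ↪ _ ⊕ Fin w.length)
        (Finsupp.equivFunOnFinite.symm fun i : Fin w.length => expFun ks i) s
      refine Eq.trans ?_ this.symm
      simpa using (hw' s s.2).2
    · rw [Finsupp.embDomain_of_notMem_range _ _ _ (by simp)]
      simpa using (hw' s s.2).1
  refine h2 _ rfl _ (by simp) fun i h => ?_
  have hi : i < ks.length := by simpa using h
  simp [expFun, hi]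

/-! ### The constants of the bimoulds -/

theorem Mould.coeff_nil (Z : Mould A) : Z.coeff [] = Z.cf 0 fun _ => 0 := by
  rw [Z.coeff_eq_cf]
  unfold Mould.cf
  congr 2

end Formal

section Constants

theorem constantCoeff_subst_of_zero {A σ τ : Type} [CommRing A] [Finite σ]
    {a : σ → MvPowerSeries τ A} (ha : ∀ s, MvPowerSeries.constantCoeff (a s) = 0)
    (F : MvPowerSeries σ A) :
    MvPowerSeries.constantCoeff (MvPowerSeries.subst a F) = MvPowerSeries.constantCoeff F := by
  have hs := MvPowerSeries.hasSubst_of_constantCoeff_zero ha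
  have h := MvPowerSeries.constantCoeff_subst_eq_zero hs ha
    (f := F - MvPowerSeries.C (MvPowerSeries.constantCoeff F)) (by simp)
  rw [MvPowerSeries.subst_sub hs, MvPowerSeries.subst_C, map_sub, sub_eq_zero] at h
  rw [h]
  simp

variable {b : Mould ℚ}

theorem Mould.IsSymmetril.cf_zero (h : b.IsSymmetril) (k : ℕ → ℕ) : b.cf 0 k = 1 := by
  have h1 := h.1
  rw [Mould.coeffMap, word, Finsupp.linearCombination_single, one_smul, Mould.coeff_nil] at h1
  rw [← h1]
  unfold Mould.cf
  congr 2
  ext i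
  exact i.elim0

theorem hasSubst_gam (b : Mould ℚ) : PowerSeries.constantCoeff (PowerSeries.mk fun n : ℕ =>
      if h : 2 ≤ n then ((-1 : ℚ) ^ n / n) • b.coeff [⟨n, by omega⟩] else 0 : PowerSeries ℚ) = 0 := by
  rw [← PowerSeries.coeff_zero_eq_constantCoeff_apply, PowerSeries.coeff_mk, dif_neg (by omega)]

theorem coeff_zero_Gam (b : Mould ℚ) : PowerSeries.coeff 0 b.Gam = 1 := by
  rw [Mould.Gam, PowerSeries.coeff_subst' (PowerSeries.HasSubst.of_constantCoeff_zero'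
    (hasSubst_gam b)), finsum_eq_single _ 0]
  · simp
  · intro d hd
    rw [PowerSeries.coeff_zero_eq_constantCoeff_apply, map_pow, hasSubst_gam, zero_pow hd, smul_zero]

/-- The series in the exponent starts in degree two. -/
theorem coeff_one_Gam (b : Mould ℚ) : PowerSeries.coeff 1 b.Gam = 0 := by
  rw [Mould.Gam, PowerSeries.coeff_subst' (PowerSeries.HasSubst.of_constantCoeff_zero'
    (hasSubst_gam b))]
  refine finsum_eq_zero_of_forall_eq_zero fun d => ?_
  cases d with
  | zero => simp [PowerSeries.coeff_one]
  | succ d =>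
    refine smul_eq_zero_of_right _ ?_
    have h2 : (PowerSeries.X : PowerSeries ℚ) ^ 2 ∣ PowerSeries.mk fun n : ℕ =>
        if h : 2 ≤ n then ((-1 : ℚ) ^ n / n) • b.coeff [⟨n, by omega⟩] else 0 := by
      rw [PowerSeries.X_pow_dvd_iff]
      intro m hm
      rw [PowerSeries.coeff_mk, dif_neg (by omega)]
    exact PowerSeries.X_pow_dvd_iff.1 (h2.trans (dvd_pow_self _ d.succ_ne_zero)) 1 (by norm_num)

theorem constantCoeff_sharp (b : Mould ℚ) (r : ℕ) :
    MvPowerSeries.constantCoeff (b.sharp r) = MvPowerSeries.constantCoeff (b r) :=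
  constantCoeff_subst_of_zero (fun s => by
    rw [map_sum]; exact Finset.sum_eq_zero fun t _ => constantCoeff_X1 _ _) _

theorem cf_constMould {A : Type} [CommRing A] (F : PowerSeries A) (r : ℕ) :
    (constMould F).cf r (fun _ => 0) = PowerSeries.coeff r F := by
  rw [cf_of_const (c := PowerSeries.coeff r F) rfl]
  simp

theorem cf_gam_zero (h : b.IsSymmetril) : b.gam.cf 0 (fun _ => 0) = 1 := by
  rw [Mould.gam, cf_mul, Finset.sum_range_one]
  simp only [Nat.sub_zero, cf_constMould, coeff_zero_Gam, mul_one]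
  rw [← constantCoeff_eq_cf, constantCoeff_sharp, constantCoeff_eq_cf, h.cf_zero]

theorem cf_gam_one (h1 : b.coeff [1] = 0) : b.gam.cf 1 (fun _ => 0) = 0 := by
  rw [Mould.gam, cf_mul, Finset.sum_range_succ, Finset.sum_range_one]
  simp only [Nat.sub_zero, Nat.sub_self, cf_constMould, coeff_zero_Gam, coeff_one_Gam, mul_zero,
    mul_one, zero_add]
  rw [← constantCoeff_eq_cf, constantCoeff_sharp, constantCoeff_eq_cf]
  rw [Mould.coeff_eq_cf_of_length (n := 1) _ rfl] at h1
  rw [← h1]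
  unfold Mould.cf
  congr 3
  funext i
  have : i = 0 := Subsingleton.elim _ _
  simp [this, expFun]

/-- There are `n + 1` places at which the letter can be inserted, all giving the same word. -/
theorem qsh_shuffle_replicate (n : ℕ) : qsh shuffleLetters [1] (List.replicate n 1) =
    ((n : ℚ) + 1) • word (List.replicate (n + 1) (1 : ℕ+)) := by
  induction n with
  | zero => simp [qsh]
  | succ n ih =>
    rw [List.replicate_succ, qsh, ih, shuffleLetters, Finsupp.sum_zero_index, add_zero, qsh,
      prepend, prepend, Finsupp.mapDomain_smul, word, word, Finsupp.mapDomain_single,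
      Finsupp.mapDomain_single]
    simp only [List.replicate_succ]
    rw [Nat.cast_add_one, add_comm ((n : ℚ) + 1) 1, add_smul 1, one_smul]
    rfl

/-- The constant terms are the values of the coefficient map on `z_1^n`. Up to the factor `n + 1`,
the word `z_1^(n+1)` is a shuffle product with `z_1`, which is sent to `0`. -/
theorem Mould.IsSymmetral.cf_eq_zero {Z : Mould ℚ} (h : Z.IsSymmetral)
    (h1 : Z.cf 1 (fun _ => 0) = 0) (n : ℕ) : Z.cf (n + 1) (fun _ => 0) = 0 := by
  have hrep : ∀ n, Z.coeffMap (word (List.replicate n 1)) = Z.cf n fun _ => 0 := fun n => by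
    rw [Mould.coeffMap, word, Finsupp.linearCombination_single, one_smul,
      Z.coeff_eq_cf_of_length (n := n) (by simp)]
    congr 1
    funext i
    simp only [expFun, List.getElem?_replicate]
    split_ifs <;> simp
  have h2 := h.2 (word [1]) (word (List.replicate n 1))
  have h3 : qmul shuffleLetters (word [1]) (word (List.replicate n 1)) =
      qsh shuffleLetters [1] (List.replicate n 1) := by
    simp [qmul, word]
  rw [h3, qsh_shuffle_replicate, map_smul, hrep] at h2
  have h4 : Z.coeffMap (word [1]) = 0 := (hrep 1).trans h1
  rw [h4, zero_mul, smul_eq_mul, mul_eq_zero] at h2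
  exact h2.resolve_left (by positivity)

/-- At `Y = 0` the factor `Y^{b_γ}` becomes the constant mould of the constant terms of `b_γ`, which
is the unit. -/
theorem cf_atZero_toBimould (h : b.IsEDS) (h1 : b.coeff [1] = 0) (r : ℕ) (k : ℕ → ℕ) :
    b.toBimould.atZero.cf r k = b.cf r k := by
  rw [Mould.toBimould, atZero_mul, cf_mul, Finset.sum_eq_single 0]
  · rw [cf_of_const (atZero_lower b.gam 0), constantCoeff_eq_cf, cf_gam_zero h.1, atZero_upper]
    simp
  · intro j _ hj
    obtain ⟨j, rfl⟩ := Nat.exists_eq_succ_of_ne_zero hj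
    rw [cf_of_const (atZero_lower b.gam _), constantCoeff_eq_cf,
      h.2.cf_eq_zero (cf_gam_one h1)]
    simp
  · simp

/-- Depth `0` is enough: the higher depths, where `exp(-T/2)` contributes, enter only through blocks
with at least two variables, for which just the order of growth matters. -/
theorem cf_atZero_tildeBimould (h : b.IsEDS) :
    b.tildeBimould.atZero.cf 0 (fun _ => 0) = 1 := by
  rw [Mould.tildeBimould, atZero_mul, atZero_mul, atZero_upper, atZero_constBimould, cf_mul,
    Finset.sum_range_one, cf_mul, Finset.sum_range_one, cf_of_const (atZero_lower _ 0),
    cf_constMould, h.1.cf_zero, Mould.minus, Mould.ev, constantCoeff_subst_of_zero,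
    constantCoeff_eq_cf, cf_gam_zero h.1]
  · simp
  · intro s
    rw [map_neg, constantCoeff_X1, neg_zero]

end Constants

/-! ### The coefficients of `𝔏_m` -/

/-- The Lambert type series `∑_{n ≥ 1} p(n) q^{mn}`. -/
def lambert (p : ℕ → ℚ) (m : ℕ) : PowerSeries ℚ :=
  PowerSeries.mk fun N => if m ∣ N ∧ N ≠ 0 then p (N / m) else 0

theorem coeff_lambert (p : ℕ → ℚ) (m N : ℕ) :
    PowerSeries.coeff N (lambert p m) = if m ∣ N ∧ N ≠ 0 then p (N / m) else 0 :=
  PowerSeries.coeff_mk _ _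

theorem lambert_sum {ι : Type*} (s : Finset ι) (c : ι → ℚ) (p : ι → ℕ → ℚ) (m : ℕ) :
    lambert (fun n => ∑ i ∈ s, c i * p i n) m =
      ∑ i ∈ s, PowerSeries.C (c i) * lambert (p i) m := by
  ext N
  simp only [coeff_lambert, map_sum, PowerSeries.coeff_C_mul]
  split_ifs <;> simp

/-- The summand `n = 1` is split off and the others are shifted by one. -/
theorem lambert_eq_shift (p : ℕ → ℚ) {m : ℕ} (hm : 0 < m) :
    lambert p m = PowerSeries.X ^ m * (PowerSeries.C (p 1) + lambert (fun n => p (n + 1)) m) := by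
  ext N
  rw [mul_comm, PowerSeries.coeff_mul_X_pow', coeff_lambert]
  by_cases hN : m ∣ N
  · obtain ⟨t, rfl⟩ := hN
    rcases t with _ | t
    · simp [hm.ne']
    · have h1 : m * (t + 1) - m = m * t := by rw [mul_add, mul_one, Nat.add_sub_cancel]
      have h2 : m ≤ m * (t + 1) := Nat.le_mul_of_pos_right m t.succ_pos
      rw [if_pos ⟨dvd_mul_right _ _, by positivity⟩, if_pos h2, h1, map_add, coeff_lambert,
        Nat.mul_div_cancel_left _ hm, PowerSeries.coeff_C, Nat.mul_div_cancel_left _ hm]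
      rcases t with _ | t
      · simp
      · rw [if_neg (by positivity), if_pos ⟨dvd_mul_right _ _, by positivity⟩, zero_add]
  · rw [if_neg fun h => hN h.1]
    split_ifs with h
    · have h1 : N - m ≠ 0 := fun h0 => hN (by rw [show N = m by omega])
      have h2 : ¬ m ∣ N - m := fun h0 => hN (by simpa [h] using Nat.dvd_add h0 (dvd_refl m))
      rw [map_add, PowerSeries.coeff_C, if_neg h1, coeff_lambert, if_neg fun h => h2 h.1, add_zero]
    · rfl

/-- The power series `∑_{n ≥ 1} e^{nx} q^{mn} = e^x q^m / (1 - e^x q^m)` in `x`. -/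
def lambertExp (m : ℕ) : PowerSeries (PowerSeries ℚ) :=
  PowerSeries.mk fun a => PowerSeries.C ((a.factorial : ℚ)⁻¹) * lambert (fun n => (n : ℚ) ^ a) m

/-- The closed form of a geometric series, proved from the self-similarity `S = e^x q^m (1 + S)`:
coefficientwise this is the index shift of `lambert_eq_shift` and the binomial expansion of
`(n+1)^a`. -/
theorem lambertExp_mul {m : ℕ} (hm : 0 < m) :
    lambertExp m * (1 - PowerSeries.exp (PowerSeries ℚ) * PowerSeries.C (PowerSeries.X ^ m)) =
      PowerSeries.exp (PowerSeries ℚ) * PowerSeries.C (PowerSeries.X ^ m) := by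
  suffices h : lambertExp m = PowerSeries.C (PowerSeries.X ^ m) *
      (PowerSeries.exp (PowerSeries ℚ) + PowerSeries.exp (PowerSeries ℚ) * lambertExp m) by
    linear_combination h
  ext1 a
  have hexp : ∀ i, PowerSeries.coeff i (PowerSeries.exp (PowerSeries ℚ)) =
      PowerSeries.C ((i.factorial : ℚ)⁻¹) := fun i => by
    rw [PowerSeries.coeff_exp, one_div]
    rfl
  rw [PowerSeries.coeff_C_mul, map_add, PowerSeries.coeff_mul, hexp, lambertExp,
    PowerSeries.coeff_mk, lambert_eq_shift _ hm]
  have h1 : (fun n : ℕ => (((n + 1 : ℕ) : ℚ)) ^ a) = fun n : ℕ =>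
      ∑ x ∈ Finset.HasAntidiagonal.antidiagonal a, ((a.factorial : ℚ) * (x.1.factorial : ℚ)⁻¹ *
        (x.2.factorial : ℚ)⁻¹) * (n : ℚ) ^ x.2 := by
    funext n
    rw [Nat.cast_add_one, add_comm, (Commute.all (1 : ℚ) (n : ℚ)).add_pow',]
    refine Finset.sum_congr rfl fun x hx => ?_
    rw [one_pow, one_mul, nsmul_eq_mul, ← Finset.HasAntidiagonal.mem_antidiagonal.1 hx,
      Nat.choose_symm_add, Nat.add_choose, Nat.cast_div (Nat.factorial_mul_factorial_dvd_factorial_add _ _)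
        (by positivity)]
    push_cast
    field_simp
  rw [h1, lambert_sum, Nat.cast_one, one_pow, map_one, mul_left_comm, mul_add, mul_one,
    Finset.mul_sum]
  congr 2
  refine Finset.sum_congr rfl fun x hx => ?_
  rw [PowerSeries.coeff_mk, hexp, ← mul_assoc, ← mul_assoc, ← map_mul, ← map_mul]
  congr 2
  field_simp

section Lm

/-- Reconciles the exponential series over `ℚ` in `Lm` with the one over `ℚ⟦q⟧` in `lambertExp_mul`.
-/
theorem subst_exp_eq {τ : Type} {x : MvPowerSeries τ (PowerSeries ℚ)}
    (hx : MvPowerSeries.constantCoeff x = 0) :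
    PowerSeries.subst x (PowerSeries.exp ℚ) =
      PowerSeries.subst x (PowerSeries.exp (PowerSeries ℚ)) := by
  have hs := PowerSeries.HasSubst.of_constantCoeff_zero hx
  ext1 e
  rw [PowerSeries.coeff_subst hs, PowerSeries.coeff_subst hs]
  refine finsum_congr fun d => ?_
  rw [PowerSeries.coeff_exp, PowerSeries.coeff_exp, algebraMap_smul]
  exact (algebraMap_smul (PowerSeries ℚ) _ _).symm

theorem killLower_subst_powerSeries {r : ℕ} {x : MvPowerSeries (Fin r ⊕ Fin r) (PowerSeries ℚ)}
    (hx : MvPowerSeries.constantCoeff x = 0) (f : PowerSeries ℚ) :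
    killLower _ r (PowerSeries.subst x f) = PowerSeries.subst (killLower _ r x) f := by
  have hs := PowerSeries.HasSubst.of_constantCoeff_zero hx
  have hs' := PowerSeries.HasSubst.of_constantCoeff_zero
    ((constantCoeff_killLower x).trans hx)
  ext1 d
  rw [killLower, MvPowerSeries.coeff_killCompl, PowerSeries.coeff_subst hs]
  erw [PowerSeries.coeff_subst hs']
  refine finsum_congr fun u => ?_
  rw [← MvPowerSeries.coeff_killCompl, map_pow]
  rfl

theorem isUnit_one_sub_exp {τ : Type} (x : MvPowerSeries τ (PowerSeries ℚ)) {m : ℕ} (hm : 0 < m) :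
    IsUnit (1 - x * MvPowerSeries.C ((PowerSeries.X : PowerSeries ℚ) ^ m)) := by
  rw [MvPowerSeries.isUnit_iff_constantCoeff, map_sub, map_mul, MvPowerSeries.constantCoeff_C,
    PowerSeries.isUnit_iff_constantCoeff]
  simp [hm.ne']

theorem killLower_Lm {r m : ℕ} (hm : 0 < m) {j : ℕ} (hj : j < r)
    {y : MvPowerSeries (Fin r ⊕ Fin r) (PowerSeries ℚ)}
    (hy : MvPowerSeries.constantCoeff y = 0) (hy' : killLower _ r y = 0) :
    killLower _ r (Lm m (XX _ r j) y) =
      PowerSeries.subst (MvPowerSeries.X (⟨j, hj⟩ : Fin r)) (lambertExp m) := by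
  have hX : X1 (PowerSeries ℚ) r j = MvPowerSeries.X ⟨j, hj⟩ := dif_pos hj
  have hX0 : MvPowerSeries.constantCoeff
    (MvPowerSeries.X (⟨j, hj⟩ : Fin r) : MvPowerSeries _ (PowerSeries ℚ)) = 0 := by simp
  have hs := PowerSeries.HasSubst.of_constantCoeff_zero hX0
  set E := PowerSeries.subst (MvPowerSeries.X (⟨j, hj⟩ : Fin r) :
    MvPowerSeries _ (PowerSeries ℚ)) (PowerSeries.exp ℚ) with hE
  have hE1 : killLower _ r (PowerSeries.subst (XX _ r j + m • y) (PowerSeries.exp ℚ)) = E := by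
    rw [killLower_subst_powerSeries, map_add, map_nsmul, hy', smul_zero, add_zero, killLower_XX, hX]
    rw [map_add, map_nsmul, hy, constantCoeff_XX, smul_zero, add_zero]
  have hE0 : killLower _ r (PowerSeries.subst (XX (PowerSeries ℚ) r j) (PowerSeries.exp ℚ)) = E := by
    rw [killLower_subst_powerSeries (constantCoeff_XX _ _), killLower_XX, hX]
  have hC : killLower _ r (MvPowerSeries.C ((PowerSeries.X : PowerSeries ℚ) ^ m)) =
      MvPowerSeries.C (PowerSeries.X ^ m) := MvPowerSeries.killCompl_C _
  have hu := isUnit_one_sub_exp E hm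
  -- Both sides are compared after multiplication by the unit `1 - e^x q^m`, where `lambertExp_mul`
  -- applies.
  refine hu.mul_right_cancel ?_
  have h1 := congrArg (PowerSeries.subst (MvPowerSeries.X (⟨j, hj⟩ : Fin r) :
    MvPowerSeries _ (PowerSeries ℚ))) (lambertExp_mul hm)
  rw [PowerSeries.subst_mul hs, PowerSeries.subst_sub hs, PowerSeries.subst_mul hs,
    PowerSeries.subst_C, ← subst_exp_eq hX0, ← hE] at h1
  have h2 : PowerSeries.subst (MvPowerSeries.X (⟨j, hj⟩ : Fin r) :
    MvPowerSeries _ (PowerSeries ℚ)) (1 : PowerSeries (PowerSeries ℚ)) = 1 := by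
    rw [← PowerSeries.coe_substAlgHom hs, map_one]
  rw [h2] at h1
  rw [h1, Lm, map_mul, map_mul, hE1, hC, mul_assoc]
  have h3 : 1 - E * MvPowerSeries.C ((PowerSeries.X : PowerSeries ℚ) ^ m) = killLower _ r
      (1 - PowerSeries.subst (XX _ r j) (PowerSeries.exp ℚ) *
        MvPowerSeries.C (PowerSeries.X ^ m)) := by
    rw [map_sub, map_one, map_mul, hE0, hC]
  rw [h3, ← map_mul, Ring.inverse_mul_cancel _ (isUnit_one_sub_exp _ hm), map_one, mul_one]

/-- The factor `P` does not involve `q` and only shifts exponents, so the coefficient combines the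
series of `n^a` with `a ≤ k_j`. The weaker bound by the sum of all exponents does not depend on `j`,
and `p` does not depend on `m`. -/
theorem coeff_lambertExp_mul {r : ℕ} (j : Fin r) (P : MvPowerSeries (Fin r) ℚ) (k : ℕ → ℕ) :
    ∃ p : ℕ → ℚ, (∃ C : ℚ, ∀ n, 1 ≤ n → |p n| ≤ C * (n : ℚ) ^ (∑ i ∈ Finset.range r, k i)) ∧
      ∀ m, MvPowerSeries.coeff (Finsupp.equivFunOnFinite.symm fun i : Fin r => k i)
        (PowerSeries.subst (MvPowerSeries.X j) (lambertExp m) *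
          MvPowerSeries.map PowerSeries.C P) = lambert p m := by
  classical
  set e : Fin r →₀ ℕ := Finsupp.equivFunOnFinite.symm fun i : Fin r => k i with he
  -- The first factor involves only `X_j`, hence only pure powers of `X_j` on its side of the
  -- antidiagonal contribute.
  set c : (Fin r →₀ ℕ) × (Fin r →₀ ℕ) → ℚ := fun x =>
    if x.1 = Finsupp.single j (x.1 j) then ((x.1 j).factorial : ℚ)⁻¹ * MvPowerSeries.coeff x.2 P
    else 0 with hc
  refine ⟨fun n => ∑ x ∈ Finset.HasAntidiagonal.antidiagonal e, c x * (n : ℚ) ^ (x.1 j),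
    ⟨∑ x ∈ Finset.HasAntidiagonal.antidiagonal e, |c x|, fun n hn => ?_⟩, fun m => ?_⟩
  · rw [Finset.sum_mul]
    refine (Finset.abs_sum_le_sum_abs _ _).trans (Finset.sum_le_sum fun x hx => ?_)
    rw [abs_mul, abs_of_nonneg (by positivity : (0 : ℚ) ≤ (n : ℚ) ^ (x.1 j))]
    refine mul_le_mul_of_nonneg_left (pow_le_pow_right₀ (by exact_mod_cast hn) ?_) (abs_nonneg _)
    have h1 : x.1 j ≤ e j := by
      rw [← Finset.HasAntidiagonal.mem_antidiagonal.1 hx]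
      simp
    refine h1.trans ?_
    rw [he, Finsupp.equivFunOnFinite_symm_apply_apply]
    exact Finset.single_le_sum (f := k) (fun _ _ => Nat.zero_le _) (Finset.mem_range.2 j.2)
  · rw [lambert_sum, MvPowerSeries.coeff_mul]
    refine Finset.sum_congr rfl fun x _ => ?_
    rw [PowerSeries.coeff_subst_single, MvPowerSeries.coeff_map, hc]
    simp only
    split_ifs with h
    · rw [lambertExp, PowerSeries.coeff_mk, map_mul]
      ring
    · simp

end Lm

section LL

variable {b : Mould ℚ}

theorem X1_eq_map (r i : ℕ) :
    X1 (PowerSeries ℚ) r i = MvPowerSeries.map PowerSeries.C (X1 ℚ r i) := by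
  unfold X1
  split_ifs <;> simp

theorem atZero_toQ_ev (B : Bimould ℚ) {r : ℕ} (n : ℕ) {x : ℕ → MvPowerSeries (Fin r) ℚ}
    (hx : ∀ i, MvPowerSeries.constantCoeff (x i) = 0) :
    B.toQ.atZero.ev n (fun i => MvPowerSeries.map PowerSeries.C (x i)) =
      MvPowerSeries.map PowerSeries.C (B.atZero.ev n x) := by
  have h1 : B.toQ.atZero n = MvPowerSeries.map PowerSeries.C (B.atZero n) :=
    MvPowerSeries.killCompl_map _ _
  rw [Mould.ev, Mould.ev, h1,
    MvPowerSeries.map_subst (MvPowerSeries.hasSubst_of_constantCoeff_zero fun i : Fin n => hx i)]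

theorem cf_atZero_toQ (B : Bimould ℚ) (r : ℕ) (k : ℕ → ℕ) :
    B.toQ.atZero.cf r k = PowerSeries.C (B.atZero.cf r k) := by
  have h1 : B.toQ.atZero r = MvPowerSeries.map PowerSeries.C (B.atZero r) :=
    MvPowerSeries.killCompl_map _ _
  rw [Mould.cf, h1, MvPowerSeries.coeff_map]
  rfl

theorem atZero_LL {r m : ℕ} (hr : r ≠ 0) (hm : 0 < m) :
    (LL b m).atZero r = ∑ j : Fin r,
      PowerSeries.subst (MvPowerSeries.X j) (lambertExp m) * MvPowerSeries.map PowerSeries.C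
        (b.toBimould.atZero.ev j (fun i => X1 ℚ r i - X1 ℚ r j) *
          b.tildeBimould.atZero.ev (r - 1 - j) fun i => X1 ℚ r (r - 1 - i) - X1 ℚ r j) := by
  have h0 : LL b m r = ∑ j ∈ Finset.range r,
      b.toBimould.toQ.ev j (fun i => XX _ r i - XX _ r j) (YY _ r) *
        Lm m (XX _ r j) (∑ i ∈ Finset.range r, YY _ r i) *
          b.tildeBimould.toQ.ev (r - 1 - j) (fun i => XX _ r (r - 1 - i) - XX _ r j)
            (fun i => YY _ r (r - 1 - i)) := if_neg hr
  rw [Bimould.atZero, h0, map_sum, Finset.sum_range]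
  refine Finset.sum_congr rfl fun j _ => ?_
  rw [map_mul, map_mul, killLower_ev, killLower_ev, killLower_Lm hm j.2]
  · have hx : ∀ i, killLower (PowerSeries ℚ) r (XX _ r i - XX _ r j) =
        MvPowerSeries.map PowerSeries.C (X1 ℚ r i - X1 ℚ r j) := fun i => by
      rw [map_sub, map_sub, killLower_XX, killLower_XX, X1_eq_map, X1_eq_map]
    simp only [hx]
    rw [atZero_toQ_ev, atZero_toQ_ev, map_mul]
    · rw [mul_right_comm, mul_comm (_ * _) (PowerSeries.subst _ _)]
    · intro i; simp [constantCoeff_X1]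
    · intro i; simp [constantCoeff_X1]
  · rw [map_sum]; exact Finset.sum_eq_zero fun i _ => constantCoeff_YY _ _
  · rw [map_sum]; exact Finset.sum_eq_zero fun i _ => killLower_YY _ _
  · intro i; simp [constantCoeff_XX]
  · intro i; exact constantCoeff_YY _ _
  · intro i; exact killLower_YY _ _
  · intro i; simp [constantCoeff_XX]
  · intro i; exact constantCoeff_YY _ _
  · intro i; exact killLower_YY _ _

theorem exists_cf_atZero_LL (b : Mould ℚ) {r : ℕ} (hr : r ≠ 0) (k : ℕ → ℕ) :
    ∃ p : ℕ → ℚ, (∃ C : ℚ, ∀ n, 1 ≤ n → |p n| ≤ C * (n : ℚ) ^ (∑ i ∈ Finset.range r, k i)) ∧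
      ∀ m, 0 < m → (LL b m).atZero.cf r k = lambert p m := by
  choose p hC hp using fun j : Fin r => coeff_lambertExp_mul j
    (b.toBimould.atZero.ev j (fun i => X1 ℚ r i - X1 ℚ r j) *
      b.tildeBimould.atZero.ev (r - 1 - j) fun i => X1 ℚ r (r - 1 - i) - X1 ℚ r j) k
  choose C hC using hC
  refine ⟨fun n => ∑ j, 1 * p j n, ⟨∑ j, C j, fun n hn => ?_⟩, fun m hm => ?_⟩
  · rw [Finset.sum_mul]
    refine (Finset.abs_sum_le_sum_abs _ _).trans (Finset.sum_le_sum fun j _ => ?_)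
    rw [one_mul]
    exact hC j n hn
  · rw [lambert_sum, Mould.cf, atZero_LL hr hm, map_sum]
    refine Finset.sum_congr rfl fun j _ => ?_
    rw [hp, map_one, one_mul]

theorem Mould.ev_zero {A σ : Type} [CommRing A] {Z : Mould A} (h : Z 0 = 1)
    (x : ℕ → MvPowerSeries σ A) : Z.ev 0 x = 1 := by
  rw [Mould.ev, h, ← MvPowerSeries.coe_substAlgHom
    (MvPowerSeries.hasSubst_of_constantCoeff_zero fun i => i.elim0), map_one]

/-- In depth one both bimould factors have depth `0` and equal `1`. Blocks of one variable survive
in the limit, so for them the function itself is needed and not only its growth. -/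
theorem cf_atZero_LL_one (h : b.IsEDS) (h1 : b.coeff [1] = 0) (k : ℕ → ℕ) {m : ℕ} (hm : 0 < m) :
    (LL b m).atZero.cf 1 k = lambert (fun n => ((k 0).factorial : ℚ)⁻¹ * (n : ℚ) ^ k 0) m := by
  rw [Mould.cf, atZero_LL one_ne_zero hm, Fin.sum_univ_one]
  simp only [Fin.val_zero, Nat.sub_self]
  rw [Mould.ev_zero, Mould.ev_zero, mul_one, map_one, mul_one, PowerSeries.coeff_subst_single,
    if_pos, lambertExp, PowerSeries.coeff_mk]
  · have := lambert_sum {()} (fun _ => ((k 0).factorial : ℚ)⁻¹) (fun _ n => (n : ℚ) ^ k 0) m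
    simp only [Finset.sum_singleton] at this
    rw [this]
    rfl
  · refine Finsupp.ext fun i => ?_
    have : i = 0 := Subsingleton.elim _ _
    simp [this]
  · exact eq_one_of_cf_zero (cf_atZero_tildeBimould h)
  · exact eq_one_of_cf_zero ((cf_atZero_toBimould h h1 0 _).trans (h.1.cf_zero _))

/-! ### The coefficients of `𝔊` -/

open Classical in
/-- The function `p` for which the coefficient of `𝔏_m` is the Lambert series of `p`. -/
def blockFun (b : Mould ℚ) (r : ℕ) (k : ℕ → ℕ) : ℕ → ℚ :=
  if r = 1 then fun n => ((k 0).factorial : ℚ)⁻¹ * (n : ℚ) ^ k 0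
  else if hr : r ≠ 0 then (exists_cf_atZero_LL b hr k).choose else 0

theorem blockFun_one (k : ℕ → ℕ) (n : ℕ) :
    blockFun b 1 k n = ((k 0).factorial : ℚ)⁻¹ * (n : ℚ) ^ k 0 := by
  rw [blockFun, if_pos rfl]

theorem exists_abs_blockFun_le (b : Mould ℚ) (r : ℕ) (k : ℕ → ℕ) :
    ∃ C : ℚ, ∀ n, 1 ≤ n → |blockFun b r k n| ≤ C * (n : ℚ) ^ (∑ i ∈ Finset.range r, k i) := by
  by_cases h1 : r = 1
  · subst h1
    refine ⟨((k 0).factorial : ℚ)⁻¹, fun n _ => ?_⟩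
    rw [blockFun_one, Finset.sum_range_one, abs_of_nonneg (by positivity)]
  by_cases hr : r ≠ 0
  · rw [blockFun, if_neg h1, dif_pos hr]
    exact (exists_cf_atZero_LL b hr k).choose_spec.1
  · rw [blockFun, if_neg h1, dif_neg hr]
    exact ⟨0, by simp⟩

theorem cf_atZero_LL (h : b.IsEDS) (h1 : b.coeff [1] = 0) {r : ℕ} (hr : r ≠ 0) (k : ℕ → ℕ)
    {m : ℕ} (hm : 0 < m) : (LL b m).atZero.cf r k = lambert (blockFun b r k) m := by
  by_cases hr1 : r = 1
  · subst hr1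
    rw [cf_atZero_LL_one h h1 k hm, blockFun, if_pos rfl]
  · rw [blockFun, if_neg hr1, dif_pos hr]
    exact (exists_cf_atZero_LL b hr k).choose_spec.2 m hm

/-- The `q`-series `∑_{m_1 > ⋯ > m_r > 0} ∏ ∑_n p_i(n) q^{m_i n}`. -/
def nestedLambert (L : List (ℕ → ℚ)) : PowerSeries ℚ :=
  PowerSeries.mk fun n => PowerSeries.coeff n (nestedSum n (L.map lambert))

/-- The list of functions attached to the blocks of a composition. -/
def blockList (b : Mould ℚ) (k : ℕ → ℕ) {r : ℕ} (c : Composition r) : List (ℕ → ℚ) :=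
  List.ofFn fun i : Fin c.length => blockFun b (c.blocksFun i) fun t => k (c.sizeUpTo i + t)

/-- The blocks of a composition use disjoint variables, so the coefficient of each product of
`𝔏_{m_i}` is a product of Lambert series. The cutoff `m_1 ≤ n` for the coefficient of `q^n` is the
same on both sides. -/
theorem atZero_gStar_cf (h : b.IsEDS) (h1 : b.coeff [1] = 0) (r : ℕ) (k : ℕ → ℕ) :
    (gStar b).atZero.cf r k = ∑ c : Composition r, nestedLambert (blockList b k c) := by
  classical
  ext n
  rw [Mould.cf, Bimould.atZero, killLower, MvPowerSeries.coeff_killCompl, map_sum]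
  rw [MvPowerSeries.coeff_apply, gStar, PowerSeries.coeff_mk]
  refine Finset.sum_congr rfl fun c _ => ?_
  rw [nestedLambert, PowerSeries.coeff_mk, blockList, List.map_ofFn, ← sum_strictAnti_eq_nestedSum,
    map_sum]
  refine Finset.sum_congr (by congr) fun m hm => ?_
  congr 1
  rw [← MvPowerSeries.coeff_killCompl]
  change MvPowerSeries.coeff _ (killLower _ r _) = _
  rw [map_prod]
  have h2 : ∀ i : Fin c.length, killLower _ r ((LL b (m i)).ev (c.blocksFun i)
      (fun t => XX (PowerSeries ℚ) r (c.sizeUpTo i + t))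
      (fun t => YY (PowerSeries ℚ) r (c.sizeUpTo i + t))) =
      MvPowerSeries.rename (c.embedding i).toEmbedding ((LL b (m i)).atZero (c.blocksFun i)) := by
    intro i
    rw [killLower_ev _ _ (fun _ => constantCoeff_XX _ _) (fun _ => constantCoeff_YY _ _)
      (fun _ => killLower_YY _ _)]
    refine ev_eq_rename _ _ _ fun t => ?_
    rw [killLower_XX, X1, dif_pos]
    rfl
  rw [Finset.prod_congr rfl fun i _ => h2 i, coeff_prod_rename (fun i => (c.embedding i).toEmbedding)
    c.blocksFinEquiv.bijective]
  refine Finset.prod_congr rfl fun i _ => ?_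
  have hmi : 0 < m i := by
    have := (Finset.mem_filter.1 hm).1
    rw [Fintype.mem_piFinset] at this
    exact (Finset.mem_Icc.1 (this i)).1
  have h3 := cf_atZero_LL h h1 (Nat.one_le_iff_ne_zero.1 (c.one_le_blocksFun i))
    (fun t => k (c.sizeUpTo i + t)) hmi
  refine Eq.trans ?_ h3
  rw [Mould.cf]
  congr 2
  ext t
  rfl

/-- The formula on which all analytic statements rest: the first `j` indices are grouped into the
blocks of a composition, the remaining ones enter through a number `β`. -/
theorem G_eq_sum (h : b.IsEDS) (h1 : b.coeff [1] = 0) (ks : List ℕ+) :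
    G b ks = ∑ j ∈ Finset.range (ks.length + 1),
      (∑ c : Composition j, nestedLambert (blockList b (expFun ks) c)) *
        PowerSeries.C (b.cf (ks.length - j) fun i => expFun ks (j + i)) := by
  rw [G, biG, Bimould.coeff_map_zero, GG, atZero_mul, cf_mul]
  refine Finset.sum_congr rfl fun j _ => ?_
  rw [atZero_gStar_cf h h1, cf_atZero_toQ, cf_atZero_toBimould h h1]

end LL

/-! ### Power series with coefficients of polynomial growth -/

/-- The coefficients are bounded by a polynomial. -/
def PolyGrowth (f : PowerSeries ℚ) : Prop :=
  ∃ (C : ℝ) (d : ℕ), ∀ n, |((PowerSeries.coeff n f : ℚ) : ℝ)| ≤ C * ((n : ℝ) + 1) ^ d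

/-- The right side is the rising factorial `(n+1) ⋯ (n+d)`, whose generating function is known in
closed form. -/
theorem succ_pow_le_choose (n d : ℕ) :
    ((n : ℝ) + 1) ^ d ≤ d.factorial * ((n + d).choose d : ℝ) := by
  have := Nat.pow_succ_le_ascFactorial (n + 1) d
  rw [Nat.ascFactorial_eq_factorial_mul_choose] at this
  exact_mod_cast this

theorem summable_succ_pow_mul_geometric (d : ℕ) {q : ℝ} (hq : |q| < 1) :
    Summable fun n : ℕ => ((n : ℝ) + 1) ^ d * |q| ^ n := by
  have h := (summable_choose_mul_geometric_of_norm_lt_one d (r := |q|) (by simpa using hq)).mul_left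
    (d.factorial : ℝ)
  refine Summable.of_nonneg_of_le (fun n => by positivity) (fun n => ?_) h
  rw [← mul_assoc]
  exact mul_le_mul_of_nonneg_right (succ_pow_le_choose n d) (by positivity)

theorem abs_qTerm_le {f : PowerSeries ℚ} {C : ℝ} {d : ℕ}
    (h : ∀ n, |((PowerSeries.coeff n f : ℚ) : ℝ)| ≤ C * ((n : ℝ) + 1) ^ d) (q : ℝ) (n : ℕ) :
    |qTerm f q n| ≤ C * (((n : ℝ) + 1) ^ d * |q| ^ n) := by
  rw [qTerm, abs_mul, abs_pow, ← mul_assoc]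
  exact mul_le_mul_of_nonneg_right (h n) (by positivity)

namespace PolyGrowth

variable {f g : PowerSeries ℚ} {q : ℝ}

theorem summable_norm (hf : PolyGrowth f) (hq : |q| < 1) : Summable fun n => ‖qTerm f q n‖ := by
  obtain ⟨C, d, h⟩ := hf
  exact Summable.of_nonneg_of_le (fun n => norm_nonneg _) (abs_qTerm_le h q)
    ((summable_succ_pow_mul_geometric d hq).mul_left C)

theorem summable (hf : PolyGrowth f) (hq : |q| < 1) : Summable (qTerm f q) :=
  (hf.summable_norm hq).of_norm

theorem add (hf : PolyGrowth f) (hg : PolyGrowth g) : PolyGrowth (f + g) := by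
  obtain ⟨C, d, h⟩ := hf
  obtain ⟨C', d', h'⟩ := hg
  have hC : 0 ≤ C := by simpa using (abs_nonneg _).trans (h 0)
  have hC' : 0 ≤ C' := by simpa using (abs_nonneg _).trans (h' 0)
  refine ⟨C + C', d + d', fun n => ?_⟩
  have h1 : (1 : ℝ) ≤ (n : ℝ) + 1 := by linarith [Nat.cast_nonneg (α := ℝ) n]
  rw [map_add, Rat.cast_add, add_mul]
  refine (abs_add_le _ _).trans (add_le_add ((h n).trans ?_) ((h' n).trans ?_))
  · exact mul_le_mul_of_nonneg_left (pow_le_pow_right₀ h1 (by omega)) hC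
  · exact mul_le_mul_of_nonneg_left (pow_le_pow_right₀ h1 (by omega)) hC'

theorem mul (hf : PolyGrowth f) (hg : PolyGrowth g) : PolyGrowth (f * g) := by
  obtain ⟨C, d, h⟩ := hf
  obtain ⟨C', d', h'⟩ := hg
  have hC : 0 ≤ C := by simpa using (abs_nonneg _).trans (h 0)
  have hC' : 0 ≤ C' := by simpa using (abs_nonneg _).trans (h' 0)
  refine ⟨C * C', d + d' + 1, fun n => ?_⟩
  rw [PowerSeries.coeff_mul, Rat.cast_sum]
  refine (Finset.abs_sum_le_sum_abs _ _).trans ((Finset.sum_le_card_nsmul _ _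
    (C * ((n : ℝ) + 1) ^ d * (C' * ((n : ℝ) + 1) ^ d')) fun x hx => ?_).trans_eq ?_)
  · have hx' := Finset.HasAntidiagonal.mem_antidiagonal.1 hx
    have h1 : (x.1 : ℝ) ≤ n := by exact_mod_cast (by omega : x.1 ≤ n)
    have h2 : (x.2 : ℝ) ≤ n := by exact_mod_cast (by omega : x.2 ≤ n)
    rw [Rat.cast_mul, abs_mul]
    refine mul_le_mul ((h _).trans ?_) ((h' _).trans ?_) (abs_nonneg _) (by positivity)
    · gcongr
    · gcongr
  · rw [Finset.Nat.card_antidiagonal, nsmul_eq_mul]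
    push_cast
    ring

theorem const (c : ℚ) : PolyGrowth (PowerSeries.C c) := by
  refine ⟨|(c : ℝ)|, 0, fun n => ?_⟩
  rw [PowerSeries.coeff_C, pow_zero, mul_one]
  split_ifs <;> simp

theorem sum {ι : Type*} {s : Finset ι} {F : ι → PowerSeries ℚ} (h : ∀ i ∈ s, PolyGrowth (F i)) :
    PolyGrowth (∑ i ∈ s, F i) := by
  classical
  induction s using Finset.induction_on with
  | empty => simpa using const 0
  | insert i s hi ih =>
    rw [Finset.sum_insert hi]
    exact (h i (by simp)).add (ih fun j hj => h j (by simp [hj]))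

theorem qValue_add (hf : PolyGrowth f) (hg : PolyGrowth g) (hq : |q| < 1) :
    qValue (f + g) q = qValue f q + qValue g q := by
  rw [qValue, qValue, qValue, ← (hf.summable hq).tsum_add (hg.summable hq)]
  refine tsum_congr fun n => ?_
  simp only [qTerm, map_add, Rat.cast_add, add_mul]

theorem qValue_mul (hf : PolyGrowth f) (hg : PolyGrowth g) (hq : |q| < 1) :
    qValue (f * g) q = qValue f q * qValue g q := by
  rw [qValue, qValue, qValue, tsum_mul_tsum_eq_tsum_sum_antidiagonal_of_summable_norm
    (hf.summable_norm hq) (hg.summable_norm hq)]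
  refine tsum_congr fun n => ?_
  rw [qTerm, PowerSeries.coeff_mul, Rat.cast_sum, Finset.sum_mul]
  refine Finset.sum_congr rfl fun x hx => ?_
  rw [qTerm, qTerm, ← Finset.HasAntidiagonal.mem_antidiagonal.1 hx, pow_add, Rat.cast_mul]
  ring

theorem _root_.CombMES.qValue_C (c : ℚ) (q : ℝ) : qValue (PowerSeries.C c) q = c := by
  rw [qValue, tsum_eq_single 0]
  · simp [qTerm]
  · intro n hn
    simp [qTerm, PowerSeries.coeff_C, hn]

theorem _root_.CombMES.qValue_one (q : ℝ) : qValue 1 q = 1 := by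
  simpa using qValue_C 1 q

theorem qValue_sum {ι : Type*} {s : Finset ι} {F : ι → PowerSeries ℚ}
    (h : ∀ i ∈ s, PolyGrowth (F i)) (hq : |q| < 1) :
    qValue (∑ i ∈ s, F i) q = ∑ i ∈ s, qValue (F i) q := by
  classical
  induction s using Finset.induction_on with
  | empty => simpa using qValue_C 0 q
  | insert i s hi ih =>
    have h1 := fun j hj => h j (Finset.mem_insert_of_mem hj)
    rw [Finset.sum_insert hi, Finset.sum_insert hi, (h i (by simp)).qValue_add (sum h1) hq, ih h1]

theorem tendsto_qValue_zero (hf : PolyGrowth f) :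
    Tendsto (qValue f) (𝓝 0) (𝓝 ((PowerSeries.constantCoeff f : ℚ) : ℝ)) := by
  have h0 : qValue f 0 = ((PowerSeries.constantCoeff f : ℚ) : ℝ) := by
    rw [qValue, tsum_eq_single 0]
    · simp [qTerm]
    · intro n hn
      simp [qTerm, hn]
  rw [← h0]
  obtain ⟨C, d, h⟩ := hf
  have hC : 0 ≤ C := by simpa using (abs_nonneg _).trans (h 0)
  refine tendsto_tsum_of_dominated_convergence (bound := fun n => C * (((n : ℝ) + 1) ^ d *
    |(1 / 2 : ℝ)| ^ n)) ?_ (fun n => ?_) ?_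
  · exact (summable_succ_pow_mul_geometric d (by norm_num [abs_of_pos])).mul_left C
  · have hc : Continuous fun q : ℝ => qTerm f q n := by unfold qTerm; fun_prop
    exact hc.tendsto 0
  · have : ∀ᶠ q : ℝ in 𝓝 0, |q| < 1 / 2 := by
      have := (continuous_abs (G := ℝ)).tendsto 0
      rw [abs_zero] at this
      exact this.eventually_lt_const (by norm_num)
    filter_upwards [this] with q hq n
    refine (abs_qTerm_le h q n).trans ?_
    exact mul_le_mul_of_nonneg_left (mul_le_mul_of_nonneg_left (pow_le_pow_left₀ (abs_nonneg q)
      (hq.le.trans (le_abs_self _)) n) (by positivity)) hC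

end PolyGrowth

/-! ### Nested sums of Lambert series -/

/-- The function `p` is bounded by a multiple of `n ^ d`. -/
def GrowthLE (p : ℕ → ℚ) (d : ℕ) : Prop := ∃ C : ℚ, ∀ n, 1 ≤ n → |p n| ≤ C * (n : ℚ) ^ d

theorem exists_abs_coeff_lambert_le {p : ℕ → ℚ} {d : ℕ} (h : GrowthLE p d) :
    ∃ C : ℝ, ∀ m, 0 < m → ∀ n, |((PowerSeries.coeff n (lambert p m) : ℚ) : ℝ)| ≤
      C * ((n : ℝ) + 1) ^ d := by
  obtain ⟨C, hC⟩ := h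
  have hC0 : 0 ≤ C := by simpa using (abs_nonneg _).trans (hC 1 le_rfl)
  have hC0' : (0 : ℝ) ≤ C := by exact_mod_cast hC0
  refine ⟨C, fun m hm n => ?_⟩
  rw [coeff_lambert]
  split_ifs with hn
  · have h1 : 1 ≤ n / m := (Nat.one_le_div_iff hm).2 (Nat.le_of_dvd (by omega) hn.1)
    have h2 : |((p (n / m) : ℚ) : ℝ)| ≤ (C : ℝ) * ((n / m : ℕ) : ℝ) ^ d := by
      exact_mod_cast hC _ h1
    refine h2.trans ?_
    have h3 : ((n / m : ℕ) : ℝ) ≤ n := by exact_mod_cast Nat.div_le_self n m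
    gcongr
    linarith
  · simp only [Rat.cast_zero, abs_zero]
    positivity

theorem polyGrowth_lambert {p : ℕ → ℚ} {d : ℕ} (h : GrowthLE p d) {m : ℕ} (hm : 0 < m) :
    PolyGrowth (lambert p m) := by
  obtain ⟨C, hC⟩ := exists_abs_coeff_lambert_le h
  exact ⟨C, d, hC m hm⟩

theorem coeff_lambert_mul_eq_zero (p : ℕ → ℚ) (f : PowerSeries ℚ) {m n : ℕ} (h : n < m) :
    PowerSeries.coeff n (lambert p m * f) = 0 := by
  rw [PowerSeries.coeff_mul]
  refine Finset.sum_eq_zero fun x hx => ?_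
  have hx' := Finset.HasAntidiagonal.mem_antidiagonal.1 hx
  rw [coeff_lambert, if_neg, zero_mul]
  rintro ⟨h1, h2⟩
  have := Nat.le_of_dvd (by omega) h1
  omega

/-- A Lambert series with parameter `m` is divisible by `q^m`, so outer indices `m > n` do not
affect the coefficient of `q^n`. -/
theorem coeff_nestedSum_lambert (L : List (ℕ → ℚ)) {n N : ℕ} (h : n ≤ N) :
    PowerSeries.coeff n (nestedSum N (L.map lambert)) =
      PowerSeries.coeff n (nestedSum n (L.map lambert)) := by
  cases L with
  | nil => simp
  | cons p L =>
    induction N, h using Nat.le_induction with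
    | base => rfl
    | succ N hN ih =>
      rw [List.map_cons, nestedSum_succ, map_add, coeff_lambert_mul_eq_zero _ _ (by omega),
        add_zero, ← List.map_cons, ih]

/-- The bound is uniform in `N`, as dominated convergence for `N → ∞` requires: at most `n` values
of the outer index reach the coefficient of `q^n`, each contributing a convolution of at most `n +
1` terms. -/
theorem exists_abs_coeff_nestedSum_le {L : List (ℕ → ℚ)} (hL : ∀ p ∈ L, ∃ d, GrowthLE p d) :
    ∃ (C : ℝ) (d : ℕ), ∀ N n, |((PowerSeries.coeff n (nestedSum N (L.map lambert)) : ℚ) : ℝ)| ≤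
      C * ((n : ℝ) + 1) ^ d := by
  induction L with
  | nil =>
    refine ⟨1, 0, fun N n => ?_⟩
    rw [List.map_nil, nestedSum_nil, PowerSeries.coeff_one]
    split_ifs <;> simp
  | cons p L ih =>
    obtain ⟨C', d', h'⟩ := ih fun r hr => hL r (by simp [hr])
    obtain ⟨d, hd⟩ := hL p (by simp)
    obtain ⟨C, h⟩ := exists_abs_coeff_lambert_le hd
    have hC : 0 ≤ C := by simpa using (abs_nonneg _).trans (h 1 one_pos 0)
    have hC' : 0 ≤ C' := by simpa using (abs_nonneg _).trans (h' 0 0)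
    refine ⟨C * C', d + d' + 1 + 1, fun N n => ?_⟩
    set B : ℝ := C * C' * ((n : ℝ) + 1) ^ (d + d' + 1) with hB
    have hB0 : 0 ≤ B := by positivity
    have hterm : ∀ a, |((PowerSeries.coeff n (lambert p (a + 1) * nestedSum a (L.map lambert)) : ℚ)
        : ℝ)| ≤ B := by
      intro a
      rw [PowerSeries.coeff_mul, Rat.cast_sum]
      refine (Finset.abs_sum_le_sum_abs _ _).trans ((Finset.sum_le_card_nsmul _ _
        (C * ((n : ℝ) + 1) ^ d * (C' * ((n : ℝ) + 1) ^ d')) fun x hx => ?_).trans_eq ?_)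
      · have hx' := Finset.HasAntidiagonal.mem_antidiagonal.1 hx
        have h1 : (x.1 : ℝ) ≤ n := by exact_mod_cast (by omega : x.1 ≤ n)
        have h2 : (x.2 : ℝ) ≤ n := by exact_mod_cast (by omega : x.2 ≤ n)
        rw [Rat.cast_mul, abs_mul]
        refine mul_le_mul ((h _ a.succ_pos _).trans ?_) ((h' _ _).trans ?_) (abs_nonneg _)
          (by positivity)
        · gcongr
        · gcongr
      · rw [Finset.Nat.card_antidiagonal, nsmul_eq_mul, hB]
        push_cast
        ring
    have hBn : C * C' * ((n : ℝ) + 1) ^ (d + d' + 1 + 1) = ((n : ℝ) + 1) * B := by rw [hB]; ring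
    rcases le_or_gt n N with hN | hN
    · rw [coeff_nestedSum_lambert _ hN, List.map_cons, nestedSum_cons, map_sum, Rat.cast_sum]
      refine (Finset.abs_sum_le_sum_abs _ _).trans ((Finset.sum_le_card_nsmul _ _ B
        fun a _ => hterm a).trans ?_)
      rw [Finset.card_range, nsmul_eq_mul, hBn]
      exact mul_le_mul_of_nonneg_right (by linarith) hB0
    · rw [List.map_cons, nestedSum_cons, map_sum, Rat.cast_sum]
      refine (Finset.abs_sum_le_sum_abs _ _).trans ((Finset.sum_le_card_nsmul _ _ B
        fun a _ => hterm a).trans ?_)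
      rw [Finset.card_range, nsmul_eq_mul, hBn]
      have : (N : ℝ) ≤ n := by exact_mod_cast hN.le
      exact mul_le_mul_of_nonneg_right (by linarith) hB0

theorem polyGrowth_nestedSum {L : List (ℕ → ℚ)} (hL : ∀ p ∈ L, ∃ d, GrowthLE p d) (N : ℕ) :
    PolyGrowth (nestedSum N (L.map lambert)) := by
  obtain ⟨C, d, h⟩ := exists_abs_coeff_nestedSum_le hL
  exact ⟨C, d, h N⟩

theorem polyGrowth_nestedLambert {L : List (ℕ → ℚ)} (hL : ∀ p ∈ L, ∃ d, GrowthLE p d) :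
    PolyGrowth (nestedLambert L) := by
  obtain ⟨C, d, h⟩ := exists_abs_coeff_nestedSum_le hL
  exact ⟨C, d, fun n => by rw [nestedLambert, PowerSeries.coeff_mk]; exact h n n⟩

theorem qValue_nestedSum {L : List (ℕ → ℚ)} (hL : ∀ p ∈ L, ∃ d, GrowthLE p d) {q : ℝ}
    (hq : |q| < 1) (N : ℕ) : qValue (nestedSum N (L.map lambert)) q =
      nestedSum N (L.map fun p m => qValue (lambert p m) q) := by
  induction L generalizing N with
  | nil => simp [qValue_one]
  | cons p L ih =>
    have hL' : ∀ r ∈ L, ∃ d, GrowthLE r d := fun r hr => hL r (by simp [hr])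
    obtain ⟨d, hd⟩ := hL p (by simp)
    rw [List.map_cons, List.map_cons, nestedSum_cons, nestedSum_cons, PolyGrowth.qValue_sum _ hq]
    · refine Finset.sum_congr rfl fun a _ => ?_
      rw [(polyGrowth_lambert hd a.succ_pos).qValue_mul (polyGrowth_nestedSum hL' a) hq, ih hL']
    · exact fun a _ => (polyGrowth_lambert hd a.succ_pos).mul (polyGrowth_nestedSum hL' a)

/-- Each coefficient is stationary once `N ≥ n`, and the growth bound is uniform in `N`. -/
theorem tendsto_qValue_nestedSum {L : List (ℕ → ℚ)} (hL : ∀ p ∈ L, ∃ d, GrowthLE p d) {q : ℝ}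
    (hq : |q| < 1) : Tendsto (fun N => nestedSum N (L.map fun p m => qValue (lambert p m) q)) atTop
      (𝓝 (qValue (nestedLambert L) q)) := by
  simp_rw [← qValue_nestedSum hL hq]
  obtain ⟨C, d, h⟩ := exists_abs_coeff_nestedSum_le hL
  refine tendsto_tsum_of_dominated_convergence
    (bound := fun n => C * (((n : ℝ) + 1) ^ d * |q| ^ n))
    ((summable_succ_pow_mul_geometric d hq).mul_left C) (fun n => ?_)
    (Eventually.of_forall fun N n => abs_qTerm_le (h N) q n)
  refine tendsto_const_nhds.congr' ?_
  filter_upwards [eventually_ge_atTop n] with N hN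
  rw [qTerm, qTerm, nestedLambert, PowerSeries.coeff_mk, coeff_nestedSum_lambert L hN]

theorem constantCoeff_nestedLambert (L : List (ℕ → ℚ)) :
    PowerSeries.constantCoeff (nestedLambert L) = if L = [] then 1 else 0 := by
  rw [← PowerSeries.coeff_zero_eq_constantCoeff_apply, nestedLambert, PowerSeries.coeff_mk]
  cases L with
  | nil => simp
  | cons p L => simp [nestedSum_cons]

/-! ### Lambert series near `q = 1` -/

theorem qValue_lambert {p : ℕ → ℚ} {m : ℕ} (hm : 0 < m) (q : ℝ) :
    qValue (lambert p m) q = ∑' n : ℕ, ((p (n + 1) : ℚ) : ℝ) * (q ^ m) ^ (n + 1) := by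
  have hinj : Function.Injective fun n : ℕ => m * (n + 1) := fun a b hab =>
    Nat.succ_injective (Nat.eq_of_mul_eq_mul_left hm hab)
  rw [qValue, ← hinj.tsum_eq]
  · refine tsum_congr fun n => ?_
    rw [qTerm, coeff_lambert, if_pos ⟨dvd_mul_right _ _, by positivity⟩,
      Nat.mul_div_cancel_left _ hm, pow_mul]
  · intro N hN
    rw [Function.mem_support, qTerm, coeff_lambert] at hN
    by_cases h : m ∣ N ∧ N ≠ 0
    · obtain ⟨⟨t, rfl⟩, ht⟩ := h
      obtain ⟨t, rfl⟩ := Nat.exists_eq_succ_of_ne_zero (right_ne_zero_of_mul ht)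
      exact ⟨t, rfl⟩
    · rw [if_neg h] at hN
      simp at hN

theorem tsum_succ_pow_le (d : ℕ) {T : ℝ} (h0 : 0 ≤ T) (h1 : T < 1) :
    ∑' n : ℕ, ((n : ℝ) + 1) ^ d * T ^ n ≤ d.factorial / (1 - T) ^ (d + 1) := by
  have hT : ‖T‖ < 1 := by rwa [Real.norm_of_nonneg h0]
  have hs := summable_succ_pow_mul_geometric d (q := T) (by simpa using hT)
  rw [abs_of_nonneg h0] at hs
  have hs' := (summable_choose_mul_geometric_of_norm_lt_one d hT).mul_left (d.factorial : ℝ)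
  refine (hs.tsum_le_tsum (fun n => ?_) hs').trans_eq ?_
  · rw [← mul_assoc]
    exact mul_le_mul_of_nonneg_right (succ_pow_le_choose n d) (by positivity)
  · rw [tsum_mul_left, tsum_choose_mul_geometric_of_norm_lt_one d hT, mul_one_div]

theorem abs_qValue_lambert_le {p : ℕ → ℚ} {d : ℕ} {C : ℚ}
    (h : ∀ n, 1 ≤ n → |p n| ≤ C * (n : ℚ) ^ d) {m : ℕ} (hm : 0 < m) {q : ℝ} (h0 : 0 < q)
    (h1 : q < 1) :
    |qValue (lambert p m) q| ≤ C * d.factorial * (q ^ m / (1 - q ^ m) ^ (d + 1)) := by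
  have hC0 : 0 ≤ C := by simpa using (abs_nonneg _).trans (h 1 le_rfl)
  have hC : (0 : ℝ) ≤ C := by exact_mod_cast hC0
  set T := q ^ m with hT
  have hT0 : 0 < T := by positivity
  have hT1 : T < 1 := pow_lt_one₀ h0.le h1 hm.ne'
  have hs := summable_succ_pow_mul_geometric d (q := T) (by rwa [abs_of_pos hT0])
  rw [abs_of_pos hT0] at hs
  rw [qValue_lambert hm]
  have hle : ∀ n : ℕ, ‖((p (n + 1) : ℚ) : ℝ) * T ^ (n + 1)‖ ≤
      C * T * (((n : ℝ) + 1) ^ d * T ^ n) := fun n => by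
    have h2 : |((p (n + 1) : ℚ) : ℝ)| ≤ (C : ℝ) * ((n : ℝ) + 1) ^ d := by
      exact_mod_cast h (n + 1) (by omega)
    rw [norm_mul, Real.norm_eq_abs, Real.norm_of_nonneg (by positivity)]
    calc |((p (n + 1) : ℚ) : ℝ)| * T ^ (n + 1) ≤ (C : ℝ) * ((n : ℝ) + 1) ^ d * T ^ (n + 1) := by
          gcongr
      _ = _ := by ring
  refine (tsum_of_norm_bounded (hs.mul_left (C * T : ℝ)).hasSum hle).trans ?_
  rw [tsum_mul_left]
  calc (C * T : ℝ) * ∑' n : ℕ, ((n : ℝ) + 1) ^ d * T ^ n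
      ≤ C * T * (d.factorial / (1 - T) ^ (d + 1)) := by
        gcongr
        exact tsum_succ_pow_le d hT0.le hT1
    _ = _ := by ring

/-- Cauchy–Schwarz for the geometric sum and its reversal: the products `q^i q^(m-1-i)` all equal
`q^(m-1)`, which is at least `q^m`. -/
theorem mul_pow_le_geom_sum_sq (m : ℕ) {q : ℝ} (h0 : 0 < q) (h1 : q < 1) :
    (m : ℝ) ^ 2 * q ^ m ≤ (∑ i ∈ Finset.range m, q ^ i) ^ 2 := by
  set s := Real.sqrt q with hs
  have hs2 : s ^ 2 = q := Real.sq_sqrt h0.le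
  have hs0 : 0 ≤ s := Real.sqrt_nonneg q
  -- The square root `s` of `q` is needed because the common value `q^(m-1)` has to be written as a
  -- square.
  have h := Finset.sum_sq_le_sum_mul_sum_of_sq_le_mul (Finset.range m) (r := fun _ => s ^ (m - 1))
    (f := fun i => q ^ i) (g := fun i => q ^ (m - 1 - i)) (fun i _ => by positivity)
    (fun i _ => by positivity) fun i hi => by
      have := Finset.mem_range.1 hi
      rw [← pow_add, ← hs2, ← pow_mul, ← pow_mul]
      apply le_of_eq
      congr 1
      have : i + (m - 1 - i) = m - 1 := by omega
      rw [this, mul_comm]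
  rw [Finset.sum_range_reflect (fun i => q ^ i) m, Finset.sum_const, Finset.card_range,
    nsmul_eq_mul, mul_pow, ← pow_mul, mul_comm (m - 1) 2, pow_mul, hs2, ← pow_two] at h
  refine le_trans ?_ h
  exact mul_le_mul_of_nonneg_left (pow_le_pow_of_le_one h0.le h1.le (Nat.sub_le m 1))
    (by positivity)

/-- With `m = a + 1` and `1 - q^m = (1 - q)(1 + ⋯ + q^(m-1))`, this is the preceding estimate. -/
theorem one_sub_sq_mul_le (a : ℕ) {q : ℝ} (h0 : 0 < q) (h1 : q < 1) :
    (1 - q) ^ 2 * (q ^ (a + 1) / (1 - q ^ (a + 1)) ^ 2) ≤ 1 / ((a : ℝ) + 1) ^ 2 := by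
  have hT1 : q ^ (a + 1) < 1 := pow_lt_one₀ h0.le h1 a.succ_ne_zero
  have h := mul_pow_le_geom_sum_sq (a + 1) h0 h1
  have h2 := mul_neg_geom_sum q (a + 1)
  rw [← mul_div_assoc, div_le_div_iff₀ (pow_pos (by linarith) 2) (by positivity), ← h2, mul_pow]
  push_cast at h
  nlinarith [mul_le_mul_of_nonneg_left h (sq_nonneg (1 - q))]

/-- The square root of the preceding estimate, since `(q^m)² ≤ q^m`. -/
theorem one_sub_mul_le (a : ℕ) {q : ℝ} (h0 : 0 < q) (h1 : q < 1) :
    (1 - q) * (q ^ (a + 1) / (1 - q ^ (a + 1))) ≤ 1 / ((a : ℝ) + 1) := by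
  have hT1 : q ^ (a + 1) < 1 := pow_lt_one₀ h0.le h1 a.succ_ne_zero
  have hT0 : 0 < q ^ (a + 1) := by positivity
  have h := one_sub_sq_mul_le a h0 h1
  have hpos : 0 ≤ (1 - q) * (q ^ (a + 1) / (1 - q ^ (a + 1))) :=
    mul_nonneg (by linarith) (div_nonneg hT0.le (by linarith))
  refine (pow_le_pow_iff_left₀ hpos (by positivity) two_ne_zero).1 ?_
  rw [div_pow, one_pow]
  refine le_trans ?_ h
  rw [mul_pow, div_pow]
  exact mul_le_mul_of_nonneg_left (div_le_div_of_nonneg_right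
    (pow_le_of_le_one hT0.le hT1.le two_ne_zero) (sq_nonneg _)) (sq_nonneg _)

/-- Two of the factors `(1-q)/(1-q^m)` yield the decay `1/m²`; the others are at most `1`. -/
theorem scaled_le_sq {d : ℕ} (hd : 1 ≤ d) (a : ℕ) {q : ℝ} (h0 : 0 < q) (h1 : q < 1) :
    (1 - q) ^ (d + 1) * (q ^ (a + 1) / (1 - q ^ (a + 1)) ^ (d + 1)) ≤ 1 / ((a : ℝ) + 1) ^ 2 := by
  have hT1 : q ^ (a + 1) < 1 := pow_lt_one₀ h0.le h1 a.succ_ne_zero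
  have hT0 : 0 < q ^ (a + 1) := by positivity
  obtain ⟨e, rfl⟩ := Nat.exists_eq_add_of_le' hd
  have h2 : (1 - q) / (1 - q ^ (a + 1)) ≤ 1 := by
    rw [div_le_one (by linarith)]
    have : q ^ (a + 1) ≤ q := pow_le_of_le_one h0.le h1.le a.succ_ne_zero
    linarith
  have h3 : 0 ≤ (1 - q) / (1 - q ^ (a + 1)) := div_nonneg (by linarith) (by linarith)
  have h4 : 0 ≤ (1 - q) ^ 2 * (q ^ (a + 1) / (1 - q ^ (a + 1)) ^ 2) := by positivity
  calc (1 - q) ^ (e + 1 + 1) * (q ^ (a + 1) / (1 - q ^ (a + 1)) ^ (e + 1 + 1))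
      = ((1 - q) / (1 - q ^ (a + 1))) ^ e *
          ((1 - q) ^ 2 * (q ^ (a + 1) / (1 - q ^ (a + 1)) ^ 2)) := by
        rw [div_pow]
        have : (1 - q ^ (a + 1)) ≠ 0 := by linarith
        field_simp
        ring
    _ ≤ 1 * ((1 - q) ^ 2 * (q ^ (a + 1) / (1 - q ^ (a + 1)) ^ 2)) := by
        gcongr
        exact pow_le_one₀ h3 h2
    _ ≤ _ := by rw [one_mul]; exact one_sub_sq_mul_le a h0 h1

theorem scaled_le (d a : ℕ) {q : ℝ} (h0 : 0 < q) (h1 : q < 1) :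
    (1 - q) ^ (d + 1) * (q ^ (a + 1) / (1 - q ^ (a + 1)) ^ (d + 1)) ≤ 1 / ((a : ℝ) + 1) := by
  rcases Nat.eq_zero_or_pos d with rfl | hd
  · simpa using one_sub_mul_le a h0 h1
  · refine (scaled_le_sq hd a h0 h1).trans ?_
    gcongr
    exact le_self_pow₀ (by linarith [Nat.cast_nonneg (α := ℝ) a]) two_ne_zero

/-- The rising factorial exceeds `(n+1)^d` only by lower order terms. Everything is multiplied by `n
+ 1` to avoid the exponent `d - 1`. -/
theorem exists_ascFactorial_le (d : ℕ) : ∃ C : ℝ, 0 ≤ C ∧ ∀ n : ℕ,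
    ((n : ℝ) + 1) * ((n + 1).ascFactorial d : ℝ) ≤ ((n : ℝ) + 1) ^ (d + 1) +
      C * ((n : ℝ) + 1) ^ d := by
  induction d with
  | zero => exact ⟨0, le_rfl, fun n => by simp⟩
  | succ d ih =>
    obtain ⟨C, hC, h⟩ := ih
    refine ⟨C + d + C * d, by positivity, fun n => ?_⟩
    rw [Nat.ascFactorial_succ]
    push_cast
    have h1 : (0 : ℝ) ≤ n := Nat.cast_nonneg n
    have h2 : ((n : ℝ) + 1) ^ d ≤ ((n : ℝ) + 1) ^ (d + 1) :=
      pow_le_pow_right₀ (by linarith) (by omega)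
    calc ((n : ℝ) + 1) * (((n : ℝ) + 1 + d) * ((n + 1).ascFactorial d : ℝ))
        = ((n : ℝ) + 1 + d) * (((n : ℝ) + 1) * ((n + 1).ascFactorial d : ℝ)) := by ring
      _ ≤ ((n : ℝ) + 1 + d) * (((n : ℝ) + 1) ^ (d + 1) + C * ((n : ℝ) + 1) ^ d) := by
          gcongr
          exact h n
      _ = ((n : ℝ) + 1) ^ (d + 1 + 1) + (C + d) * ((n : ℝ) + 1) ^ (d + 1) +
            C * d * ((n : ℝ) + 1) ^ d := by ring
      _ ≤ ((n : ℝ) + 1) ^ (d + 1 + 1) + (C + d) * ((n : ℝ) + 1) ^ (d + 1) +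
            C * d * ((n : ℝ) + 1) ^ (d + 1) := by gcongr
      _ = _ := by ring

/-- The generating function of the rising factorials is exactly `d!/(1-T)^(d+1)`. Replacing them by
`(n+1)^d` costs a series with a pole of order only `d`, which the scaling sends to zero. -/
theorem tendsto_one_sub_pow_mul_tsum (d : ℕ) :
    Tendsto (fun T : ℝ => (1 - T) ^ (d + 1) * ∑' n : ℕ, ((n : ℝ) + 1) ^ d * T ^ n) (𝓝[<] 1)
      (𝓝 (d.factorial : ℝ)) := by
  have hev : ∀ᶠ T : ℝ in 𝓝[<] 1, 0 < T ∧ T < 1 :=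
    Ioo_mem_nhdsLT (by norm_num : (0 : ℝ) < 1)
  rcases d with _ | d
  · refine tendsto_const_nhds.congr' ?_
    filter_upwards [hev] with T hT
    simp only [pow_zero, one_mul, zero_add, pow_one]
    rw [tsum_geometric_of_lt_one hT.1.le hT.2, mul_inv_cancel₀ (by linarith [hT.2])]
    simp
  obtain ⟨C, hC, h⟩ := exists_ascFactorial_le (d + 1)
  have h1 : ∀ n : ℕ, (((d + 1).factorial : ℝ) * ((n + (d + 1)).choose (d + 1) : ℝ)) ≤
      ((n : ℝ) + 1) ^ (d + 1) + C * ((n : ℝ) + 1) ^ d := fun n => by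
    have h2 := h n
    rw [Nat.ascFactorial_eq_factorial_mul_choose] at h2
    push_cast at h2
    have h3 : (0 : ℝ) < (n : ℝ) + 1 := by positivity
    refine le_of_mul_le_mul_left (h2.trans_eq ?_) h3
    ring
  have hzero : Tendsto (fun T : ℝ => C * d.factorial * (1 - T)) (𝓝[<] 1) (𝓝 0) := by
    have : Tendsto (fun T : ℝ => C * d.factorial * (1 - T)) (𝓝 1) (𝓝 (C * d.factorial * (1 - 1))) :=
      (Continuous.tendsto (by fun_prop) 1)
    rw [sub_self, mul_zero] at this
    exact this.mono_left nhdsWithin_le_nhds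
  rw [tendsto_iff_dist_tendsto_zero]
  refine squeeze_zero' (Eventually.of_forall fun _ => dist_nonneg) ?_ hzero
  filter_upwards [hev] with T hT
  have hTn : ‖T‖ < 1 := by rw [Real.norm_of_nonneg hT.1.le]; exact hT.2
  have hTa : |T| < 1 := hTn
  have hs := summable_succ_pow_mul_geometric (d + 1) hTa
  have hs' := summable_succ_pow_mul_geometric d hTa
  rw [abs_of_pos hT.1] at hs hs'
  have hsc := (summable_choose_mul_geometric_of_norm_lt_one (d + 1) hTn).mul_left
    ((d + 1).factorial : ℝ)
  have hv : ∑' n : ℕ, ((d + 1).factorial : ℝ) * (((n + (d + 1)).choose (d + 1) : ℝ) * T ^ n) =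
      (d + 1).factorial / (1 - T) ^ (d + 1 + 1) := by
    rw [tsum_mul_left, tsum_choose_mul_geometric_of_norm_lt_one (d + 1) hTn, mul_one_div]
  have hpos : 0 < 1 - T := by linarith [hT.2]
  have hup := tsum_succ_pow_le (d + 1) hT.1.le hT.2
  have hlow : (d + 1).factorial / (1 - T) ^ (d + 1 + 1) ≤
      ∑' n : ℕ, ((n : ℝ) + 1) ^ (d + 1) * T ^ n + C * (d.factorial / (1 - T) ^ (d + 1)) := by
    rw [← hv]
    calc ∑' n : ℕ, ((d + 1).factorial : ℝ) * (((n + (d + 1)).choose (d + 1) : ℝ) * T ^ n)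
        ≤ ∑' n : ℕ, (((n : ℝ) + 1) ^ (d + 1) * T ^ n + C * (((n : ℝ) + 1) ^ d * T ^ n)) := by
          refine hsc.tsum_le_tsum (fun n => ?_) (hs.add (hs'.mul_left C))
          have := mul_le_mul_of_nonneg_right (h1 n) (pow_nonneg hT.1.le n)
          linarith
      _ = ∑' n : ℕ, ((n : ℝ) + 1) ^ (d + 1) * T ^ n + C * ∑' n : ℕ, ((n : ℝ) + 1) ^ d * T ^ n := by
          rw [hs.tsum_add (hs'.mul_left C), tsum_mul_left]
      _ ≤ _ := by
          gcongr
          exact tsum_succ_pow_le d hT.1.le hT.2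
  set S := ∑' n : ℕ, ((n : ℝ) + 1) ^ (d + 1) * T ^ n with hS
  have hP : 0 < (1 - T) ^ (d + 1 + 1) := by positivity
  have hup' : (1 - T) ^ (d + 1 + 1) * S ≤ (d + 1).factorial := by
    rw [le_div_iff₀ hP] at hup
    linarith
  have hlow' : ((d + 1).factorial : ℝ) ≤ (1 - T) ^ (d + 1 + 1) * S + C * d.factorial * (1 - T) := by
    rw [div_le_iff₀ hP] at hlow
    refine hlow.trans_eq ?_
    rw [add_mul, pow_succ (1 - T) (d + 1)]
    field_simp
  rw [Real.dist_eq, abs_le]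
  have : 0 ≤ C * d.factorial * (1 - T) := by positivity
  constructor <;> linarith

theorem tendsto_pow_nhdsLT_one (a : ℕ) :
    Tendsto (fun q : ℝ => q ^ (a + 1)) (𝓝[<] 1) (𝓝[<] 1) := by
  refine tendsto_nhdsWithin_of_tendsto_nhds_of_eventually_within _ ?_ ?_
  · have : Tendsto (fun q : ℝ => q ^ (a + 1)) (𝓝 1) (𝓝 (1 ^ (a + 1))) :=
      Continuous.tendsto (by fun_prop) 1
    rw [one_pow] at this
    exact this.mono_left nhdsWithin_le_nhds
  · filter_upwards [Ioo_mem_nhdsLT (by norm_num : (0 : ℝ) < 1)] with q hq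
    exact pow_lt_one₀ hq.1.le hq.2 a.succ_ne_zero

/-- With `T = q^m`, the factor `1 - q` equals `(1 - T)/(1 + ⋯ + q^(m-1))`, whose denominator tends
to `m`; the powers of `1 - T` are absorbed by `tendsto_one_sub_pow_mul_tsum`. -/
theorem tendsto_scaled_lambert {p : ℕ → ℚ} {d : ℕ}
    (hp : ∀ n, p n = (d.factorial : ℚ)⁻¹ * (n : ℚ) ^ d) (a : ℕ) :
    Tendsto (fun q : ℝ => (1 - q) ^ (d + 1) * qValue (lambert p (a + 1)) q) (𝓝[<] 1)
      (𝓝 (1 / ((a : ℝ) + 1) ^ (d + 1))) := by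
  have hev : ∀ᶠ T : ℝ in 𝓝[<] 1, 0 < T ∧ T < 1 :=
    Ioo_mem_nhdsLT (by norm_num : (0 : ℝ) < 1)
  have hT := tendsto_pow_nhdsLT_one a
  have h1 := (tendsto_one_sub_pow_mul_tsum d).comp hT
  have h2 : Tendsto (fun q : ℝ => (∑ i ∈ Finset.range (a + 1), q ^ i)⁻¹ ^ (d + 1)) (𝓝[<] 1)
      (𝓝 (((a : ℝ) + 1)⁻¹ ^ (d + 1))) := by
    have h3 : Tendsto (fun q : ℝ => ∑ i ∈ Finset.range (a + 1), q ^ i) (𝓝 1)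
        (𝓝 (∑ i ∈ Finset.range (a + 1), 1 ^ i)) := Continuous.tendsto (by fun_prop) 1
    simp only [one_pow, Finset.sum_const, Finset.card_range, nsmul_eq_mul, mul_one] at h3
    push_cast at h3
    exact ((h3.mono_left nhdsWithin_le_nhds).inv₀ (by positivity)).pow _
  have h4 : Tendsto (fun q : ℝ => q ^ (a + 1)) (𝓝[<] 1) (𝓝 1) :=
    hT.mono_right nhdsWithin_le_nhds
  have h5 := ((h2.mul h4).mul h1).const_mul ((d.factorial : ℝ)⁻¹)
  have hval : (d.factorial : ℝ)⁻¹ * (((a : ℝ) + 1)⁻¹ ^ (d + 1) * 1 * d.factorial) =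
      1 / ((a : ℝ) + 1) ^ (d + 1) := by
    rw [inv_pow]
    field_simp
  rw [hval] at h5
  refine h5.congr' ?_
  filter_upwards [hev] with q hq
  have hT1 : q ^ (a + 1) < 1 := pow_lt_one₀ hq.1.le hq.2 a.succ_ne_zero
  have hgeo := mul_neg_geom_sum q (a + 1)
  have hq1 : 1 - q ≠ 0 := by linarith [hq.2]
  have hgne : (∑ i ∈ Finset.range (a + 1), q ^ i) ≠ 0 := by
    intro h0
    rw [h0, mul_zero] at hgeo
    linarith
  have h6 : qValue (lambert p (a + 1)) q = (d.factorial : ℝ)⁻¹ * q ^ (a + 1) *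
      ∑' n : ℕ, ((n : ℝ) + 1) ^ d * (q ^ (a + 1)) ^ n := by
    rw [qValue_lambert (Nat.succ_pos a : 0 < a + 1), ← tsum_mul_left]
    refine tsum_congr fun n => ?_
    rw [hp]
    push_cast
    simp only [Nat.succ_eq_add_one]
    ring
  rw [h6, Function.comp_apply, ← hgeo, inv_pow, mul_pow]
  field_simp

/-! ### Blocks of compositions -/

/-- The blocks of a composition, as pairs of the start and the size. -/
def compItems {r : ℕ} (c : Composition r) : List (ℕ × ℕ) :=
  List.ofFn fun i : Fin c.length => (c.sizeUpTo i, c.blocksFun i)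

/-- The function attached to a block. -/
def blockItem (b : Mould ℚ) (k : ℕ → ℕ) (i : ℕ × ℕ) : ℕ → ℚ := blockFun b i.2 fun t => k (i.1 + t)

/-- The degree of the growth of the function attached to a block. -/
def blockDeg (k : ℕ → ℕ) (i : ℕ × ℕ) : ℕ := ∑ t ∈ Finset.range i.2, k (i.1 + t)

theorem blockList_eq_map (b : Mould ℚ) (k : ℕ → ℕ) {r : ℕ} (c : Composition r) :
    blockList b k c = (compItems c).map (blockItem b k) := by
  rw [blockList, compItems, List.map_ofFn]
  rfl

theorem growthLE_blockItem (b : Mould ℚ) (k : ℕ → ℕ) (i : ℕ × ℕ) :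
    GrowthLE (blockItem b k i) (blockDeg k i) := exists_abs_blockFun_le b i.2 _

theorem exists_growthLE_of_mem {b : Mould ℚ} {k : ℕ → ℕ} {L : List (ℕ × ℕ)} :
    ∀ p ∈ L.map (blockItem b k), ∃ d, GrowthLE p d := by
  intro p hp
  obtain ⟨i, -, rfl⟩ := List.mem_map.1 hp
  exact ⟨_, growthLE_blockItem b k i⟩

theorem one_le_of_mem_compItems {r : ℕ} {c : Composition r} {i : ℕ × ℕ} (hi : i ∈ compItems c) :
    1 ≤ i.2 := by
  obtain ⟨t, rfl⟩ := (List.mem_ofFn' _ _).1 hi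
  exact c.one_le_blocksFun t

theorem sum_compItems {r : ℕ} (c : Composition r) (f : ℕ → ℕ) :
    ((compItems c).map fun i => ∑ t ∈ Finset.range i.2, f (i.1 + t)).sum =
      ∑ t ∈ Finset.range r, f t := by
  rw [compItems, List.map_ofFn, List.sum_ofFn, Finset.sum_range, ← c.blocksFinEquiv.sum_comp,
    Fintype.sum_sigma]
  refine Finset.sum_congr rfl fun i _ => ?_
  rw [Function.comp_apply, Finset.sum_range]
  rfl

theorem sum_blockDeg_add {r : ℕ} (c : Composition r) (k : ℕ → ℕ) :
    ((compItems c).map fun i => blockDeg k i + i.2).sum = ∑ t ∈ Finset.range r, (k t + 1) := by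
  rw [← sum_compItems c]
  congr 2
  ext i
  rw [blockDeg, Finset.sum_add_distrib, Finset.sum_const, Finset.card_range, smul_eq_mul, mul_one]

theorem compItems_ones (r : ℕ) : compItems (Composition.ones r) =
    (List.range r).map fun i => (i, 1) := by
  refine List.ext_getElem (by simp [compItems]) fun i h1 h2 => ?_
  simp [compItems, Composition.ones_sizeUpTo, Composition.ones_blocksFun]

theorem exists_mem_compItems_ne_one {r : ℕ} {c : Composition r} (hc : c ≠ Composition.ones r) :
    ∃ i ∈ compItems c, i.2 ≠ 1 := by
  obtain ⟨n, hn, h1⟩ := Composition.ne_ones_iff.1 hc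
  rw [← c.ofFn_blocksFun, List.mem_ofFn'] at hn
  obtain ⟨t, rfl⟩ := hn
  exact ⟨_, (List.mem_ofFn' _ _).2 ⟨t, rfl⟩, h1.ne'⟩

theorem compItems_eq_cons {r : ℕ} (hr : r ≠ 0) (c : Composition r) :
    ∃ n L, compItems c = (0, n) :: L := by
  have hl : 0 < c.length := c.length_pos_of_pos (Nat.pos_of_ne_zero hr)
  obtain ⟨i, L, h⟩ := List.exists_cons_of_length_pos (l := compItems c)
    (by rw [compItems, List.length_ofFn]; exact hl)
  refine ⟨i.2, L, ?_⟩
  rw [h]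
  congr 1
  have h0 : (compItems c)[0]'(by simp [h]) = i := by simp [h]
  rw [← h0]
  simp [compItems]

theorem sum_expFun_add_one (ks : List ℕ+) :
    ∑ t ∈ Finset.range ks.length, (expFun ks t + 1) = weight ks := by
  induction ks with
  | nil => simp [weight]
  | cons a ks ih =>
    rw [List.length_cons, Finset.sum_range_succ', weight_cons, ← ih, add_comm]
    congr 1
    have := a.pos
    simp only [expFun, List.getElem?_cons_zero, Option.getD_some]
    omega

/-! ### Scaled nested Lambert sums -/

theorem nestedSum_mul {R ι : Type*} [CommSemiring R] (s : ι → R) (f : ι → ℕ → R) (L : List ι)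
    (N : ℕ) : nestedSum N (L.map fun i m => s i * f i m) =
      (L.map s).prod * nestedSum N (L.map f) := by
  induction L generalizing N with
  | nil => simp
  | cons i L ih =>
    simp only [List.map_cons, nestedSum_cons, List.prod_cons, Finset.mul_sum, ih]
    exact Finset.sum_congr rfl fun a _ => by ring

theorem nestedSum_eq_zero {R : Type*} [CommSemiring R] {L : List (ℕ → R)} (h : 0 ∈ L) (N : ℕ) :
    nestedSum N L = 0 := by
  induction L generalizing N with
  | nil => simp at h
  | cons f L ih =>
    rw [nestedSum_cons]
    refine Finset.sum_eq_zero fun a _ => ?_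
    rcases List.mem_cons.1 h with rfl | h
    · simp
    · rw [ih h, mul_zero]

theorem nestedTsum_eq_zero {L : List (ℕ → ℝ)} (h : 0 ∈ L) : nestedTsum L = 0 := by
  cases L with
  | nil => simp at h
  | cons f L =>
    rw [nestedTsum]
    refine (tsum_congr fun a => ?_).trans tsum_zero
    rcases List.mem_cons.1 h with rfl | h
    · simp
    · rw [nestedSum_eq_zero h, mul_zero]

/-- The Lambert series attached to a block, scaled by its weight. -/
def scaledItem (b : Mould ℚ) (k : ℕ → ℕ) (q : ℝ) (i : ℕ × ℕ) (m : ℕ) : ℝ :=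
  (1 - q) ^ (blockDeg k i + i.2) * qValue (lambert (blockItem b k i) m) q

/-- The limit of the scaled Lambert series attached to a block. -/
def limitItem (k : ℕ → ℕ) (i : ℕ × ℕ) (m : ℕ) : ℝ :=
  if i.2 = 1 then 1 / (m : ℝ) ^ (k i.1 + 1) else 0

/-- A block of size `s` and degree `d` is scaled by `(1-q)^(d+s)`, but its Lambert series needs only
`(1-q)^(d+1)`. The surplus `(1-q)^(s-1)` is what removes larger blocks in the limit. -/
theorem exists_abs_scaledItem_le (b : Mould ℚ) (k : ℕ → ℕ) {i : ℕ × ℕ} (hi : 1 ≤ i.2) :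
    ∃ C : ℝ, 0 ≤ C ∧ ∀ q : ℝ, 0 < q → q < 1 → ∀ a : ℕ,
      |scaledItem b k q i (a + 1)| ≤ (1 - q) ^ (i.2 - 1) * (C * (1 / ((a : ℝ) + 1))) ∧
      (1 ≤ blockDeg k i →
        |scaledItem b k q i (a + 1)| ≤ (1 - q) ^ (i.2 - 1) * (C * (1 / ((a : ℝ) + 1) ^ 2))) := by
  obtain ⟨C, h⟩ := growthLE_blockItem b k i
  have hC0 : 0 ≤ C := by simpa using (abs_nonneg _).trans (h 1 le_rfl)
  have hC : (0 : ℝ) ≤ C := by exact_mod_cast hC0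
  refine ⟨C * (blockDeg k i).factorial, by positivity, fun q h0 h1 a => ?_⟩
  have hq : 0 ≤ 1 - q := by linarith
  set d := blockDeg k i with hd
  have key : |scaledItem b k q i (a + 1)| ≤ (1 - q) ^ (i.2 - 1) * (C * d.factorial *
      ((1 - q) ^ (d + 1) * (q ^ (a + 1) / (1 - q ^ (a + 1)) ^ (d + 1)))) := by
    have he : d + i.2 = (i.2 - 1) + (d + 1) := by omega
    rw [scaledItem, ← hd, he, pow_add, abs_mul, abs_of_nonneg (by positivity)]
    refine (mul_le_mul_of_nonneg_left (abs_qValue_lambert_le h (Nat.succ_pos a) h0 h1)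
      (by positivity)).trans_eq ?_
    simp only [Nat.succ_eq_add_one]
    ring
  refine ⟨key.trans ?_, fun h2 => key.trans ?_⟩
  · exact mul_le_mul_of_nonneg_left (mul_le_mul_of_nonneg_left (scaled_le d a h0 h1)
      (by positivity)) (by positivity)
  · exact mul_le_mul_of_nonneg_left (mul_le_mul_of_nonneg_left (scaled_le_sq h2 a h0 h1)
      (by positivity)) (by positivity)

theorem eventually_mem_Ioo : ∀ᶠ q : ℝ in 𝓝[<] 1, 0 < q ∧ q < 1 :=
  Ioo_mem_nhdsLT (by norm_num : (0 : ℝ) < 1)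

theorem tendsto_one_sub_pow {n : ℕ} (hn : n ≠ 0) :
    Tendsto (fun q : ℝ => (1 - q) ^ n) (𝓝[<] 1) (𝓝 0) := by
  have h : Tendsto (fun q : ℝ => (1 - q) ^ n) (𝓝 1) (𝓝 ((1 - 1) ^ n)) :=
    Continuous.tendsto (by fun_prop) 1
  rw [sub_self, zero_pow hn] at h
  exact h.mono_left nhdsWithin_le_nhds

theorem tendsto_scaledItem (b : Mould ℚ) (k : ℕ → ℕ) {i : ℕ × ℕ} (hi : 1 ≤ i.2) (a : ℕ) :
    Tendsto (fun q => scaledItem b k q i (a + 1)) (𝓝[<] 1) (𝓝 (limitItem k i (a + 1))) := by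
  obtain ⟨s, n⟩ := i
  by_cases h1 : n = 1
  · subst h1
    have hd : blockDeg k (s, 1) = k s := by simp [blockDeg]
    have h2 := tendsto_scaled_lambert (p := blockItem b k (s, 1)) (d := k s)
      (fun n => by simp [blockItem, blockFun_one]) a
    simp only [scaledItem, hd, limitItem, if_true]
    push_cast
    exact h2
  · simp only [limitItem, if_neg h1]
    obtain ⟨C, hC, h⟩ := exists_abs_scaledItem_le b k hi
    have hn : n - 1 ≠ 0 := by simp only at hi; omega
    have h0 := (tendsto_one_sub_pow hn).mul_const (C * (1 / ((a : ℝ) + 1)))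
    rw [zero_mul] at h0
    refine squeeze_zero_norm' ?_ h0
    filter_upwards [eventually_mem_Ioo] with q hq
    exact (h q hq.1 hq.2 a).1

theorem exists_forall_abs_scaledItem_le (b : Mould ℚ) (k : ℕ → ℕ) {L : List (ℕ × ℕ)}
    (hL : ∀ i ∈ L, 1 ≤ i.2) : ∃ C : ℝ, ∀ i ∈ L, ∀ q : ℝ, 0 < q → q < 1 → ∀ a : ℕ,
      |scaledItem b k q i (a + 1)| ≤ C * (1 / ((a : ℝ) + 1)) ∧
      (1 ≤ blockDeg k i → |scaledItem b k q i (a + 1)| ≤ C * (1 / ((a : ℝ) + 1) ^ 2)) := by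
  induction L with
  | nil => exact ⟨0, by simp⟩
  | cons i L ih =>
    obtain ⟨C, h⟩ := ih fun j hj => hL j (by simp [hj])
    obtain ⟨C', hC', h'⟩ := exists_abs_scaledItem_le b k (hL i (by simp))
    refine ⟨max C C', fun j hj q h0 h1 a => ?_⟩
    rcases List.mem_cons.1 hj with rfl | hj
    · have h2 : (1 - q) ^ (j.2 - 1) ≤ 1 := pow_le_one₀ (by linarith) (by linarith)
      obtain ⟨h3, h4⟩ := h' q h0 h1 a
      refine ⟨h3.trans ?_, fun h5 => (h4 h5).trans ?_⟩
      · exact (mul_le_of_le_one_left (by positivity) h2).trans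
          (mul_le_mul_of_nonneg_right (le_max_right _ _) (by positivity))
      · exact (mul_le_of_le_one_left (by positivity) h2).trans
          (mul_le_mul_of_nonneg_right (le_max_right _ _) (by positivity))
    · obtain ⟨h3, h4⟩ := h j hj q h0 h1 a
      refine ⟨h3.trans ?_, fun h5 => (h4 h5).trans ?_⟩
      · exact mul_le_mul_of_nonneg_right (le_max_left _ _) (by positivity)
      · exact mul_le_mul_of_nonneg_right (le_max_left _ _) (by positivity)

/-- Both sides are limits of the same truncated sums, from which the powers of `1 - q` can be pulled
out factor by factor. -/
theorem nestedTsum_scaledItem (b : Mould ℚ) (k : ℕ → ℕ) {i : ℕ × ℕ} {L : List (ℕ × ℕ)}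
    (hL : ∀ j ∈ i :: L, 1 ≤ j.2) (hi : 1 ≤ blockDeg k i) {q : ℝ} (h0 : 0 < q) (h1 : q < 1) :
    nestedTsum ((i :: L).map (scaledItem b k q)) =
      (1 - q) ^ ((i :: L).map fun j => blockDeg k j + j.2).sum *
        qValue (nestedLambert ((i :: L).map (blockItem b k))) q := by
  obtain ⟨C, h⟩ := exists_forall_abs_scaledItem_le b k hL
  have ht : Tendsto (fun N => nestedSum N ((i :: L).map (scaledItem b k q))) atTop
      (𝓝 (nestedTsum ((i :: L).map (scaledItem b k q)))) :=
    tendsto_nestedSum_nestedTsum (C := C) (fun a => (h i (by simp) q h0 h1 a).2 hi)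
      fun f hf a => by
        obtain ⟨j, hj, rfl⟩ := List.mem_map.1 hf
        exact (h j (by simp [hj]) q h0 h1 a).1
  have hs := (tendsto_qValue_nestedSum (exists_growthLE_of_mem (b := b) (k := k) (L := i :: L))
    (abs_lt.2 ⟨by linarith, h1⟩)).const_mul ((1 - q) ^ ((i :: L).map fun j => blockDeg k j + j.2).sum)
  refine tendsto_nhds_unique ht (hs.congr fun N => ?_)
  have h2 : (1 - q) ^ ((i :: L).map fun j => blockDeg k j + j.2).sum =
      ((i :: L).map fun j => (1 - q) ^ (blockDeg k j + j.2)).prod := by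
    generalize i :: L = L'
    induction L' with
    | nil => simp
    | cons j L' ih => rw [List.map_cons, List.sum_cons, pow_add, ih, List.map_cons, List.prod_cons]
  rw [h2, List.map_map]
  exact (nestedSum_mul (fun j : ℕ × ℕ => (1 - q) ^ (blockDeg k j + j.2))
    (fun j m => qValue (lambert (blockItem b k j) m) q) (i :: L) N).symm

/-- Dominated convergence. The condition `hk` says that the word is admissible; it gives the
outermost sum its decay `1/m²`. -/
theorem tendsto_nestedLambert (b : Mould ℚ) {k : ℕ → ℕ} (hk : 1 ≤ k 0) {r : ℕ} (c : Composition r) :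
    Tendsto (fun q => (1 - q) ^ (∑ t ∈ Finset.range r, (k t + 1)) *
      qValue (nestedLambert (blockList b k c)) q) (𝓝[<] 1)
      (𝓝 (nestedTsum ((compItems c).map (limitItem k)))) := by
  have hmem : ∀ j ∈ compItems c, 1 ≤ j.2 := fun j hj => one_le_of_mem_compItems hj
  rw [blockList_eq_map, ← sum_blockDeg_add c]
  rcases Nat.eq_zero_or_pos r with rfl | hr
  · have h0 : compItems c = [] := by
      rw [compItems, List.ofFn_eq_nil_iff]
      exact Nat.le_zero.1 c.length_le
    have h1 : nestedLambert ([] : List (ℕ → ℚ)) = 1 := by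
      ext n
      simp [nestedLambert]
    simp only [h0, List.map_nil, h1, qValue_one, nestedTsum]
    simp
  · obtain ⟨n, L, h⟩ := compItems_eq_cons hr.ne' c
    rw [h] at hmem ⊢
    -- The first block contains the first index, so its degree is at least `k 0`.
    have hd : 1 ≤ blockDeg k (0, n) := by
      have hn : 0 < n := hmem (0, n) (by simp)
      refine hk.trans ?_
      have := Finset.single_le_sum (f := fun t => k (0 + t)) (fun _ _ => Nat.zero_le _)
        (Finset.mem_range.2 hn)
      simpa [blockDeg] using this
    obtain ⟨C, hC⟩ := exists_forall_abs_scaledItem_le b k hmem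
    refine (tendsto_nestedTsum (F := fun q => scaledItem b k q) (g := limitItem k) (C := C)
      (fun j hj a => tendsto_scaledItem b k (hmem j hj) a) ?_ ?_).congr' ?_
    · filter_upwards [eventually_mem_Ioo] with q hq a
      exact (hC _ (by simp) q hq.1 hq.2 a).2 hd
    · filter_upwards [eventually_mem_Ioo] with q hq j hj a
      exact (hC j (by simp [hj]) q hq.1 hq.2 a).1
    · filter_upwards [eventually_mem_Ioo] with q hq
      exact nestedTsum_scaledItem b k hmem hd hq.1 hq.2

theorem nestedTsum_limitItem_ones (ks : List ℕ+) :
    nestedTsum ((compItems (Composition.ones ks.length)).map (limitItem (expFun ks))) = mzv ks := by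
  rw [mzv, compItems_ones]
  congr 1
  refine List.ext_getElem (by simp) fun i h1 h2 => ?_
  have hi : i < ks.length := by simpa using h2
  ext m
  have hpos := (ks[i]).pos
  simp only [List.getElem_map, List.getElem_range, limitItem, if_true, zetaTerm, expFun,
    List.getElem?_eq_getElem hi, Option.getD_some]
  congr 2
  omega

theorem nestedTsum_limitItem_of_ne_ones (k : ℕ → ℕ) {r : ℕ} {c : Composition r}
    (hc : c ≠ Composition.ones r) : nestedTsum ((compItems c).map (limitItem k)) = 0 := by
  obtain ⟨i, hi, h1⟩ := exists_mem_compItems_ne_one hc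
  refine nestedTsum_eq_zero (List.mem_map.2 ⟨i, hi, ?_⟩)
  ext m
  simp [limitItem, h1]

/-! ### Combinatorial multiple Eisenstein series -/

section G

variable {b : Mould ℚ}

theorem polyGrowth_sum_nestedLambert (k : ℕ → ℕ) (r : ℕ) :
    PolyGrowth (∑ c : Composition r, nestedLambert (blockList b k c)) :=
  PolyGrowth.sum fun c _ => by
    rw [blockList_eq_map]
    exact polyGrowth_nestedLambert exists_growthLE_of_mem

theorem polyGrowth_G (h : b.IsEDS) (h1 : b.coeff [1] = 0) (ks : List ℕ+) : PolyGrowth (G b ks) := by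
  rw [G_eq_sum h h1]
  exact PolyGrowth.sum fun j _ => (polyGrowth_sum_nestedLambert _ j).mul (PolyGrowth.const _)

/-- A nonempty nest of Lambert series has no constant term, so only the empty composition remains,
with the full `β`. -/
theorem constantCoeff_G (h : b.IsEDS) (h1 : b.coeff [1] = 0) (ks : List ℕ+) :
    PowerSeries.constantCoeff (G b ks) = b.coeff ks := by
  have hc : ∀ {j : ℕ} (c : Composition j),
      PowerSeries.constantCoeff (nestedLambert (blockList b (expFun ks) c)) =
        if j = 0 then 1 else 0 := by
    intro j c
    simp only [constantCoeff_nestedLambert, blockList, List.ofFn_eq_nil_iff, c.length_eq_zero]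
  rw [G_eq_sum h h1, map_sum, Finset.sum_eq_single 0]
  · rw [map_mul, map_sum, Finset.sum_congr rfl fun c _ => hc c, PowerSeries.constantCoeff_C,
      Mould.coeff_eq_cf]
    simp [composition_card]
  · intro j _ hj
    rw [map_mul, map_sum, Finset.sum_congr rfl fun c _ => hc c, Finset.sum_eq_zero, zero_mul]
    intro c _
    rw [if_neg hj]
  · simp

theorem tendsto_sum_nestedLambert (b : Mould ℚ) {k : ℕ → ℕ} (hk : 1 ≤ k 0) (r : ℕ) :
    Tendsto (fun q => (1 - q) ^ (∑ t ∈ Finset.range r, (k t + 1)) *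
      qValue (∑ c : Composition r, nestedLambert (blockList b k c)) q) (𝓝[<] 1)
      (𝓝 (nestedTsum ((compItems (Composition.ones r)).map (limitItem k)))) := by
  have h1 := tendsto_finsetSum (Finset.univ : Finset (Composition r))
    fun c _ => tendsto_nestedLambert b hk c
  rw [Finset.sum_eq_single (Composition.ones r)
    (fun c _ hc => nestedTsum_limitItem_of_ne_ones k hc) (by simp)] at h1
  refine h1.congr' ?_
  filter_upwards [eventually_mem_Ioo] with q hq
  rw [PolyGrowth.qValue_sum (fun c _ => ?_) (abs_lt.2 ⟨by linarith [hq.1], hq.2⟩), Finset.mul_sum]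
  rw [blockList_eq_map]
  exact polyGrowth_nestedLambert exists_growthLE_of_mem

theorem tendsto_G (h : b.IsEDS) (h1 : b.coeff [1] = 0) {ks : List ℕ+} (hks : Admissible ks) :
    Tendsto (fun q => (1 - q) ^ weight ks * qValue (G b ks) q) (𝓝[<] 1) (𝓝 (mzv ks)) := by
  rcases ks with - | ⟨a, ks⟩
  · have hG : G b [] = 1 := by
      rw [G_eq_sum h h1]
      have hc : ∀ c : Composition 0, nestedLambert (blockList b (expFun []) c) = 1 := fun c => by
        have : blockList b (expFun []) c = [] := by
          rw [blockList, List.ofFn_eq_nil_iff, c.length_eq_zero]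
        rw [this]
        ext n
        simp [nestedLambert]
      simp [hc, h.1.cf_zero, composition_card]
    simp [hG, qValue_one, weight, mzv, nestedTsum]
  · set w := a :: ks with hw
    have hk : 1 ≤ expFun w 0 := by
      have ha : a ≠ 1 := fun ha => hks (congrArg some ha)
      have h2 : (a : ℕ) ≠ 1 := fun h2 => ha (PNat.coe_injective h2)
      have := a.pos
      simp only [hw, expFun, List.getElem?_cons_zero, Option.getD_some]
      omega
    -- The weight is split at `j`. The number `β` of the last indices needs no scaling, so their
    -- share of the power of `1 - q` forces the limit `0` unless there are none.
    have hterm : ∀ j ∈ Finset.range (w.length + 1), Tendsto (fun q : ℝ =>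
        (1 - q) ^ (∑ t ∈ Finset.Ico j w.length, (expFun w t + 1)) *
        ((1 - q) ^ (∑ t ∈ Finset.range j, (expFun w t + 1)) *
          qValue (∑ c : Composition j, nestedLambert (blockList b (expFun w) c)) q) *
        ((b.cf (w.length - j) fun i => expFun w (j + i) : ℚ) : ℝ)) (𝓝[<] 1)
        (𝓝 (if j = w.length then mzv w else 0)) := by
      intro j hj
      have h2 := tendsto_sum_nestedLambert b hk j
      split_ifs with hjw
      · subst hjw
        rw [nestedTsum_limitItem_ones] at h2
        simpa [h.1.cf_zero] using h2
      · have hlt : j < w.length := by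
          have := Finset.mem_range.1 hj
          omega
        have hne : ∑ t ∈ Finset.Ico j w.length, (expFun w t + 1) ≠ 0 := by
          refine (Finset.sum_pos (fun t _ => Nat.succ_pos _) ?_).ne'
          simpa using hlt
        have h3 := ((tendsto_one_sub_pow hne).mul h2).mul_const
          ((b.cf (w.length - j) fun i => expFun w (j + i) : ℚ) : ℝ)
        rwa [zero_mul, zero_mul] at h3
    have hsum := tendsto_finsetSum _ hterm
    rw [Finset.sum_ite_eq' _ w.length, if_pos (by simp)] at hsum
    refine hsum.congr' ?_
    filter_upwards [eventually_mem_Ioo] with q hq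
    have hq' : |q| < 1 := abs_lt.2 ⟨by linarith [hq.1], hq.2⟩
    rw [G_eq_sum h h1, PolyGrowth.qValue_sum (fun j _ =>
      (polyGrowth_sum_nestedLambert _ j).mul (PolyGrowth.const _)) hq', Finset.mul_sum]
    refine Finset.sum_congr rfl fun j hj => ?_
    have hjw : j ≤ w.length := Nat.lt_succ_iff.1 (Finset.mem_range.1 hj)
    rw [PolyGrowth.qValue_mul (polyGrowth_sum_nestedLambert _ j) (PolyGrowth.const _) hq', qValue_C,
      ← sum_expFun_add_one, ← Finset.sum_range_add_sum_Ico _ hjw, pow_add]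
    ring

theorem polyGrowth_GMap (h : b.IsEDS) (h1 : b.coeff [1] = 0) (u : Words ℕ+) :
    PolyGrowth (GMap b u) := by
  rw [GMap, Finsupp.linearCombination_apply, Finsupp.sum]
  refine PolyGrowth.sum fun w _ => ?_
  rw [PowerSeries.smul_eq_C_mul]
  exact (PolyGrowth.const _).mul (polyGrowth_G h h1 w)

theorem tendsto_GMap (h : b.IsEDS) (h1 : b.coeff [1] = 0) {n : ℕ} {x : StuffleAlg}
    (hx : x ∈ admSpace n) :
    Tendsto (fun q => (1 - q) ^ n * qValue (GMap b (ofWords.symm x)) q) (𝓝[<] 1)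
      (𝓝 (mzvMap x)) := by
  induction hx using Submodule.span_induction with
  | mem x hx =>
    obtain ⟨w, ⟨hw, rfl⟩, rfl⟩ := hx
    have h2 : GMap b (ofWords.symm (sword w)) = G b w := by simp [GMap, sword, word]
    rw [h2, mzvMap_sword]
    exact tendsto_G h h1 hw
  | zero =>
    have h2 : ∀ q, qValue (0 : PowerSeries ℚ) q = 0 := fun q => by simp [qValue, qTerm]
    simp [h2]
  | add x y _ _ hx hy =>
    rw [map_add mzvMap]
    refine (hx.add hy).congr' ?_
    filter_upwards [eventually_mem_Ioo] with q hq
    rw [map_add, map_add, PolyGrowth.qValue_add (polyGrowth_GMap h h1 _) (polyGrowth_GMap h h1 _)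
      (abs_lt.2 ⟨by linarith [hq.1], hq.2⟩), mul_add]
  | smul c x _ hx =>
    rw [map_smul mzvMap, Rat.smul_def]
    refine (hx.const_mul (c : ℝ)).congr' ?_
    filter_upwards [eventually_mem_Ioo] with q hq
    rw [map_smul, map_smul, PowerSeries.smul_eq_C_mul, PolyGrowth.qValue_mul (PolyGrowth.const _)
      (polyGrowth_GMap h h1 _) (abs_lt.2 ⟨by linarith [hq.1], hq.2⟩), qValue_C]
    ring

theorem hasStuffleRegLimit (h : b.IsEDS) (h1 : b.coeff [1] = 0) (ks : List ℕ+) :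
    HasStuffleRegLimit b ks (zetaStar (word ks)) := by
  obtain ⟨c, hc, hexp⟩ := isH0Expansion_toPoly (word ks)
  refine ⟨c, hexp, fun c' hc' => ?_, ?_⟩
  · ext1 j
    exact ofWords.injective ((hc'.apply_eq j).trans (hc j).symm)
  -- `w_0` is the constant coefficient in `z_1`, a combination of admissible words of the weight of
  -- `ks`, so the limit can be taken word by word with one power of `1 - q`.
  · have h2 := tendsto_GMap h h1 (coeff_zero_toPoly_mem ks)
    rw [zetaStar_apply, ofWords_word]
    rwa [← ofWords_word, ← hc 0, LinearEquiv.symm_apply_apply, hc 0, ofWords_word] at h2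

end G

end

end CombMES

theorem proposition5p12 (b : CombMES.Mould ℚ) (hb : b.IsEDS) (hb1 : b.HasBernoulliDepthOne) :
    (∀ ks : List ℕ+,
      PowerSeries.constantCoeff (CombMES.G b ks) = b.coeff ks ∧
      (∀ q : ℝ, |q| < 1 → Summable (CombMES.qTerm (CombMES.G b ks) q)) ∧
      Tendsto (CombMES.qValue (CombMES.G b ks)) (𝓝[≠] 0) (𝓝 ((b.coeff ks : ℚ) : ℝ))) ∧
    ∃ zetaStar : CombMES.Words ℕ+ →ₗ[ℚ] ℝ,
      CombMES.IsStuffleRegZeta zetaStar ∧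
      (∀ φ, CombMES.IsStuffleRegZeta φ → φ = zetaStar) ∧
      ∀ ks : List ℕ+, CombMES.HasStuffleRegLimit b ks (zetaStar (CombMES.word ks)) := by
  have h1 : b.coeff [1] = 0 := (hb1 1).trans (if_pos rfl)
  refine ⟨fun ks => ⟨CombMES.constantCoeff_G hb h1 ks,
    fun q hq => (CombMES.polyGrowth_G hb h1 ks).summable hq, ?_⟩, CombMES.zetaStar,
    CombMES.isStuffleRegZeta_zetaStar, fun φ hφ => hφ.eq_zetaStar,
    CombMES.hasStuffleRegLimit hb h1⟩
  have h2 := (CombMES.polyGrowth_G hb h1 ks).tendsto_qValue_zero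
  rw [CombMES.constantCoeff_G hb h1] at h2
  exact h2.mono_left nhdsWithin_le_nhds
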